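/- Let $\xi(s)=\tfrac12\,\pi^{-s/2}\,2\Gamma(1+s/2)\,(s-1)\,\zeta(s)$ (an entire function, removable singularities removed) and $n(s)=\sin(\pi s/4)\cdot 2\xi(\tfrac12+s)$. For real $x$ that is not a multiple of $4$ and real $t,t_1,t_2$, put $m_x(t)=|1-n(x)/n(x+it)|^{1/2}$ if $n(x+it)\ne 0$, $m_x(t)=\infty$ if $n(x+it)=0$, and $d_x(t_1,t_2)=m_x(t_1-t_2)$. A function $m:\mathbb R\to[0,\infty]$ is called a (finite-valued) metric norm if $m(t)<\infty$, $m(t)=0\iff t=0$, $m(-t)=m(t)$ and $m(s+t)\le m(s)+m(t)$ for all real $s,t$. **Conjectures.** Let $\gamma_1<\gamma_2<\cdots$ be the distinct positive imaginary parts of the zeros of $\zeta$, $\gamma_0=0$; for $k\ge1$ let $\delta_k=\min\{\gamma_k-\gamma_{k-1},\gamma_{k+1}-\gamma_k\}$ and $\delta_k'=\min\{1/\log|\gamma_k|,\delta_k\}$. For $0<\alpha<\tfrac12$ let $T_*(\alpha)$ be the union over $k\ge 1$ of the segments $\{it:\gamma_k+\alpha\delta'_k<t<\gamma_{k+1}-\alpha\delta'_{k+1}\}$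 and the semicircles $\{s:|s-i\gamma_k|=\alpha\delta_k',\ \operatorname{Re}s\ge0\}$; for $t>\gamma_1-\alpha\delta_1'$ let $s(t,\alpha)$ be the unique point of $T_*(\alpha)$ with imaginary part $t$. Let $j_k(\alpha)=\min\{|\zeta(\tfrac12+it)/(t-\gamma_k)|:|t-\gamma_k|\le\alpha\delta_k'\}$, the quotient being read as $\zeta'(\tfrac12+i\gamma_k)$ at $t=\gamma_k$. For a real sequence $(u_k)_{k\ge1}$ let $e(u)$ be the least $\varepsilon\ge0$ such that for each $\sigma>0$ there is $K>0$ with $u_k>K\gamma_k^{-(\varepsilon+\sigma)}$ for all $k\ge1$, if such $\varepsilon$ exist. Put $\varepsilon_1=e(|\zeta'(\tfrac12+i\gamma_k)|)$, $\varepsilon_2=e(\delta_k)$, $\tilde\varepsilon_1(\alpha)=e(j_k(\alpha))$. Then $C^\wedge$ is the conjunction of: the Riemann hypothesis; (C3) $\varepsilon_1,\varepsilon_2$ exist and $\varepsilon_1+\varepsilon_2<\tfrac34$; and there is $\alpha\in(0,\tfrac12)$ such that (C1) there are $\varepsilon>0$ for which some $\lambda>0$ satisfies $|\zeta(\tfrac12+s(t,\alpha))|>\lambda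 t^{-\varepsilon}$ for all $t>\gamma_1-\alpha\delta'_1$, and the infimum of these $\varepsilon$ is less than $\tfrac34$; and (C4) $\tilde\varepsilon_1(\alpha)$ exists and $\tilde\varepsilon_1(\alpha)+\varepsilon_2\le1$. Let $c(z)=1/n'(z)$, $A=2\sum_{k\ge1}|c(i\gamma_k)|\in[0,\infty]$, and $P_0(v)=-\sum_{k\ge1}\tilde c(4k)(-v^2)^k$ with $\tilde c(4k)=1/\bigl(\pi^{3/4}\Gamma(\tfrac54+2k)(2k-\tfrac14)\zeta(\tfrac12+4k)\bigr)$. Then C5 is the conjunction of: (i) $A<\infty$ and $0<c(0)-A$; (ii) $c(0)-A<P_0(\pi)$; (iii) $P_0(v)>0$ for $\pi<v\le\pi/v_0$, where $v_0\in(0,1)$ is given by $P_0(\pi v_0)=c(0)-A$. **Statement.** 1. Let $x$ be real with $|x|>4$, $x$ not a multiple of $4$. Then $m_x$ is a finite-valued metric norm on $\mathbb R$, and $d_x$ is a (finite-valued) translation-invariant metric on $\mathbb R$. 2. Assume $C^\wedge$ and C5. Then the same holds for every real $x$ with $0<x<4$. 3. Assume $C^\wedge$, $A<\infty$ and, in place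 of C5, $c(0)-A\ge P_0(\pi)$. Then the same holds for every real $x$ with $0<x<4$. -/

import Mathlib

open scoped ENNReal

noncomputable section

namespace Csizmazia

/-! ### The entire functions `ξ` and `n` -/

/-- `l(s) = π^{-s/2} · 2 Γ(1 + s/2)`. -/
def lFun (s : ℂ) : ℂ := (Real.pi : ℂ) ^ (-s / 2) * (2 * Complex.Gamma (1 + s / 2))

/-- `a(s) = l(s)(s - 1)`. -/
def aFun (s : ℂ) : ℂ := lFun s * (s - 1)

/-- Riemann's entire function `ξ(s) = (1/2) a(s) ζ(s)`. The product has removable singularities at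
`s = 1` and `s = -2, -4, …`; the entire function is written here through Mathlib's entire function
`Λ₀(s) = π^{-s/2} Γ(s/2) ζ(s) + 1/s + 1/(1 - s)`. The two lemmas after this definition show that
`xi` is entire and equals `(1/2) a(s) ζ(s)` away from these points. -/
def xi (s : ℂ) : ℂ := (1 / 2) * (s * (s - 1) * completedRiemannZeta₀ s + 1)

theorem differentiable_xi : Differentiable ℂ xi := by
  unfold xi
  have := differentiable_completedZeta₀
  fun_prop

theorem xi_eq {s : ℂ} (h1 : s ≠ 1) (h2 : ∀ k : ℕ, s ≠ -2 * (k + 1)) :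
    xi s = (1 / 2) * aFun s * riemannZeta s := by
  rcases eq_or_ne s 0 with rfl | h0
  · norm_num [xi, aFun, lFun, riemannZeta_zero]
  · have hs2 : s / 2 ≠ 0 := by simpa using h0
    have hG : Complex.Gamma (s / 2) ≠ 0 := by
      rw [Ne, Complex.Gamma_eq_zero_iff]
      rintro ⟨m, hm⟩
      rcases m with _ | m
      · simp at hm; exact h0 hm
      · refine h2 m ?_
        push_cast at hm
        linear_combination 2 * hm
    have hpi : (Real.pi : ℂ) ^ (-s / 2) ≠ 0 := by
      rw [Ne, Complex.cpow_eq_zero_iff]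
      simp [Real.pi_ne_zero]
    have h1' : (1 : ℂ) - s ≠ 0 := sub_ne_zero.mpr h1.symm
    rw [riemannZeta_eq_completedRiemannZeta₀ h0, xi, aFun, lFun, add_comm 1 (s / 2),
      Complex.Gamma_add_one _ hs2]
    field_simp
    ring

/-- The entire function `n(s) = sin(π s / 4) · 2 ξ(1/2 + s)`. -/
def nFun (s : ℂ) : ℂ := Complex.sin (Real.pi * s / 4) * (2 * xi (1 / 2 + s))

/-! ### Metric norms -/

/-- `m_x(t) = |1 - n(x)/n(x+it)|^{1/2}`, with value `∞` where `n(x+it) = 0`. -/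
def mNorm (x t : ℝ) : ℝ≥0∞ :=
  if nFun (x + t * Complex.I) = 0 then ⊤
  else ENNReal.ofReal (Real.sqrt ‖1 - nFun x / nFun (x + t * Complex.I)‖)

/-- `d_x(t₁, t₂) = m_x(t₁ - t₂)`. -/
def dMetric (x t₁ t₂ : ℝ) : ℝ≥0∞ := mNorm x (t₁ - t₂)

/-- A finite-valued metric norm on the additive group of real numbers. -/
structure IsFiniteMetricNorm (m : ℝ → ℝ≥0∞) : Prop where
  finite : ∀ t, m t ≠ ⊤
  eq_zero_iff : ∀ t, m t = 0 ↔ t = 0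
  neg : ∀ t, m (-t) = m t
  add_le : ∀ s t, m (s + t) ≤ m s + m t

/-- A (finite-valued) translation-invariant metric on the real line. -/
structure IsTranslationInvariantMetric (d : ℝ → ℝ → ℝ≥0∞) : Prop where
  finite : ∀ t₁ t₂, d t₁ t₂ ≠ ⊤
  eq_zero_iff : ∀ t₁ t₂, d t₁ t₂ = 0 ↔ t₁ = t₂
  symm : ∀ t₁ t₂, d t₁ t₂ = d t₂ t₁
  triangle : ∀ t₁ t₂ t₃, d t₁ t₃ ≤ d t₁ t₂ + d t₂ t₃
  translate : ∀ a t₁ t₂, d (t₁ + a) (t₂ + a) = d t₁ t₂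

/-! ### Ordinates of the zeros of zeta in the upper half-plane -/

/-- The set of imaginary parts of the zeros of `ζ` with positive imaginary part. -/
def ordinates : Set ℝ := {y | 0 < y ∧ ∃ z : ℂ, riemannZeta z = 0 ∧ z.im = y}

/-- `γ_1 < γ_2 < …`, the elements of `ordinates` in increasing order, preceded by `γ_0 = 0`:
each `γ_{k+1}` is the least ordinate larger than `γ_k`. -/
def gam : ℕ → ℝ
  | 0 => 0
  | k + 1 => sInf {y | y ∈ ordinates ∧ gam k < y}

/-- `δ_k = min {γ_k - γ_{k-1}, γ_{k+1} - γ_k}`, for `k ≥ 1`. -/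
def delta (k : ℕ) : ℝ := min (gam k - gam (k - 1)) (gam (k + 1) - gam k)

/-- `δ_k' = min {1 / log |γ_k|, γ_k - γ_{k-1}, γ_{k+1} - γ_k}`, for `k ≥ 1`. -/
def delta' (k : ℕ) : ℝ := min (1 / Real.log |gam k|) (delta k)

/-! ### The compound conjecture `C^` -/

/-- The open segment of the imaginary axis with ordinates in
`(γ_k + α δ_k', γ_{k+1} - α δ_{k+1}')`. -/
def segI (α : ℝ) (k : ℕ) : Set ℂ :=
  {s | s.re = 0 ∧ gam k + α * delta' k < s.im ∧ s.im < gam (k + 1) - α * delta' (k + 1)}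

/-- The closed right semicircle with centre `iγ_k` and radius `α δ_k'`. -/
def semiS (α : ℝ) (k : ℕ) : Set ℂ :=
  {s | ‖s - gam k * Complex.I‖ = α * delta' k ∧ 0 ≤ s.re}

/-- The path `T_*(α)`, the union over `k ≥ 1` of these segments and semicircles. -/
def pathT (α : ℝ) : Set ℂ := {s | ∃ k : ℕ, 1 ≤ k ∧ (s ∈ segI α k ∨ s ∈ semiS α k)}

/-- `t(1) = γ_1 - α δ_1'`. -/
def tOne (α : ℝ) : ℝ := gam 1 - α * delta' 1

/-- The `ε > 0` for which there is `λ > 0` with `|ζ(1/2 + s(t, α))| > λ t^{-ε}` for all `t > t(1)`;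
here `s(t, α)` is the only point of `T_*(α)` with imaginary part `t`. -/
def pathExponents (α : ℝ) : Set ℝ :=
  {ε | 0 < ε ∧ ∃ lam : ℝ, 0 < lam ∧
    ∀ s ∈ pathT α, tOne α < s.im → lam * s.im ^ (-ε) < ‖riemannZeta (1 / 2 + s)‖}

/-- Conjecture 1 for the parameter `α`: `0 < α < 1/2`, such `ε` exist, and their infimum `ε_0` is
less than `3/4`. -/
def C1 (α : ℝ) : Prop :=
  0 < α ∧ α < 1 / 2 ∧ (pathExponents α).Nonempty ∧ sInf (pathExponents α) < 3 / 4

/-- The `ε ≥ 0` such that for every `σ > 0` there is `K > 0` with `u_k > K γ_k^{-(ε+σ)}` for all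
`k ≥ 1`. If this set is nonempty, it has a least element. -/
def exponents (u : ℕ → ℝ) : Set ℝ :=
  {ε | 0 ≤ ε ∧ ∀ σ : ℝ, 0 < σ → ∃ K : ℝ, 0 < K ∧ ∀ k : ℕ, 1 ≤ k → K * gam k ^ (-(ε + σ)) < u k}

/-- `|ζ'(1/2 + iγ_k)|`. -/
def zetaDeriv (k : ℕ) : ℝ := ‖deriv riemannZeta (1 / 2 + gam k * Complex.I)‖

/-- `ε_1`. -/
def eps1 : ℝ := sInf (exponents zetaDeriv)

/-- `ε_2`. -/
def eps2 : ℝ := sInf (exponents delta)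

/-- Conjecture 3: `ε_1` and `ε_2` exist, and `ε_1 + ε_2 < 3/4`. -/
def C3 : Prop :=
  (exponents zetaDeriv).Nonempty ∧ (exponents delta).Nonempty ∧ eps1 + eps2 < 3 / 4

/-- `|ζ(1/2 + it)/(t - γ_k)|`, read as `|ζ'(1/2 + iγ_k)|` at `t = γ_k`. -/
def zetaQuot (k : ℕ) (t : ℝ) : ℝ :=
  if t = gam k then zetaDeriv k else ‖riemannZeta (1 / 2 + t * Complex.I)‖ / |t - gam k|

/-- `j_k(α)`, the minimum of `|ζ(1/2 + it)/(t - γ_k)|` over `|t - γ_k| ≤ α δ_k'`. -/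
def jMin (α : ℝ) (k : ℕ) : ℝ := sInf (zetaQuot k '' {t : ℝ | |t - gam k| ≤ α * delta' k})

/-- `ε̃_1` for the parameter `α`. -/
def epsTilde1 (α : ℝ) : ℝ := sInf (exponents (jMin α))

/-- The conditions of Conjecture 4 on `α`: `ε̃_1` exists, and `ε̃_1 + ε_2 ≤ 1`. -/
def C4 (α : ℝ) : Prop := (exponents (jMin α)).Nonempty ∧ epsTilde1 α + eps2 ≤ 1

/-- The compound conjecture `C^`: the Riemann hypothesis, Conjecture 3, and Conjectures 1 and 4
with the same `α`. -/
def CHat : Prop := RiemannHypothesis ∧ C3 ∧ ∃ α : ℝ, C1 α ∧ C4 α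

/-! ### Conjecture 5 -/

/-- `c(0) = 1 / n'(0)`, a real number. -/
def cZero : ℝ := (1 / deriv nFun 0).re

/-- `A = 2 ∑_{k ≥ 1} |c(iγ_k)|` with `c(z) = 1 / n'(z)`, as an extended nonnegative real. -/
def bigA : ℝ≥0∞ := 2 * ∑' k : ℕ, ‖deriv nFun (gam (k + 1) * Complex.I)‖ₑ⁻¹

/-- `c̃(4k) = 1 / (π^{3/4} Γ(5/4 + 2k) (2k - 1/4) ζ(1/2 + 4k))`. -/
def cTilde (k : ℕ) : ℝ :=
  1 / (Real.pi ^ (3 / 4 : ℝ) * Real.Gamma (5 / 4 + 2 * k) * (2 * k - 1 / 4) *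
    (riemannZeta (1 / 2 + 4 * k)).re)

/-- `P_0(v) = - ∑_{k ≥ 1} c̃(4k) (-v²)^k`, for real `v`. -/
def P0 (v : ℝ) : ℝ := -∑' k : ℕ, cTilde (k + 1) * (-v ^ 2) ^ (k + 1)

/-- Conjecture 5: `A` is finite, `0 < c(0) - A < P_0(π)`, and `P_0 > 0` on `(π, π/v_0]`, where
`0 < v_0 < 1` is given by `P_0(π v_0) = c(0) - A`. -/
def C5 : Prop :=
  bigA < ⊤ ∧ 0 < -bigA.toReal + cZero ∧ -bigA.toReal + cZero < P0 Real.pi ∧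
    ∃ v₀ : ℝ, 0 < v₀ ∧ v₀ < 1 ∧ P0 (Real.pi * v₀) = -bigA.toReal + cZero ∧
      ∀ v : ℝ, Real.pi < v → v ≤ Real.pi / v₀ → 0 < P0 v

end Csizmazia

end

open scoped ENNReal

noncomputable section

open MeasureTheory Set Filter Topology

namespace Csizmazia

/-! ### Metric norms from Fourier transforms of nonnegative densities -/

/-! Everything rests on one principle. If `1 / n` on the line through `x` is, up to a constant, the
Fourier transform of an integrable density `f ≥ 0`, then `1 - n(x)/n(x+it)` is a positive constant
times `D(t) = ∫ f (1 - e^{-itu/2})`, and `√|D|` is a metric norm. With `a = e^{-isu/2}` and `b =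
e^{-itu/2}`, the identity `1 - ab = (1 - a) + (1 - b) - (1 - a)(1 - b)` and weighted AM-GM bound the
product term by `l Re D(s) + l⁻¹ Re D(t)`. Optimizing `l` gives `|D(s+t)| ≤ (√|D(s)| + √|D(t)|)²`
(`sqrt_norm_defect_add_le`, `isFiniteMetricNorm_of_density`).

The densities come from multiplicative convolution: averaging `g(v y)` over `y` with weight `h`
multiplies the transform of `g(e^u)` by the moment `∫ h y^z` (`lap_mixture`). The function `1 - cos`
has transform `π / (2 sin(πz/2) Γ(1+z))`, beta weights contribute quotients of Gamma values, and
Möbius weights on the points `1/n²` contribute `1/ζ`. Together they rebuild `1/n(2z)` in any strip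
where the Dirichlet series of `1/ζ` converges absolutely. For `x > 4` this covers the whole strip,
and the kernel is nonnegative because the `n = 1` term of the Möbius sum dominates the others
(`moebiusMix_cosKernel_nonneg`). Negative `x` follows from the oddness of `n`.

For `0 < x < 4` the same construction yields `P_0(πv)`, identified by its Taylor coefficients, but
represents `2/n(2z)` only for `1/4 < re z < 2`. Both the missing part of the strip and the sign of
`P_0` come from the reflection formula `P_0(πv) + P_0(π/v) = ∑ c(2ρ) v^ρ`, summed over the zeros `ρ`
of `n(2z)` on the imaginary axis (`StripData.add_refl_eq`). The Laplace transform of the difference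
of its two sides continues to an odd entire function, since the poles of `1/n(2z)` cancel against
those of the sum. Borel–Carathéodory bounds this function off the imaginary axis by `exp(K(1+|im
z|)/|re z|)`; a maximum-principle argument on a square removes the blow-up at the axis, and
Phragmén–Lindelöf and Liouville make the function constant, hence zero. Fourier inversion then gives
the formula.

The right side of the reflection formula is at least `c(0) - A`. Since `P_0` is positive and
increasing on `(0, π]` (alternating series), the hypotheses on `c(0) - A` give `P_0 ≥ 0` on the
whole half-line (`P0_nonneg_of_C5`, `P0_nonneg_of_ge`). -/

/-- `∫ f(u) (1 - e^{-itu/2}) du`. -/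
def defect (f : ℝ → ℝ) (t : ℝ) : ℂ :=
  ∫ u, (f u : ℂ) * (1 - Complex.exp (-(t / 2 * u : ℝ) * Complex.I))

theorem norm_exp_neg_mul_I (a : ℝ) : ‖Complex.exp (-(a : ℂ) * Complex.I)‖ = 1 := by
  simpa using Complex.norm_exp_ofReal_mul_I (-a)

theorem integrable_mul_of_norm_le {f : ℝ → ℝ} (hf : Integrable f) {g : ℝ → ℂ} (hg : Continuous g)
    {C : ℝ} (hC : ∀ u, ‖g u‖ ≤ C) : Integrable fun u => (f u : ℂ) * g u :=
  hf.ofReal.mul_bdd (c := C) hg.aestronglyMeasurable (ae_of_all _ hC)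

theorem integrable_mul_exp_I {f : ℝ → ℝ} (hf : Integrable f) (t : ℝ) :
    Integrable fun u => (f u : ℂ) * Complex.exp (-(t / 2 * u : ℝ) * Complex.I) :=
  integrable_mul_of_norm_le hf (by fun_prop) fun u => (norm_exp_neg_mul_I _).le

theorem integrable_defect {f : ℝ → ℝ} (hf : Integrable f) (t : ℝ) :
    Integrable fun u => (f u : ℂ) * (1 - Complex.exp (-(t / 2 * u : ℝ) * Complex.I)) := by
  simp only [mul_sub, mul_one]
  exact hf.ofReal.sub (integrable_mul_exp_I hf t)

theorem norm_one_sub_exp_sq (a : ℝ) :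
    ‖1 - Complex.exp (-(a : ℂ) * Complex.I)‖ ^ 2 = 2 * (1 - Real.cos a) := by
  have h : Complex.exp (-(a : ℂ) * Complex.I) = Real.cos a - Real.sin a * Complex.I := by
    rw [Complex.exp_mul_I]; simp; ring
  rw [h, Complex.sq_norm, Complex.normSq_apply]
  simp only [Complex.sub_re, Complex.one_re, Complex.sub_im, Complex.one_im, Complex.mul_re,
    Complex.mul_im, Complex.I_re, Complex.I_im, Complex.ofReal_re, Complex.ofReal_im]
  nlinarith [Real.sin_sq_add_cos_sq a]

theorem integrable_mul_one_sub_cos {f : ℝ → ℝ} (hf : Integrable f) (t : ℝ) :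
    Integrable fun u => f u * (1 - Real.cos (t / 2 * u)) := by
  refine hf.mul_bdd (c := 2) (Continuous.aestronglyMeasurable (by fun_prop))
    (ae_of_all _ fun u => ?_)
  rw [Real.norm_eq_abs, abs_le]
  constructor <;> linarith [Real.neg_one_le_cos (t / 2 * u), Real.cos_le_one (t / 2 * u)]

theorem defect_re {f : ℝ → ℝ} (hf : Integrable f) (t : ℝ) :
    (defect f t).re = ∫ u, f u * (1 - Real.cos (t / 2 * u)) := by
  have h := integral_re (integrable_defect hf t)
  simp only [RCLike.re_eq_complex_re] at h
  rw [defect, ← h]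
  congr 1 with u
  rw [Complex.re_ofReal_mul, Complex.sub_re, Complex.one_re, ← Complex.ofReal_neg,
    Complex.exp_ofReal_mul_I_re, Real.cos_neg]

/-- The factor `1 - cos(tu/2)` is nonnegative and vanishes only on a countable set of `u`, so a zero
integral would force `f = 0` almost everywhere. -/
theorem defect_re_pos {f : ℝ → ℝ} (hf : Integrable f) (h0 : ∀ u, 0 ≤ f u) (hI : ∫ u, f u ≠ 0)
    {t : ℝ} (ht : t ≠ 0) : 0 < (defect f t).re := by
  have hn : ∀ u, 0 ≤ f u * (1 - Real.cos (t / 2 * u)) := fun u =>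
    mul_nonneg (h0 u) (by linarith [Real.cos_le_one (t / 2 * u)])
  rw [defect_re hf]
  refine lt_of_le_of_ne (integral_nonneg hn) fun h => hI ?_
  have h1 := (integral_eq_zero_iff_of_nonneg hn (integrable_mul_one_sub_cos hf t)).1 h.symm
  have hc : {u : ℝ | Real.cos (t / 2 * u) = 1}.Countable := by
    refine (countable_range fun n : ℤ => (n * (2 * Real.pi)) / (t / 2)).mono fun u hu => ?_
    obtain ⟨n, hn⟩ := (Real.cos_eq_one_iff _).1 hu
    exact ⟨n, by simp only [hn]; field_simp⟩
  have h2 : f =ᵐ[volume] 0 := by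
    filter_upwards [h1, (compl_mem_ae_iff.2 (hc.measure_zero volume))] with u hu hu2
    rcases mul_eq_zero.1 hu with h | h
    · exact h
    · exact absurd (by linarith : Real.cos (t / 2 * u) = 1) hu2
  simpa using integral_congr_ae h2

theorem defect_neg (f : ℝ → ℝ) (t : ℝ) : defect f (-t) = (starRingEnd ℂ) (defect f t) := by
  rw [defect, defect, ← integral_conj]
  congr 1 with u
  simp only [map_mul, map_sub, map_one, ← Complex.exp_conj, Complex.conj_ofReal, Complex.conj_I,
    map_neg]
  congr 3
  push_cast
  ring

/-- The only obstruction to additivity of the defect is `∫ f (1 - a)(1 - b)`. Weighted AM-GM applies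
to it pointwise because `|1 - a|² = 2(1 - cos)`, which ties the squares to real parts of defects. -/
theorem norm_defect_add_le {f : ℝ → ℝ} (hf : Integrable f) (h0 : ∀ u, 0 ≤ f u) (s t : ℝ) {l : ℝ}
    (hl : 0 < l) : ‖defect f (s + t)‖ ≤ ‖defect f s‖ + ‖defect f t‖ +
      (l * (defect f s).re + l⁻¹ * (defect f t).re) := by
  set a : ℝ → ℂ := fun u => Complex.exp (-(s / 2 * u : ℝ) * Complex.I)
  set b : ℝ → ℂ := fun u => Complex.exp (-(t / 2 * u : ℝ) * Complex.I)
  have hsum : defect f (s + t) = defect f s + defect f t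
      - ∫ u, (f u : ℂ) * ((1 - a u) * (1 - b u)) := by
    rw [defect, defect, defect, ← integral_add (integrable_defect hf s) (integrable_defect hf t),
      ← integral_sub]
    · congr 1 with u
      have : Complex.exp (-((s + t) / 2 * u : ℝ) * Complex.I) = a u * b u := by
        simp only [a, b, ← Complex.exp_add]; congr 1; push_cast; ring
      rw [this]; simp only [a, b]; ring
    · exact (integrable_defect hf s).add (integrable_defect hf t)
    · refine integrable_mul_of_norm_le hf (C := 2 * 2) (by fun_prop) fun u => ?_
      rw [norm_mul]
      gcongr
      · exact (norm_sub_le _ _).trans (by rw [norm_exp_neg_mul_I]; norm_num)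
      · exact (norm_sub_le _ _).trans (by rw [norm_exp_neg_mul_I]; norm_num)
  have hprod : ‖∫ u, (f u : ℂ) * ((1 - a u) * (1 - b u))‖ ≤
      l * (defect f s).re + l⁻¹ * (defect f t).re := by
    rw [defect_re hf, defect_re hf, ← integral_const_mul, ← integral_const_mul, ← integral_add
      ((integrable_mul_one_sub_cos hf s).const_mul _)
      ((integrable_mul_one_sub_cos hf t).const_mul _)]
    refine norm_integral_le_of_norm_le (((integrable_mul_one_sub_cos hf s).const_mul _).add
      ((integrable_mul_one_sub_cos hf t).const_mul _)) (ae_of_all _ fun u => ?_)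
    rw [norm_mul, norm_mul, Complex.norm_real, Real.norm_of_nonneg (h0 u)]
    have h1 := norm_one_sub_exp_sq (s / 2 * u)
    have h2 := norm_one_sub_exp_sq (t / 2 * u)
    simp only [a, b]
    set p := ‖1 - Complex.exp (-(s / 2 * u : ℝ) * Complex.I)‖
    set q := ‖1 - Complex.exp (-(t / 2 * u : ℝ) * Complex.I)‖
    have h3 : p * q ≤ l * (1 - Real.cos (s / 2 * u)) + l⁻¹ * (1 - Real.cos (t / 2 * u)) := by
      have h4 : 0 ≤ l⁻¹ * (l * p - q) ^ 2 := by positivity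
      have h5 : l⁻¹ * (l * p - q) ^ 2 = l * p ^ 2 + l⁻¹ * q ^ 2 - 2 * (p * q) := by
        field_simp; ring
      rw [h5, h1, h2] at h4
      linarith
    calc f u * (p * q) ≤ f u * _ := mul_le_mul_of_nonneg_left h3 (h0 u)
      _ = _ := by ring
  rw [hsum]
  exact (norm_sub_le _ _).trans (add_le_add (norm_add_le _ _) hprod)

theorem sqrt_norm_defect_add_le {f : ℝ → ℝ} (hf : Integrable f) (h0 : ∀ u, 0 ≤ f u)
    (hI : ∫ u, f u ≠ 0) (s t : ℝ) :
    √‖defect f (s + t)‖ ≤ √‖defect f s‖ + √‖defect f t‖ := by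
  have hz : defect f 0 = 0 := by simp [defect]
  rcases eq_or_ne s 0 with rfl | hs
  · simp [hz]
  rcases eq_or_ne t 0 with rfl | ht
  · simp [hz]
  have hA := (defect_re_pos hf h0 hI hs).trans_le (Complex.re_le_norm _)
  have hB := (defect_re_pos hf h0 hI ht).trans_le (Complex.re_le_norm _)
  -- With `l = √B/√A` each of the two weighted real parts is at most `√A √B`, which completes the
  -- square `(√A + √B)²`.
  set A := ‖defect f s‖
  set B := ‖defect f t‖
  have hA' : 0 < √A := Real.sqrt_pos.2 hA
  have hB' : 0 < √B := Real.sqrt_pos.2 hB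
  have hl : 0 < √B / √A := by positivity
  have h := norm_defect_add_le hf h0 s t hl
  rw [inv_div] at h
  have e1 : √B / √A * (defect f s).re ≤ √A * √B := by
    calc _ ≤ √B / √A * (√A * √A) := by
          gcongr; rw [Real.mul_self_sqrt hA.le]; exact Complex.re_le_norm _
      _ = _ := by field_simp
  have e2 : √A / √B * (defect f t).re ≤ √A * √B := by
    calc _ ≤ √A / √B * (√B * √B) := by
          gcongr; rw [Real.mul_self_sqrt hB.le]; exact Complex.re_le_norm _
      _ = _ := by field_simp
  refine Real.sqrt_le_iff.2 ⟨by positivity, ?_⟩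
  nlinarith [Real.sq_sqrt hA.le, Real.sq_sqrt hB.le]

theorem IsFiniteMetricNorm.isTranslationInvariantMetric {m : ℝ → ℝ≥0∞} (h : IsFiniteMetricNorm m) :
    IsTranslationInvariantMetric fun t₁ t₂ => m (t₁ - t₂) where
  finite _ _ := h.finite _
  eq_zero_iff t₁ t₂ := by rw [h.eq_zero_iff, sub_eq_zero]
  symm t₁ t₂ := by rw [← h.neg, neg_sub]
  triangle t₁ t₂ t₃ := by
    have := h.add_le (t₁ - t₂) (t₂ - t₃)
    rwa [sub_add_sub_cancel] at this
  translate a t₁ t₂ := by rw [add_sub_add_right_eq_sub]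

/-- If `1 / n` on the vertical line through `x` is a multiple of the Fourier transform of a
nonnegative integrable function, then `m_x` is a metric norm. -/
theorem isFiniteMetricNorm_of_density {x : ℝ} {f : ℝ → ℝ} (hf : Integrable f) (h0 : ∀ u, 0 ≤ f u)
    (hn : ∀ t : ℝ, nFun (x + t * Complex.I) ≠ 0) {K : ℂ} (hK : K ≠ 0)
    (h : ∀ t : ℝ, K / nFun (x + t * Complex.I) =
      ∫ u, (f u : ℂ) * Complex.exp (-(t / 2 * u : ℝ) * Complex.I)) :
    IsFiniteMetricNorm (mNorm x) := by
  have hx : nFun x ≠ 0 := by simpa using hn 0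
  have h00 : K / nFun x = ((∫ u, f u : ℝ) : ℂ) := by
    have := h 0
    simp only [Complex.ofReal_zero, zero_mul, add_zero, zero_div, neg_zero, Complex.exp_zero,
      mul_one] at this
    rw [this, integral_complex_ofReal]
  have hI : ∫ u, f u ≠ 0 := by
    intro h1
    rw [h1, Complex.ofReal_zero, div_eq_zero_iff] at h00
    tauto
  have hIpos : 0 < ∫ u, f u := lt_of_le_of_ne (integral_nonneg h0) hI.symm
  have key (t : ℝ) : 1 - nFun x / nFun (x + t * Complex.I) =
      ((∫ u, f u : ℝ) : ℂ)⁻¹ * defect f t := by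
    have h1 : defect f t = ((∫ u, f u : ℝ) : ℂ) - K / nFun (x + t * Complex.I) := by
      rw [h t, ← integral_complex_ofReal]
      simp only [defect, mul_sub, mul_one]
      exact integral_sub hf.ofReal (integrable_mul_exp_I hf t)
    rw [h1, ← h00]
    field_simp
  have hm (t : ℝ) : mNorm x t = ENNReal.ofReal (√(∫ u, f u)⁻¹ * √‖defect f t‖) := by
    rw [mNorm, if_neg (hn t), key, norm_mul, norm_inv, Complex.norm_real,
      Real.norm_of_nonneg hIpos.le, Real.sqrt_mul (by positivity)]
  have hc : 0 < √(∫ u, f u)⁻¹ := Real.sqrt_pos.2 (by positivity)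
  refine ⟨fun t => hm t ▸ ENNReal.ofReal_ne_top, fun t => ?_, fun t => by rw [hm, hm, defect_neg]; simp,
    fun s t => ?_⟩
  · constructor
    · intro h1
      by_contra ht
      have := (defect_re_pos hf h0 hI ht).trans_le (Complex.re_le_norm _)
      rw [hm, ENNReal.ofReal_eq_zero] at h1
      exact absurd h1 (not_le.2 (mul_pos hc (Real.sqrt_pos.2 this)))
    · rintro rfl
      simp [hm, defect]
  · rw [hm, hm, hm, ← ENNReal.ofReal_add (by positivity) (by positivity), ← mul_add]
    exact ENNReal.ofReal_le_ofReal
      (mul_le_mul_of_nonneg_left (sqrt_norm_defect_add_le hf h0 hI s t) hc.le)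

/-! ### Bilateral Laplace transforms of `u ↦ g(e^u)` -/

/-- `∫ g(e^u) e^{-zu} du`, the Mellin transform of `g` at `-z`. -/
def lap (g : ℝ → ℝ) (z : ℂ) : ℂ := ∫ u : ℝ, (g (Real.exp u) : ℂ) * Complex.exp (-z * u)

/-- Absolute convergence of `lap g` on the line `re z = σ`. -/
def LapConv (g : ℝ → ℝ) (σ : ℝ) : Prop :=
  Integrable fun u : ℝ => g (Real.exp u) * Real.exp (-σ * u)

theorem norm_exp_mul_ofReal (z : ℂ) (u : ℝ) : ‖Complex.exp (z * u)‖ = Real.exp (z.re * u) := by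
  rw [Complex.norm_exp]; simp

section Mixture

variable {α : Type*} [MeasurableSpace α] {ν : Measure α} [SFinite ν] {h y : α → ℝ} {g : ℝ → ℝ}
  {σ : ℝ}

/-- Multiplying the argument of `g` by `y` translates `u` by `log y`. Each inner integral is
therefore `h y^σ` times a translate of one fixed integrable function, which is what Fubini needs. -/
theorem integrable_prod_mixture (hh : Measurable h) (hy : Measurable y)
    (hy0 : ∀ᵐ a ∂ν, 0 < y a) (hg : Measurable g) (hi : Integrable (fun a => h a * y a ^ σ) ν)
    (hc : LapConv g σ) :
    Integrable (fun q : ℝ × α => h q.2 * g (Real.exp q.1 * y q.2) * Real.exp (-σ * q.1))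
      (volume.prod ν) := by
  have hm : AEStronglyMeasurable
      (fun q : ℝ × α => h q.2 * g (Real.exp q.1 * y q.2) * Real.exp (-σ * q.1))
      (volume.prod ν) := Measurable.aestronglyMeasurable (by fun_prop)
  have hrw : ∀ a, 0 < y a → (fun u : ℝ => h a * g (Real.exp u * y a) * Real.exp (-σ * u)) =
      fun u => (h a * y a ^ σ) *
        (g (Real.exp (u + Real.log (y a))) * Real.exp (-σ * (u + Real.log (y a)))) := by
    intro a ha
    funext u
    rw [Real.exp_add, Real.exp_log ha, mul_add, Real.exp_add, Real.rpow_def_of_pos ha]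
    have : Real.exp (Real.log (y a) * σ) * Real.exp (-σ * Real.log (y a)) = 1 := by
      rw [← Real.exp_add, ← Real.exp_zero]; congr 1; ring
    linear_combination (-(h a * g (Real.exp u * y a) * Real.exp (-σ * u))) * this
  rw [integrable_prod_iff' hm]
  constructor
  · filter_upwards [hy0] with a ha
    simp only [hrw a ha]
    exact (Integrable.comp_add_right hc _).const_mul _
  · refine (hi.norm.mul_const (∫ u, ‖g (Real.exp u) * Real.exp (-σ * u)‖)).congr ?_
    filter_upwards [hy0] with a ha
    have h1 : ∀ u, ‖h a * g (Real.exp u * y a) * Real.exp (-σ * u)‖ = ‖h a * y a ^ σ‖ *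
        ‖g (Real.exp (u + Real.log (y a))) * Real.exp (-σ * (u + Real.log (y a)))‖ := by
      intro u
      rw [← norm_mul]
      exact congrArg norm (congrFun (hrw a ha) u)
    simp only [h1]
    rw [integral_const_mul]
    congr 1
    exact (integral_add_right_eq_self
      (fun u => ‖g (Real.exp u) * Real.exp (-σ * u)‖) (Real.log (y a))).symm

theorem LapConv.mixture (hh : Measurable h) (hy : Measurable y)
    (hy0 : ∀ᵐ a ∂ν, 0 < y a) (hg : Measurable g) (hi : Integrable (fun a => h a * y a ^ σ) ν)
    (hc : LapConv g σ) : LapConv (fun v => ∫ a, h a * g (v * y a) ∂ν) σ := by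
  have := (integrable_prod_mixture hh hy hy0 hg hi hc).integral_prod_left
  refine this.congr (ae_of_all _ fun u => ?_)
  simp only [integral_mul_const]

/-- Fubini, then the translation `u ↦ u + log y` in the inner integral produces the factor `y^z`.
Every kernel below is built by iterating this rule. -/
theorem lap_mixture (hh : Measurable h) (hy : Measurable y)
    (hy0 : ∀ᵐ a ∂ν, 0 < y a) (hg : Measurable g) (hi : Integrable (fun a => h a * y a ^ σ) ν)
    (hc : LapConv g σ) {z : ℂ} (hz : z.re = σ) :
    lap (fun v => ∫ a, h a * g (v * y a) ∂ν) z = (∫ a, (h a : ℂ) * (y a : ℂ) ^ z ∂ν) * lap g z := by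
  have hp : Integrable (fun q : ℝ × α => ((h q.2 * g (Real.exp q.1 * y q.2) : ℝ) : ℂ) *
      Complex.exp (-z * q.1)) (volume.prod ν) := by
    refine (integrable_prod_mixture hh hy hy0 hg hi hc).mono
      (Measurable.aestronglyMeasurable (by fun_prop)) (ae_of_all _ fun q => ?_)
    rw [norm_mul, norm_mul, norm_exp_mul_ofReal, Complex.norm_real, Complex.neg_re, hz,
      Real.norm_of_nonneg (Real.exp_pos (-σ * q.1)).le]
  calc lap (fun v => ∫ a, h a * g (v * y a) ∂ν) z
      = ∫ u : ℝ, ∫ a, ((h a * g (Real.exp u * y a) : ℝ) : ℂ) * Complex.exp (-z * u) ∂ν := by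
        rw [lap]
        congr 1 with u
        rw [integral_mul_const, integral_complex_ofReal]
    _ = ∫ a, (∫ u : ℝ, ((h a * g (Real.exp u * y a) : ℝ) : ℂ) * Complex.exp (-z * u)) ∂ν :=
        integral_integral_swap hp
    _ = ∫ a, ((h a : ℂ) * (y a : ℂ) ^ z) * lap g z ∂ν := by
        refine integral_congr_ae ?_
        filter_upwards [hy0] with a ha
        have hrw : ∀ u : ℝ, ((h a * g (Real.exp u * y a) : ℝ) : ℂ) * Complex.exp (-z * u) =
            ((h a : ℂ) * (y a : ℂ) ^ z) * ((g (Real.exp (u + Real.log (y a))) : ℂ) *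
              Complex.exp (-z * ((u + Real.log (y a) : ℝ) : ℂ))) := by
          intro u
          rw [Real.exp_add, Real.exp_log ha, Complex.cpow_def_of_ne_zero
            (Complex.ofReal_ne_zero.2 ha.ne'), Complex.ofReal_add, mul_add, Complex.exp_add,
            Complex.ofReal_log ha.le]
          have : Complex.exp (Complex.log (y a) * z) * Complex.exp (-z * Complex.log (y a)) = 1 := by
            rw [← Complex.exp_add, ← Complex.exp_zero]; congr 1; ring
          push_cast
          linear_combination (-((h a : ℂ) * g (Real.exp u * y a) * Complex.exp (-z * u))) * this
        simp only [hrw]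
        rw [integral_const_mul]
        congr 1
        exact integral_add_right_eq_self (fun u : ℝ => (g (Real.exp u) : ℂ) *
          Complex.exp (-z * u)) (Real.log (y a))
    _ = _ := integral_mul_const _ _

end Mixture

/-! ### Change of variables -/

theorem integral_exp_smul_comp_exp {E : Type*} [NormedAddCommGroup E] [NormedSpace ℝ E]
    (F : ℝ → E) : ∫ u : ℝ, Real.exp u • F (Real.exp u) = ∫ t in Ioi (0 : ℝ), F t := by
  have h := integral_image_eq_integral_abs_deriv_smul (s := univ) MeasurableSet.univ
    (fun u _ => (Real.hasDerivAt_exp u).hasDerivWithinAt) Real.exp_injective.injOn F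
  rw [image_univ, Real.range_exp, setIntegral_univ] at h
  rw [h]
  simp [abs_of_pos (Real.exp_pos _)]

theorem integrable_exp_smul_comp_exp {E : Type*} [NormedAddCommGroup E] [NormedSpace ℝ E]
    (F : ℝ → E) :
    Integrable (fun u : ℝ => Real.exp u • F (Real.exp u)) ↔ IntegrableOn F (Ioi (0 : ℝ)) := by
  have h := integrableOn_image_iff_integrableOn_abs_deriv_smul (s := univ) MeasurableSet.univ
    (fun u _ => (Real.hasDerivAt_exp u).hasDerivWithinAt) Real.exp_injective.injOn F
  rw [image_univ, Real.range_exp, integrableOn_univ] at h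
  rw [h]
  simp [abs_of_pos (Real.exp_pos _)]

theorem lapConv_iff (g : ℝ → ℝ) (σ : ℝ) :
    LapConv g σ ↔ IntegrableOn (fun t => g t * t ^ (-σ - 1)) (Ioi (0 : ℝ)) := by
  rw [← integrable_exp_smul_comp_exp, LapConv]
  refine iff_of_eq (congrArg (fun f => Integrable f volume) (funext fun u => ?_))
  rw [← Real.exp_mul, smul_eq_mul, mul_left_comm, ← Real.exp_add]
  congr 2; ring

theorem lap_eq (g : ℝ → ℝ) (z : ℂ) :
    lap g z = ∫ t in Ioi (0 : ℝ), (g t : ℂ) * (t : ℂ) ^ (-z - 1) := by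
  rw [← integral_exp_smul_comp_exp, lap]
  congr 1 with u
  rw [Complex.real_smul, mul_left_comm, Complex.ofReal_exp, ← Complex.ofReal_exp,
    Complex.cpow_def_of_ne_zero (Complex.ofReal_ne_zero.2 (Real.exp_pos u).ne'),
    ← Complex.ofReal_log (Real.exp_pos u).le, Real.log_exp, Complex.ofReal_exp, ← Complex.exp_add]
  congr 2; ring

/-! ### The transform of `1 - cos` -/

theorem lapConv_exp_neg {σ : ℝ} (hσ : σ < 0) : LapConv (fun t => Real.exp (-t)) σ := by
  rw [lapConv_iff]
  simpa using Real.GammaIntegral_convergent (s := -σ) (by linarith)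

theorem lap_exp_neg {z : ℂ} (hz : z.re < 0) :
    lap (fun t => Real.exp (-t)) z = Complex.Gamma (-z) := by
  rw [lap_eq, Complex.Gamma_eq_integral (by simpa using hz), Complex.GammaIntegral]

theorem integrableOn_exp_neg_mul {b : ℝ} (hb : 0 < b) :
    IntegrableOn (fun v : ℝ => Real.exp (-(b * v))) (Ioi 0) := by
  simpa using integrableOn_exp_mul_Ioi (a := -b) (by linarith) 0

theorem integral_exp_neg_mul {b : ℝ} (hb : 0 < b) :
    ∫ v in Ioi (0 : ℝ), Real.exp (-(b * v)) = 1 / b := by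
  have := integral_exp_mul_Ioi (a := -b) (by linarith) 0
  simp only [neg_mul, mul_zero, Real.exp_zero] at this
  rw [this]
  field_simp

theorem integral_cos_mul_exp_neg {b : ℝ} (hb : 0 < b) :
    ∫ v in Ioi (0 : ℝ), Real.cos v * Real.exp (-(b * v)) = b / (1 + b ^ 2) := by
  have ha : (-(b : ℂ) + Complex.I).re < 0 := by simpa using hb
  have h := integral_exp_mul_complex_Ioi ha 0
  have hi := integrableOn_exp_mul_complex_Ioi ha 0
  have h2 := integral_re hi
  simp only [RCLike.re_eq_complex_re] at h2
  rw [h] at h2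
  have h3 : ∀ v : ℝ, (Complex.exp ((-(b : ℂ) + Complex.I) * v)).re =
      Real.cos v * Real.exp (-(b * v)) := by
    intro v
    rw [Complex.exp_re]
    simp [mul_comm]
  simp only [h3] at h2
  rw [h2]
  simp only [Complex.ofReal_zero, mul_zero, Complex.exp_zero, Complex.div_re, Complex.neg_re,
    Complex.one_re, Complex.add_re, Complex.ofReal_re, Complex.I_re, Complex.neg_im,
    Complex.one_im, Complex.add_im, Complex.ofReal_im, Complex.I_im, Complex.normSq_apply]
  have : (0 : ℝ) < 1 + b ^ 2 := by positivity
  field_simp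
  ring

theorem one_sub_cos_nonneg (v : ℝ) : 0 ≤ 1 - Real.cos v := by linarith [Real.cos_le_one v]

theorem one_sub_cos_le_two (v : ℝ) : 1 - Real.cos v ≤ 2 := by linarith [Real.neg_one_le_cos v]

theorem one_sub_cos_le_sq (v : ℝ) : 1 - Real.cos v ≤ v ^ 2 / 2 := by
  linarith [Real.one_sub_sq_div_two_le_cos (x := v)]

theorem integral_one_sub_cos_mul_exp_neg {b : ℝ} (hb : 0 < b) :
    ∫ v in Ioi (0 : ℝ), (1 - Real.cos v) * Real.exp (-(b * v)) = 1 / (b * (1 + b ^ 2)) := by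
  have hi : IntegrableOn (fun v : ℝ => Real.cos v * Real.exp (-(b * v))) (Ioi 0) := by
    refine (integrableOn_exp_neg_mul hb).bdd_mul (c := 1)
      (Continuous.aestronglyMeasurable (by fun_prop)) (ae_of_all _ fun u => ?_)
    exact Real.abs_cos_le_one u
  simp only [sub_mul, one_mul]
  rw [integral_sub (integrableOn_exp_neg_mul hb) hi, integral_exp_neg_mul hb,
    integral_cos_mul_exp_neg hb]
  field_simp
  ring

theorem lapConv_of_bounds {g : ℝ → ℝ} (hg : Measurable g) {a b C σ : ℝ} (hb : b < σ) (ha : σ < a)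
    (h1 : ∀ v, 0 < v → v ≤ 1 → |g v| ≤ C * v ^ a) (h2 : ∀ v, 1 ≤ v → |g v| ≤ C * v ^ b) :
    LapConv g σ := by
  rw [lapConv_iff, ← Ioc_union_Ioi_eq_Ioi zero_le_one]
  refine IntegrableOn.union ?_ ?_
  · have hi : IntegrableOn (fun v : ℝ => C * v ^ (a - σ - 1)) (Ioc 0 1) := by
      refine Integrable.const_mul ?_ _
      rw [← IntegrableOn, ← intervalIntegrable_iff_integrableOn_Ioc_of_le zero_le_one]
      exact intervalIntegral.intervalIntegrable_rpow' (by linarith)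
    refine hi.mono' (Measurable.aestronglyMeasurable (by fun_prop))
      ((ae_restrict_iff' measurableSet_Ioc).2 (ae_of_all _ fun v hv => ?_))
    rw [norm_mul, Real.norm_eq_abs, Real.norm_of_nonneg (Real.rpow_nonneg hv.1.le _),
      show a - σ - 1 = a + (-σ - 1) by ring, Real.rpow_add hv.1, ← mul_assoc]
    exact mul_le_mul_of_nonneg_right (h1 v hv.1 hv.2) (Real.rpow_nonneg hv.1.le _)
  · have hi : IntegrableOn (fun v : ℝ => C * v ^ (b - σ - 1)) (Ioi 1) :=
      (integrableOn_Ioi_rpow_of_lt (by linarith) zero_lt_one).const_mul _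
    refine hi.mono' (Measurable.aestronglyMeasurable (by fun_prop))
      ((ae_restrict_iff' measurableSet_Ioi).2 (ae_of_all _ fun v hv => ?_))
    have hv0 : (0 : ℝ) < v := zero_lt_one.trans hv
    rw [norm_mul, Real.norm_eq_abs, Real.norm_of_nonneg (Real.rpow_nonneg hv0.le _),
      show b - σ - 1 = b + (-σ - 1) by ring, Real.rpow_add hv0, ← mul_assoc]
    exact mul_le_mul_of_nonneg_right (h2 v (le_of_lt hv)) (Real.rpow_nonneg hv0.le _)

theorem lapConv_one_sub_cos {σ : ℝ} (h0 : 0 < σ) (h2 : σ < 2) :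
    LapConv (fun v => 1 - Real.cos v) σ := by
  refine lapConv_of_bounds (C := 2) (by fun_prop) h0 h2 (fun v hv _ => ?_) fun v _ => ?_
  · rw [abs_of_nonneg (one_sub_cos_nonneg v), Real.rpow_two]
    nlinarith [one_sub_cos_le_sq v, sq_nonneg v]
  · rw [abs_of_nonneg (one_sub_cos_nonneg v), Real.rpow_zero]
    linarith [one_sub_cos_le_two v]

/-- The function `1/(1+v)` is the mixture `∫ e^{-s} e^{-vs} ds` of exponentials, so its transform is
`Γ(a) Γ(1-a)`, and Euler's reflection formula applies. -/
theorem integral_exp_mul_div_one_add_exp {a : ℂ} (h0 : 0 < a.re) (h1 : a.re < 1) :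
    ∫ u : ℝ, ((1 / (1 + Real.exp u) : ℝ) : ℂ) * Complex.exp (a * u) =
      Real.pi / Complex.sin (Real.pi * a) := by
  have h := lap_mixture (α := ℝ) (ν := volume.restrict (Ioi 0)) (h := fun s => Real.exp (-s))
    (y := fun s => s) (g := fun t => Real.exp (-t)) (σ := -a.re) (z := -a)
    (by fun_prop) measurable_id ((ae_restrict_iff' measurableSet_Ioi).2 (ae_of_all _ fun s hs => hs))
    (by fun_prop) (by simpa [IntegrableOn] using Real.GammaIntegral_convergent (s := 1 - a.re) (by linarith))
    (lapConv_exp_neg (by linarith)) (by simp)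
  rw [lap_exp_neg (by simpa using h0), neg_neg] at h
  have h3 : ∫ s in Ioi (0 : ℝ), ((Real.exp (-s) : ℝ) : ℂ) * (s : ℂ) ^ (-a) =
      Complex.Gamma (1 - a) := by
    rw [Complex.Gamma_eq_integral (by simpa using h1), Complex.GammaIntegral]
    congr 1 with s
    congr 2; ring
  rw [h3, mul_comm, Complex.Gamma_mul_Gamma_one_sub] at h
  rw [← h, lap]
  congr 1 with u
  rw [neg_neg]
  congr 2
  have : ∀ s : ℝ, Real.exp (-s) * Real.exp (-(Real.exp u * s)) =
      Real.exp (-((1 + Real.exp u) * s)) := by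
    intro s; rw [← Real.exp_add]; congr 1; ring
  simp only [this]
  rw [integral_exp_neg_mul (by positivity)]

theorem sin_ne_zero_of_re {z : ℂ} (h0 : 0 < z.re) (h2 : z.re < 2) :
    Complex.sin (Real.pi * z / 2) ≠ 0 := by
  rw [Complex.sin_ne_zero_iff]
  intro k hk
  have h : z = 2 * k := by
    have : (Real.pi : ℂ) ≠ 0 := by exact_mod_cast Real.pi_ne_zero
    field_simp at hk
    exact hk
  rw [h] at h0 h2
  simp at h0 h2
  have h3 : (0 : ℤ) < k := by exact_mod_cast h0
  have h4 : k < 1 := by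
    have : (k : ℝ) < 1 := by linarith
    exact_mod_cast this
  omega

/-- The transform of `∫ (1 - cos s) e^{-vs} ds = 1/(v(1+v²))` at `-z-1` is evaluated twice. As a
mixture of exponentials it is the wanted transform times `Γ(1+z)`; directly, the substitution `u ↦
2u` reduces it to the integral of `1/(1+e^u)` with `a = z/2`. -/
theorem lap_one_sub_cos {z : ℂ} (h0 : 0 < z.re) (h2 : z.re < 2) :
    lap (fun v => 1 - Real.cos v) z =
      Real.pi / (2 * Complex.sin (Real.pi * z / 2) * Complex.Gamma (1 + z)) := by
  have hconv := lapConv_one_sub_cos h0 h2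
  have h := lap_mixture (α := ℝ) (ν := volume.restrict (Ioi 0)) (h := fun s => 1 - Real.cos s)
    (y := fun s => s) (g := fun t => Real.exp (-t)) (σ := -z.re - 1) (z := -z - 1)
    (by fun_prop) measurable_id ((ae_restrict_iff' measurableSet_Ioi).2 (ae_of_all _ fun s hs => hs))
    (by fun_prop) ((lapConv_iff _ _).1 hconv) (lapConv_exp_neg (by linarith)) (by simp)
  rw [← lap_eq, lap_exp_neg (by simp; linarith)] at h
  have hG : Complex.Gamma (1 + z) ≠ 0 := Complex.Gamma_ne_zero_of_re_pos (by simp; linarith)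
  have hs := sin_ne_zero_of_re h0 h2
  have h3 : lap (fun v => ∫ s in Ioi (0 : ℝ), (1 - Real.cos s) * Real.exp (-(v * s))) (-z - 1) =
      Real.pi / (2 * Complex.sin (Real.pi * z / 2)) := by
    have h4 := integral_exp_mul_div_one_add_exp (a := z / 2) (by simpa using h0)
      (by simp; linarith)
    have h5 := Measure.integral_comp_mul_left
      (fun u : ℝ => ((1 / (1 + Real.exp u) : ℝ) : ℂ) * Complex.exp (z / 2 * u)) 2
    rw [h4] at h5
    have h6 : lap (fun v => ∫ s in Ioi (0 : ℝ), (1 - Real.cos s) * Real.exp (-(v * s))) (-z - 1)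
        = ∫ u : ℝ, ((1 / (1 + Real.exp (2 * u)) : ℝ) : ℂ) *
          Complex.exp (z / 2 * ((2 * u : ℝ) : ℂ)) := by
      rw [lap]
      congr 1 with u
      rw [integral_one_sub_cos_mul_exp_neg (Real.exp_pos u),
        show -(-z - 1) * (u : ℂ) = u + z / 2 * ((2 * u : ℝ) : ℂ) by push_cast; ring,
        Complex.exp_add, ← mul_assoc, ← Complex.ofReal_exp, ← Complex.ofReal_mul]
      congr 2
      have : Real.exp (2 * u) = Real.exp u ^ 2 := by rw [← Real.exp_nat_mul]; norm_num
      rw [this]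
      have := Real.exp_pos u
      field_simp
    rw [h6, h5, mul_div_assoc]
    simp
    field_simp
  rw [h3, show -(-z - 1) = 1 + z by ring] at h
  field_simp at h ⊢
  linear_combination -h

theorem measurable_mixture {α : Type*} [MeasurableSpace α] {ν : Measure α} [SFinite ν]
    {h y : α → ℝ} {g : ℝ → ℝ} (hh : Measurable h) (hy : Measurable y) (hg : Measurable g) :
    Measurable fun v => ∫ a, h a * g (v * y a) ∂ν := by
  have : StronglyMeasurable fun q : ℝ × α => h q.2 * g (q.1 * y q.2) :=
    Measurable.stronglyMeasurable (by fun_prop)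
  exact this.integral_prod_right.measurable

/-! ### Beta weights -/

/-- `∫_0^1 y^c (1 - y)^{b - 1} g(v y) dy`. -/
def betaMix (c b : ℝ) (g : ℝ → ℝ) (v : ℝ) : ℝ :=
  ∫ y in Ioo (0 : ℝ) 1, (y ^ c * (1 - y) ^ (b - 1)) * g (v * y)

theorem ae_Ioo_pos : ∀ᵐ y ∂(volume.restrict (Ioo (0 : ℝ) 1)), 0 < y :=
  (ae_restrict_iff' measurableSet_Ioo).2 (ae_of_all _ fun _ hy => hy.1)

theorem integrable_beta_complex {c b : ℝ} {z : ℂ} (hb : 0 < b) (hz : 0 < 1 + c + z.re) :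
    IntegrableOn (fun y : ℝ => ((y ^ c * (1 - y) ^ (b - 1) : ℝ) : ℂ) * (y : ℂ) ^ z) (Ioo 0 1) ∧
    ∫ y in Ioo (0 : ℝ) 1, ((y ^ c * (1 - y) ^ (b - 1) : ℝ) : ℂ) * (y : ℂ) ^ z =
      Complex.Gamma (1 + c + z) * Complex.Gamma b / Complex.Gamma (1 + c + z + b) := by
  have hu : 0 < (1 + c + z : ℂ).re := by simpa using hz
  have hv : 0 < (b : ℂ).re := by simpa using hb
  have heq : EqOn (fun y : ℝ => (y : ℂ) ^ ((1 + c + z : ℂ) - 1) * (1 - (y : ℂ)) ^ ((b : ℂ) - 1))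
      (fun y : ℝ => ((y ^ c * (1 - y) ^ (b - 1) : ℝ) : ℂ) * (y : ℂ) ^ z) (Ioo 0 1) := by
    intro y hy
    have hy0 : (y : ℂ) ≠ 0 := Complex.ofReal_ne_zero.2 hy.1.ne'
    simp only
    rw [Complex.ofReal_mul, Complex.ofReal_cpow hy.1.le, Complex.ofReal_cpow (by linarith [hy.2]),
      show (1 + c + z : ℂ) - 1 = c + z by ring, Complex.cpow_add _ _ hy0]
    push_cast
    ring
  constructor
  · have := Complex.betaIntegral_convergent hu hv
    rw [intervalIntegrable_iff_integrableOn_Ioo_of_le zero_le_one] at this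
    exact this.congr_fun heq measurableSet_Ioo
  · rw [← setIntegral_congr_fun measurableSet_Ioo heq, ← integral_Ioc_eq_integral_Ioo,
      ← intervalIntegral.integral_of_le zero_le_one,
      ← Complex.betaIntegral_eq_Gamma_mul_div _ _ hu hv, Complex.betaIntegral]

theorem integrable_beta_real {c b σ : ℝ} (hb : 0 < b) (hσ : 0 < 1 + c + σ) :
    Integrable (fun y : ℝ => (y ^ c * (1 - y) ^ (b - 1)) * y ^ σ)
      (volume.restrict (Ioo 0 1)) := by
  have := (integrable_beta_complex (z := σ) hb (by simpa using hσ)).1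
  refine Integrable.congr (RCLike.reCLM.integrable_comp this) ?_
  filter_upwards [ae_Ioo_pos] with y hy
  simp only [RCLike.reCLM_apply, RCLike.re_eq_complex_re, ← Complex.ofReal_cpow hy.le,
    ← Complex.ofReal_mul, Complex.ofReal_re]

section

variable {c b : ℝ} {g : ℝ → ℝ}

theorem measurable_beta_weight (c b : ℝ) : Measurable fun y : ℝ => y ^ c * (1 - y) ^ (b - 1) := by
  fun_prop

theorem measurable_betaMix (hg : Measurable g) : Measurable (betaMix c b g) :=
  measurable_mixture (measurable_beta_weight c b) measurable_id hg

theorem betaMix_nonneg (hg : ∀ v, 0 < v → 0 ≤ g v) {v : ℝ} (hv : 0 < v) : 0 ≤ betaMix c b g v :=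
  setIntegral_nonneg measurableSet_Ioo fun y hy => mul_nonneg
    (mul_nonneg (Real.rpow_nonneg hy.1.le _) (Real.rpow_nonneg (by linarith [hy.2]) _))
    (hg _ (mul_pos hv hy.1))

theorem lapConv_betaMix (hg : Measurable g) {σ : ℝ} (hb : 0 < b) (hσ : 0 < 1 + c + σ)
    (hc : LapConv g σ) : LapConv (betaMix c b g) σ :=
  hc.mixture (measurable_beta_weight c b) measurable_id ae_Ioo_pos hg (integrable_beta_real hb hσ)

theorem lap_betaMix (hg : Measurable g) {z : ℂ} (hb : 0 < b) (hσ : 0 < 1 + c + z.re)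
    (hc : LapConv g z.re) : lap (betaMix c b g) z =
      Complex.Gamma (1 + c + z) * Complex.Gamma b / Complex.Gamma (1 + c + z + b) * lap g z := by
  rw [← (integrable_beta_complex hb hσ).2]
  exact lap_mixture (measurable_beta_weight c b) measurable_id ae_Ioo_pos hg
    (integrable_beta_real hb hσ) hc rfl

end

/-! ### Möbius weights -/

/-- `μ(n+1) (n+1)^{-s}`. -/
def moebiusWeight (s : ℝ) (n : ℕ) : ℝ :=
  (ArithmeticFunction.moebius (n + 1) : ℝ) * ((n : ℝ) + 1) ^ (-s)

/-- `(n+1)^{-2}`. -/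
def invSq (n : ℕ) : ℝ := (((n : ℝ) + 1) ^ 2)⁻¹

theorem invSq_pos (n : ℕ) : 0 < invSq n := by unfold invSq; positivity

theorem invSq_le_one (n : ℕ) : invSq n ≤ 1 := by
  unfold invSq
  refine inv_le_one_of_one_le₀ ?_
  have : (0 : ℝ) ≤ n := Nat.cast_nonneg n
  nlinarith

theorem abs_moebius_le_one (n : ℕ) : |(ArithmeticFunction.moebius n : ℝ)| ≤ 1 := by
  exact_mod_cast ArithmeticFunction.abs_moebius_le_one (n := n)

theorem summable_succ_rpow {p : ℝ} (hp : 1 < p) : Summable fun n : ℕ => ((n : ℝ) + 1) ^ (-p) := by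
  have := (summable_nat_add_iff 1).2 (Real.summable_nat_rpow.2 (by linarith : -p < -1))
  simpa using this

theorem invSq_rpow (n : ℕ) (σ : ℝ) : invSq n ^ σ = ((n : ℝ) + 1) ^ (-(2 * σ)) := by
  rw [invSq, Real.inv_rpow (by positivity), ← Real.rpow_natCast, ← Real.rpow_mul (by positivity),
    ← Real.rpow_neg (by positivity)]
  norm_num

theorem abs_moebiusWeight_mul_le (s σ : ℝ) (n : ℕ) :
    |moebiusWeight s n * invSq n ^ σ| ≤ ((n : ℝ) + 1) ^ (-(s + 2 * σ)) := by
  have hn : (0 : ℝ) < (n : ℝ) + 1 := by positivity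
  rw [invSq_rpow, moebiusWeight, mul_assoc, ← Real.rpow_add hn, abs_mul,
    abs_of_pos (Real.rpow_pos_of_pos hn _), neg_add]
  exact mul_le_of_le_one_left (Real.rpow_nonneg hn.le _) (abs_moebius_le_one _)

theorem integrable_moebiusWeight {s σ : ℝ} (h : 1 < s + 2 * σ) :
    Integrable (fun n => moebiusWeight s n * invSq n ^ σ) Measure.count := by
  rw [integrable_count_iff]
  exact Summable.of_norm_bounded (summable_succ_rpow h) fun n => by
    rw [norm_norm]; exact abs_moebiusWeight_mul_le s σ n

theorem integral_moebiusWeight {s : ℝ} {z : ℂ} (h : 1 < s + 2 * z.re) :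
    ∫ n, (moebiusWeight s n : ℂ) * (invSq n : ℂ) ^ z ∂Measure.count =
      1 / riemannZeta (s + 2 * z) := by
  have hre : 1 < (s + 2 * z : ℂ).re := by simpa using h
  have hterm : ∀ n : ℕ, (moebiusWeight s n : ℂ) * (invSq n : ℂ) ^ z =
      LSeries.term (fun n => ((ArithmeticFunction.moebius n : ℤ) : ℂ)) (s + 2 * z) (n + 1) := by
    intro n
    have hn : (0 : ℝ) < (n : ℝ) + 1 := by positivity
    have hn' : (((n : ℝ) + 1 : ℝ) : ℂ) ≠ 0 := Complex.ofReal_ne_zero.2 hn.ne'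
    have h2 : ((n + 1 : ℕ) : ℂ) = (((n : ℝ) + 1 : ℝ) : ℂ) := by push_cast; rfl
    have e1 : (invSq n : ℂ) ^ z = (((n : ℝ) + 1 : ℝ) : ℂ) ^ (-(2 * z)) := by
      rw [Complex.cpow_def_of_ne_zero (Complex.ofReal_ne_zero.2 (invSq_pos n).ne'),
        Complex.cpow_def_of_ne_zero hn', ← Complex.ofReal_log (invSq_pos n).le,
        ← Complex.ofReal_log hn.le, invSq, Real.log_inv, Real.log_pow]
      congr 1; push_cast; ring
    rw [LSeries.term_of_ne_zero (by omega), h2, e1, moebiusWeight, div_eq_mul_inv,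
      ← Complex.cpow_neg, neg_add, Complex.cpow_add _ _ hn']
    push_cast [Complex.ofReal_cpow hn.le]
    ring
  have hsum := ArithmeticFunction.LSeriesSummable_moebius_iff.2 hre
  have hz := LSeries_one_mul_Lseries_moebius hre
  rw [LSeries_one_eq_riemannZeta hre] at hz
  have hint : Integrable (fun n => (moebiusWeight s n : ℂ) * (invSq n : ℂ) ^ z) Measure.count := by
    rw [integrable_count_iff]
    simp only [hterm]
    exact (summable_nat_add_iff 1).2 hsum.norm
  rw [integral_countable hint]
  simp only [Measure.real, Measure.count_singleton, ENNReal.toReal_one, one_smul, hterm]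
  -- The L-series is indexed from `0`, where its term is zero, whereas the weights start at `n + 1 =
  -- 1`.
  have h3 := hsum.tsum_eq_zero_add
  rw [LSeries.term_zero, zero_add] at h3
  rw [← h3, eq_div_iff (riemannZeta_ne_zero_of_one_lt_re hre), mul_comm]
  exact hz

/-- `∑_{n ≥ 1} μ(n) n^{-s} g(v / n²)`. -/
def moebiusMix (s : ℝ) (g : ℝ → ℝ) (v : ℝ) : ℝ :=
  ∫ n, moebiusWeight s n * g (v * invSq n) ∂Measure.count

section

variable {s : ℝ} {g : ℝ → ℝ}

theorem measurable_moebiusMix (hg : Measurable g) : Measurable (moebiusMix s g) :=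
  measurable_mixture .of_discrete .of_discrete hg

theorem lapConv_moebiusMix (hg : Measurable g) {σ : ℝ} (hσ : 1 < s + 2 * σ)
    (hc : LapConv g σ) : LapConv (moebiusMix s g) σ :=
  hc.mixture .of_discrete .of_discrete (ae_of_all _ invSq_pos) hg (integrable_moebiusWeight hσ)

theorem lap_moebiusMix (hg : Measurable g) {z : ℂ} (hσ : 1 < s + 2 * z.re)
    (hc : LapConv g z.re) :
    lap (moebiusMix s g) z = 1 / riemannZeta (s + 2 * z) * lap g z := by
  rw [← integral_moebiusWeight hσ]
  exact lap_mixture .of_discrete .of_discrete (ae_of_all _ invSq_pos) hg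
    (integrable_moebiusWeight hσ) hc rfl

end

/-! ### Taylor coefficients -/

/-- `g` is the sum of the everywhere convergent series `∑ a_k v^{2k+2}`. -/
structure HasEvenSeries (g : ℝ → ℝ) (a : ℕ → ℝ) : Prop where
  summable : ∀ v : ℝ, Summable fun k => |a k| * |v| ^ (2 * k + 2)
  hasSum : ∀ v : ℝ, HasSum (fun k => a k * v ^ (2 * k + 2)) (g v)

/-- As `0 < y ≤ 1`, every moment of order `2k+2` is dominated by the absolute second moment. This
justifies integrating the series term by term, even for weights such as `y^{-5/4}` that are not
integrable themselves. -/
theorem HasEvenSeries.mixture {α : Type*} [MeasurableSpace α] {ν : Measure α}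
    {h y : α → ℝ} {g : ℝ → ℝ} {a : ℕ → ℝ} (hh : Measurable h) (hy : Measurable y)
    (hy0 : ∀ᵐ q ∂ν, 0 < y q) (hy1 : ∀ᵐ q ∂ν, y q ≤ 1)
    (hi : Integrable (fun q => h q * y q ^ (2 : ℝ)) ν) (hg : HasEvenSeries g a) :
    HasEvenSeries (fun v => ∫ q, h q * g (v * y q) ∂ν)
      fun k => a k * ∫ q, h q * y q ^ (2 * k + 2) ∂ν := by
  set M := ∫ q, ‖h q * y q ^ (2 : ℝ)‖ ∂ν
  have hle : ∀ k : ℕ, ∀ᵐ q ∂ν, ‖h q * y q ^ (2 * k + 2)‖ ≤ ‖h q * y q ^ (2 : ℝ)‖ := by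
    intro k
    filter_upwards [hy0, hy1] with q h0 h1
    rw [norm_mul, norm_mul, Real.rpow_two, Real.norm_of_nonneg (pow_nonneg h0.le _),
      Real.norm_of_nonneg (pow_nonneg h0.le _)]
    exact mul_le_mul_of_nonneg_left (pow_le_pow_of_le_one h0.le h1 (by omega)) (norm_nonneg _)
  have hik : ∀ k : ℕ, Integrable (fun q => h q * y q ^ (2 * k + 2)) ν := fun k =>
    hi.mono (Measurable.aestronglyMeasurable (by fun_prop)) (hle k)
  have hM : ∀ k : ℕ, ∫ q, ‖h q * y q ^ (2 * k + 2)‖ ∂ν ≤ M := fun k =>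
    integral_mono_ae (hik k).norm hi.norm (hle k)
  refine ⟨fun v => ?_, fun v => ?_⟩
  · refine Summable.of_nonneg_of_le (fun k => by positivity) (fun k => ?_)
      ((hg.summable v).mul_right M)
    rw [abs_mul]
    have : |∫ q, h q * y q ^ (2 * k + 2) ∂ν| ≤ M :=
      (norm_integral_le_integral_norm _).trans (hM k)
    calc |a k| * |∫ q, h q * y q ^ (2 * k + 2) ∂ν| * |v| ^ (2 * k + 2)
        ≤ |a k| * M * |v| ^ (2 * k + 2) := by gcongr
      _ = _ := by ring
  · have hF : ∀ k : ℕ, (fun q => (a k * v ^ (2 * k + 2)) * (h q * y q ^ (2 * k + 2))) =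
        fun q => h q * (a k * (v * y q) ^ (2 * k + 2)) := by
      intro k; funext q; rw [mul_pow]; ring
    have h1 := hasSum_integral_of_summable_integral_norm
      (F := fun k q => (a k * v ^ (2 * k + 2)) * (h q * y q ^ (2 * k + 2)))
      (fun k => (hik k).const_mul _) (by
        refine Summable.of_nonneg_of_le (fun k => integral_nonneg fun q => norm_nonneg _)
          (fun k => ?_) ((hg.summable v).mul_right M)
        simp only [norm_mul (a k * v ^ (2 * k + 2))]
        rw [integral_const_mul, norm_mul, norm_pow, Real.norm_eq_abs, Real.norm_eq_abs]
        exact mul_le_mul_of_nonneg_left (hM k) (by positivity))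
    have h2 : (fun q => ∑' k, (a k * v ^ (2 * k + 2)) * (h q * y q ^ (2 * k + 2))) =
        fun q => h q * g (v * y q) := by
      funext q
      rw [← ((hg.hasSum (v * y q)).mul_left (h q)).tsum_eq]
      exact tsum_congr fun k => congrFun (hF k) q
    rw [h2] at h1
    refine h1.congr_fun ?_ |> fun h => h
    intro k
    rw [integral_const_mul]
    ring

/-! ### Reduction to nonnegative kernels -/

theorem lapConv_comp_mul {g : ℝ → ℝ} {σ a : ℝ} (ha : 0 < a) (hc : LapConv g σ) :
    LapConv (fun v => g (a * v)) σ := by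
  refine ((hc.comp_add_right (Real.log a)).mul_const (Real.exp (σ * Real.log a))).congr
    (ae_of_all _ fun u => ?_)
  beta_reduce
  rw [mul_assoc, ← Real.exp_add, Real.exp_add u, Real.exp_log ha, mul_comm a]
  congr 2; ring

theorem lap_comp_mul {g : ℝ → ℝ} {a : ℝ} (ha : 0 < a) (z : ℂ) :
    lap (fun v => g (a * v)) z = (a : ℂ) ^ z * lap g z := by
  have h1 := integral_add_right_eq_self
    (fun u : ℝ => (g (Real.exp u) : ℂ) * Complex.exp (-z * u)) (Real.log a) (μ := volume)
  rw [lap, lap, ← h1, ← integral_const_mul]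
  congr 1 with u
  rw [Real.exp_add, Real.exp_log ha, Complex.cpow_def_of_ne_zero
    (Complex.ofReal_ne_zero.2 ha.ne'), ← Complex.ofReal_log ha.le, mul_left_comm,
    ← Complex.exp_add, mul_comm a]
  congr 2; push_cast; ring

/-- On `z = σ + it/2` one has `e^{-zu} = e^{-σu} e^{-itu/2}`, so `g(e^u) e^{-σu}` is the required
density. -/
theorem isFiniteMetricNorm_of_lap {x w σ : ℝ} (hx : x = 2 * (σ + w)) {g : ℝ → ℝ}
    (hc : LapConv g σ) (h0 : ∀ v, 0 < v → 0 ≤ g v)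
    (hn : ∀ z : ℂ, z.re = σ → nFun (2 * (z + w)) ≠ 0) {K : ℂ} (hK : K ≠ 0)
    (h : ∀ z : ℂ, z.re = σ → K / nFun (2 * (z + w)) = lap g z) :
    IsFiniteMetricNorm (mNorm x) := by
  have hz (t : ℝ) : (x + t * Complex.I : ℂ) = 2 * ((σ + (t / 2 : ℝ) * Complex.I) + w) := by
    rw [hx]; push_cast; ring
  have hre (t : ℝ) : (σ + (t / 2 : ℝ) * Complex.I : ℂ).re = σ := by simp
  refine isFiniteMetricNorm_of_density hc
    (fun u => mul_nonneg (h0 _ (Real.exp_pos u)) (Real.exp_pos _).le)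
    (fun t => hz t ▸ hn _ (hre t)) hK fun t => ?_
  rw [hz t, h _ (hre t), lap]
  congr 1 with u
  rw [Complex.ofReal_mul, Complex.ofReal_exp, mul_assoc, ← Complex.exp_add]
  congr 2; push_cast; ring

/-! ### The function `n` in the half-plane of absolute convergence -/

/-- The factorization that the kernels have to match: sine from `1 - cos`, Gamma and linear factors
from beta weights, zeta from Möbius weights, and `π^z` from rescaling the argument. The excluded
point corresponds to the pole of zeta. -/
theorem nFun_two_mul {z : ℂ} (h0 : 0 < z.re) (h1 : z ≠ 1 / 4) :
    nFun (2 * z) = 4 * (Real.pi : ℂ) ^ (-1 / 4 : ℂ) * Complex.sin (Real.pi * z / 2) *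
      (Complex.Gamma (5 / 4 + z) * (z - 1 / 4) * riemannZeta (1 / 2 + 2 * z)) /
        (Real.pi : ℂ) ^ z := by
  have hpi : (Real.pi : ℂ) ≠ 0 := by exact_mod_cast Real.pi_ne_zero
  rw [nFun, xi_eq, aFun, lFun]
  · rw [show -(1 / 2 + 2 * z) / 2 = -1 / 4 - z by ring, Complex.cpow_sub _ _ hpi,
      show (1 : ℂ) + (1 / 2 + 2 * z) / 2 = 5 / 4 + z by ring,
      show Real.pi * (2 * z) / 4 = Real.pi * z / 2 by ring]
    field_simp
    ring
  · contrapose! h1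
    linear_combination h1 / 2
  · intro k hk
    have := congrArg Complex.re hk
    simp at this
    have hk0 : (0 : ℝ) ≤ k := Nat.cast_nonneg k
    linarith

theorem ne_quarter_of_re {z : ℂ} (hz : 1 / 4 < z.re) : z ≠ 1 / 4 := by
  rintro rfl
  norm_num at hz

theorem pi_cpow_ne_zero (z : ℂ) : (Real.pi : ℂ) ^ z ≠ 0 := by
  rw [Ne, Complex.cpow_eq_zero_iff]
  simp [Real.pi_ne_zero]

theorem zeta_factor_ne_zero {z : ℂ} (hz : 1 / 4 < z.re) :
    Complex.Gamma (5 / 4 + z) * (z - 1 / 4) * riemannZeta (1 / 2 + 2 * z) ≠ 0 := by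
  refine mul_ne_zero (mul_ne_zero (Complex.Gamma_ne_zero_of_re_pos ?_) (sub_ne_zero.2
    (ne_quarter_of_re hz))) (riemannZeta_ne_zero_of_one_lt_re ?_)
  · norm_num; linarith
  · norm_num; linarith

/-! ### Positivity of the kernel away from the central strip -/

/-- `∫_0^1 (1 - y)(1 - cos(v y)) dy`. -/
def cosKernel : ℝ → ℝ := betaMix 0 2 fun v => 1 - Real.cos v

/-- A Fejér-type closed form. It reduces comparing the kernel at `v` and at `v/n²` to comparing
values of `|sin θ / θ|`. -/
theorem cosKernel_eq {v : ℝ} (hv : v ≠ 0) :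
    cosKernel v = (1 - (Real.sin (v / 2) / (v / 2)) ^ 2) / 2 := by
  have h1 : cosKernel v = ∫ y in (0 : ℝ)..1, (1 - y) * (1 - Real.cos (v * y)) := by
    rw [cosKernel, betaMix, intervalIntegral.integral_of_le zero_le_one,
      integral_Ioc_eq_integral_Ioo]
    norm_num
  have hd : ∀ y ∈ uIcc (0 : ℝ) 1, HasDerivAt (fun y => y - y ^ 2 / 2 -
      (1 - y) * (Real.sin (v * y) / v) + Real.cos (v * y) / v ^ 2)
      ((1 - y) * (1 - Real.cos (v * y))) y := by
    intro y _
    have hl : HasDerivAt (fun y : ℝ => v * y) v y := by simpa using (hasDerivAt_id y).const_mul v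
    have hs := (hl.sin).div_const v
    have hco := (hl.cos).div_const (v ^ 2)
    have := (((hasDerivAt_id y).sub (((hasDerivAt_id y).pow 2).div_const 2)).sub
      (((hasDerivAt_id y).const_sub 1).mul hs)).add hco
    refine this.congr_deriv ?_
    simp
    field_simp
    ring
  rw [h1, intervalIntegral.integral_eq_sub_of_hasDerivAt hd
    (Continuous.intervalIntegrable (by fun_prop) _ _)]
  have h2 : Real.cos v = 1 - 2 * Real.sin (v / 2) ^ 2 := by
    have := Real.cos_two_mul (v / 2)
    rw [mul_div_cancel₀ _ two_ne_zero] at this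
    rw [this, Real.cos_sq']; ring
  simp [h2]
  field_simp
  ring

theorem abs_sin_nat_mul_le (n : ℕ) (θ : ℝ) : |Real.sin (n * θ)| ≤ n * |Real.sin θ| := by
  induction n with
  | zero => simp
  | succ n ih =>
    rw [Nat.cast_succ, add_mul, one_mul, Real.sin_add, add_mul, one_mul]
    refine (abs_add_le _ _).trans (add_le_add ?_ ?_)
    · rw [abs_mul]
      exact (mul_le_of_le_one_right (abs_nonneg _) (Real.abs_cos_le_one _)).trans ih
    · rw [abs_mul]
      exact mul_le_of_le_one_left (abs_nonneg _) (Real.abs_cos_le_one _)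

theorem measurable_cosKernel : Measurable cosKernel := measurable_betaMix (by fun_prop)

theorem cosKernel_nonneg {v : ℝ} (hv : 0 < v) : 0 ≤ cosKernel v :=
  betaMix_nonneg (fun _ _ => one_sub_cos_nonneg _) hv

/-- Although the kernel is not monotone, `v/2` is an integer multiple `Nθ` of the smaller argument
`θ`, and `|sin Nθ| ≤ N |sin θ|`. -/
theorem cosKernel_div_sq_le {v : ℝ} (hv : 0 < v) (n : ℕ) :
    cosKernel (v * invSq n) ≤ cosKernel v := by
  have hn : (0 : ℝ) < ((n : ℝ) + 1) ^ 2 := by positivity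
  have hpos := mul_pos hv (invSq_pos n)
  rw [cosKernel_eq hv.ne', cosKernel_eq hpos.ne']
  set θ := v * invSq n / 2
  have hθ : 0 < θ := by positivity
  have hvθ : v / 2 = (((n + 1) ^ 2 : ℕ) : ℝ) * θ := by
    simp only [θ, invSq]; push_cast; field_simp
  have h := abs_sin_nat_mul_le ((n + 1) ^ 2) θ
  rw [← hvθ] at h
  have h2 : |Real.sin (v / 2) / (v / 2)| ≤ |Real.sin θ / θ| := by
    have hv2 : 0 < v / 2 := by positivity
    rw [abs_div, abs_of_pos hv2, abs_div, abs_of_pos hθ, div_le_div_iff₀ hv2 hθ]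
    calc _ ≤ (((n + 1) ^ 2 : ℕ) : ℝ) * |Real.sin θ| * θ := by gcongr
      _ = |Real.sin θ| * (v / 2) := by rw [hvθ]; ring
  have h3 := sq_le_sq' (by linarith [neg_abs_le (Real.sin θ / θ), abs_nonneg (Real.sin (v / 2) / (v / 2))]) h2
  rw [sq_abs, sq_abs] at h3
  linarith

/-- The first term is `cosKernel v`, and the other terms together have absolute value at most `(π²/6
- 1) cosKernel v`, which is smaller. -/
theorem moebiusMix_cosKernel_nonneg {s : ℝ} (hs : 2 ≤ s) {v : ℝ} (hv : 0 < v) :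
    0 ≤ moebiusMix s cosKernel v := by
  have hb : ∀ n, |moebiusWeight s n * cosKernel (v * invSq n)| ≤
      ((n : ℝ) + 1) ^ (-2 : ℝ) * cosKernel v := by
    intro n
    have h1 := abs_moebiusWeight_mul_le s 0 n
    simp only [Real.rpow_zero, mul_one, mul_zero, add_zero] at h1
    rw [abs_mul, abs_of_nonneg (cosKernel_nonneg (mul_pos hv (invSq_pos n)))]
    refine mul_le_mul (h1.trans ?_) (cosKernel_div_sq_le hv n)
      (cosKernel_nonneg (mul_pos hv (invSq_pos n))) (by positivity)
    refine Real.rpow_le_rpow_of_exponent_le ?_ (by linarith)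
    have : (0 : ℝ) ≤ n := Nat.cast_nonneg n
    linarith
  have hsum2 : Summable fun n : ℕ => ((n : ℝ) + 1) ^ (-2 : ℝ) * cosKernel v :=
    (summable_succ_rpow one_lt_two).mul_right _
  have hsum : Summable fun n => ‖moebiusWeight s n * cosKernel (v * invSq n)‖ :=
    Summable.of_nonneg_of_le (fun _ => norm_nonneg _) hb hsum2
  rw [moebiusMix, integral_countable ((integrable_count_iff).2 hsum)]
  simp only [Measure.real, Measure.count_singleton, ENNReal.toReal_one, one_smul]
  rw [hsum.of_norm.tsum_eq_zero_add]
  have hz : moebiusWeight s 0 * cosKernel (v * invSq 0) = cosKernel v := by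
    simp [moebiusWeight, invSq]
  rw [hz]
  have h2 : HasSum (fun n : ℕ => ((n : ℝ) + 1) ^ (-2 : ℝ)) (Real.pi ^ 2 / 6) := by
    have := (hasSum_nat_add_iff' 1).2 hasSum_zeta_two
    simp only [Finset.range_one, Finset.sum_singleton, Nat.cast_zero, Nat.cast_add,
      Nat.cast_one] at this
    have e : (fun n : ℕ => ((n : ℝ) + 1) ^ (-2 : ℝ)) = fun n : ℕ => 1 / ((n : ℝ) + 1) ^ 2 := by
      funext n
      rw [Real.rpow_neg (by positivity), Real.rpow_two, one_div]
    rw [e]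
    simpa using this
  have h3 := h2.summable.tsum_eq_zero_add
  rw [h2.tsum_eq] at h3
  simp only [Nat.cast_zero, zero_add, Real.one_rpow] at h3
  have h4 : -∑' n : ℕ, ((((n + 1 : ℕ) : ℝ) + 1) ^ (-2 : ℝ) * cosKernel v) ≤
      ∑' n : ℕ, moebiusWeight s (n + 1) * cosKernel (v * invSq (n + 1)) := by
    rw [← tsum_neg]
    exact (((summable_nat_add_iff 1).2 hsum2).neg).tsum_le_tsum
      (fun n => (abs_le.1 (hb (n + 1))).1) ((summable_nat_add_iff 1).2 hsum.of_norm)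
  rw [tsum_mul_right] at h4
  -- This says that the tail `∑_{n ≥ 2} n⁻²` is at most `1`.
  have h5 : Real.pi ^ 2 / 6 ≤ 2 := by nlinarith [Real.pi_lt_d2, Real.pi_pos]
  have h6 := cosKernel_nonneg hv
  nlinarith

/-- The kernel whose transform is, up to a constant, `1 / n` in the strip `4w < re s < 4w + 4`. -/
def stripKernel (w : ℕ) : ℝ → ℝ :=
  betaMix (2 * w - 5 / 4) 1 (betaMix 2 (2 * w - 7 / 4) (moebiusMix (1 / 2 + 4 * w) cosKernel))

/-- The mixtures contribute in turn, from the inside out, `Γ(1+z)/Γ(3+z)`, `1/ζ(1/2+4w+2z)`,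
`Γ(3+z)Γ(2w-7/4)/Γ(5/4+2w+z)` and `1/(z+2w-1/4)`, so the Gamma quotients telescope. The third needs
`2w - 7/4 > 0`, hence `w ≥ 1`. -/
theorem lap_stripKernel {w : ℕ} (hw : 1 ≤ w) {z : ℂ} (h0 : 0 < z.re) (h2 : z.re < 2) :
    LapConv (stripKernel w) z.re ∧
    lap (stripKernel w) z = Complex.Gamma (2 * w - 7 / 4) * (Real.pi / 2) /
      (Complex.sin (Real.pi * z / 2) * (Complex.Gamma (5 / 4 + (z + 2 * w)) * (z + 2 * w - 1 / 4) *
        riemannZeta (1 / 2 + 2 * (z + 2 * w)))) := by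
  have hw' : (1 : ℝ) ≤ w := by exact_mod_cast hw
  have hm1 := measurable_moebiusMix (s := 1 / 2 + 4 * w) measurable_cosKernel
  have hm2 := measurable_betaMix (c := 2) (b := 2 * w - 7 / 4) hm1
  have c0 := lapConv_one_sub_cos h0 h2
  have c1 : LapConv cosKernel z.re := lapConv_betaMix (by fun_prop) (by norm_num) (by linarith) c0
  have c2 := lapConv_moebiusMix (s := 1 / 2 + 4 * w) measurable_cosKernel
    (by linarith : 1 < 1 / 2 + 4 * (w : ℝ) + 2 * z.re) c1
  have c3 := lapConv_betaMix (c := 2) (b := 2 * w - 7 / 4) hm1 (by linarith) (by linarith) c2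
  have c4 := lapConv_betaMix (c := 2 * w - 5 / 4) (b := 1) hm2 (by linarith) (by linarith) c3
  refine ⟨c4, ?_⟩
  rw [stripKernel, lap_betaMix hm2 (by linarith) (by linarith) c3,
    lap_betaMix hm1 (by linarith) (by linarith) c2,
    lap_moebiusMix measurable_cosKernel (by linarith) c1, cosKernel,
    lap_betaMix (by fun_prop) (by norm_num) (by linarith) c0, lap_one_sub_cos h0 h2]
  have hz : 1 / 4 < (z + 2 * w).re := by simp; linarith
  have hf := zeta_factor_ne_zero hz
  have hs := sin_ne_zero_of_re h0 h2
  have g1 : Complex.Gamma (1 + z) ≠ 0 := Complex.Gamma_ne_zero_of_re_pos (by simp; linarith)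
  have g3 : Complex.Gamma (3 + z) ≠ 0 := Complex.Gamma_ne_zero_of_re_pos (by simp; linarith)
  have g4 : Complex.Gamma (z + 2 * w - 1 / 4) ≠ 0 :=
    Complex.Gamma_ne_zero_of_re_pos (by simp at hz ⊢; linarith)
  have hq : z + 2 * w - 1 / 4 ≠ 0 := sub_ne_zero.2 (ne_quarter_of_re hz)
  have G2 : Complex.Gamma 2 = 1 := by norm_num
  have e1 : (1 : ℂ) + ((2 * w - 5 / 4 : ℝ) : ℂ) + z = z + 2 * w - 1 / 4 := by push_cast; ring
  have e2 : (1 : ℂ) + ((2 : ℝ) : ℂ) + z = 3 + z := by push_cast; ring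
  have e3 : 3 + z + ((2 * w - 7 / 4 : ℝ) : ℂ) = 5 / 4 + (z + 2 * w) := by push_cast; ring
  have e4 : ((1 / 2 + 4 * w : ℝ) : ℂ) + 2 * z = 1 / 2 + 2 * (z + 2 * w) := by push_cast; ring
  have e5 : (1 : ℂ) + ((0 : ℝ) : ℂ) + z = 1 + z := by push_cast; ring
  have e6 : 1 + z + ((2 : ℝ) : ℂ) = 3 + z := by push_cast; ring
  have e7 : ((2 * w - 7 / 4 : ℝ) : ℂ) = 2 * w - 7 / 4 := by push_cast; ring
  rw [e2, e3, e1, e4, e5, e6, e7, Complex.ofReal_one, Complex.Gamma_add_one _ hq,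
    Complex.Gamma_one, Complex.ofReal_ofNat, G2]
  set w' : ℂ := z + 2 * w with hwz
  have z1 : Complex.Gamma (5 / 4 + w') ≠ 0 := fun h => hf (by rw [h]; simp)
  have z2 : riemannZeta (1 / 2 + 2 * w') ≠ 0 := fun h => hf (by rw [h]; simp)
  generalize Complex.Gamma (1 + z) = G1 at *
  generalize Complex.Gamma (3 + z) = G3 at *
  generalize Complex.Gamma (w' - 1 / 4) = G4 at *
  generalize w' - 1 / 4 = q at *
  generalize Complex.Gamma (5 / 4 + w') = G5 at *
  generalize riemannZeta (1 / 2 + 2 * w') = Z at *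
  generalize Complex.sin (Real.pi * z / 2) = S at *
  field_simp

theorem stripKernel_nonneg {w : ℕ} (hw : 1 ≤ w) {v : ℝ} (hv : 0 < v) : 0 ≤ stripKernel w v := by
  have hw' : (1 : ℝ) ≤ w := by exact_mod_cast hw
  exact betaMix_nonneg (fun v hv => betaMix_nonneg
    (fun v hv => moebiusMix_cosKernel_nonneg (by linarith) hv) hv) hv

theorem sin_shift (z : ℂ) (w : ℕ) : Complex.sin (Real.pi * (z + 2 * w) / 2) =
    (-1) ^ w * Complex.sin (Real.pi * z / 2) := by
  rw [show (Real.pi * (z + 2 * w) / 2 : ℂ) = Real.pi * z / 2 + w * Real.pi by ring]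
  exact Complex.sin_antiperiodic.add_nat_mul_eq w

theorem isFiniteMetricNorm_of_gt_four {x : ℝ} (hx : 4 < x) (hx' : ∀ w : ℤ, x ≠ 4 * w) :
    IsFiniteMetricNorm (mNorm x) := by
  -- With this `w` the abscissa `σ = x/2 - 2w` lies in `[0, 2)`; the value `0` is excluded because
  -- `x` is not a multiple of `4`.
  obtain ⟨w, hw1, hw2⟩ : ∃ w : ℕ, (w : ℝ) ≤ x / 4 ∧ x / 4 < w + 1 :=
    ⟨⌊x / 4⌋₊, Nat.floor_le (by linarith), Nat.lt_floor_add_one _⟩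
  have hw3 : (w : ℝ) < x / 4 := lt_of_le_of_ne hw1 fun h => hx' w (by push_cast; linarith)
  have hw : 1 ≤ w := by
    have : (0 : ℝ) < w := by linarith
    exact_mod_cast this
  have hw' : (1 : ℝ) ≤ w := by exact_mod_cast hw
  have hG : Complex.Gamma (2 * w - 7 / 4) ≠ 0 :=
    Complex.Gamma_ne_zero_of_re_pos (by norm_num; linarith)
  have hp := pi_cpow_ne_zero
  have hpi : (Real.pi : ℂ) ≠ 0 := by exact_mod_cast Real.pi_ne_zero
  have hm : ((-1 : ℂ)) ^ w ≠ 0 := by simp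
  have hform : ∀ z : ℂ, z.re = x / 2 - 2 * w → nFun (2 * (z + (2 * w : ℝ))) ≠ 0 ∧
      4 * (Real.pi : ℂ) ^ (-1 / 4 : ℂ) * (-1) ^ w * (Complex.Gamma (2 * w - 7 / 4) * (Real.pi / 2))
        / (Real.pi : ℂ) ^ (2 * w : ℂ) / nFun (2 * (z + (2 * w : ℝ))) =
      lap (fun v => stripKernel w (Real.pi * v)) z := by
    intro z hz
    have h0 : 0 < z.re := by rw [hz]; linarith
    have h2 : z.re < 2 := by rw [hz]; linarith
    have hq : 1 / 4 < (z + 2 * w).re := by simp; linarith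
    have hf := zeta_factor_ne_zero hq
    have hs := sin_ne_zero_of_re h0 h2
    have e : ((2 * w : ℝ) : ℂ) = 2 * w := by push_cast; rfl
    rw [e, nFun_two_mul (by linarith) (ne_quarter_of_re hq), sin_shift,
      lap_comp_mul Real.pi_pos, (lap_stripKernel hw h0 h2).2, Complex.cpow_add _ _ hpi]
    have p1 := hp z
    have p2 := hp (2 * w)
    have p3 := hp (-1 / 4)
    generalize (Real.pi : ℂ) ^ z = A at *
    generalize (Real.pi : ℂ) ^ (2 * w : ℂ) = B at *
    generalize (Real.pi : ℂ) ^ (-1 / 4 : ℂ) = D at *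
    generalize Complex.Gamma (5 / 4 + (z + 2 * w)) * (z + 2 * w - 1 / 4) *
      riemannZeta (1 / 2 + 2 * (z + 2 * w)) = F at *
    generalize Complex.sin (Real.pi * z / 2) = S at *
    refine ⟨?_, by field_simp⟩
    simp [*]
  refine isFiniteMetricNorm_of_lap (w := 2 * w) (σ := x / 2 - 2 * w) (by ring)
    (lapConv_comp_mul Real.pi_pos ?_)
    (fun v hv => stripKernel_nonneg hw (mul_pos Real.pi_pos hv)) (fun z hz => (hform z hz).1)
    ?_ (fun z hz => (hform z hz).2)
  · have := (lap_stripKernel hw (z := ((x / 2 - 2 * w : ℝ) : ℂ))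
      (by rw [Complex.ofReal_re]; linarith) (by rw [Complex.ofReal_re]; linarith)).1
    rwa [Complex.ofReal_re] at this
  · simp [hG, hp, hpi]

/-! ### Oddness of `n` and negative `x` -/

theorem completedRiemannZeta₀_neg_add (s : ℂ) :
    completedRiemannZeta₀ (1 / 2 + -s) = completedRiemannZeta₀ (1 / 2 + s) := by
  rw [← completedRiemannZeta₀_one_sub]
  congr 1; ring

/-- By the functional equation `ξ(1/2 + s)` is even in `s`, while the sine factor is odd. -/
theorem nFun_neg (s : ℂ) : nFun (-s) = -nFun s := by
  rw [nFun, nFun, xi, xi, completedRiemannZeta₀_neg_add,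
    show Real.pi * -s / 4 = -(Real.pi * s / 4) by ring, Complex.sin_neg]
  ring

theorem mNorm_neg_neg (x t : ℝ) : mNorm (-x) (-t) = mNorm x t := by
  have h : ((-x : ℝ) : ℂ) + ((-t : ℝ) : ℂ) * Complex.I = -(x + t * Complex.I) := by
    push_cast; ring
  rw [mNorm, mNorm, h, nFun_neg, Complex.ofReal_neg, nFun_neg, neg_div_neg_eq]
  simp

theorem isFiniteMetricNorm_of_abs_gt_four {x : ℝ} (hx : 4 < |x|) (hx' : ∀ w : ℤ, x ≠ 4 * w) :
    IsFiniteMetricNorm (mNorm x) := by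
  rcases lt_abs.1 hx with h | h
  · exact isFiniteMetricNorm_of_gt_four h hx'
  · have h1 := isFiniteMetricNorm_of_gt_four h fun w hw => hx' (-w) (by push_cast; linarith)
    have h2 : mNorm x = mNorm (-x) := by
      funext t
      rw [← mNorm_neg_neg, h1.neg]
    rwa [h2]

/-! ### Real values of zeta -/

theorem riemannZeta_ofReal {s : ℝ} (hs : 1 < s) :
    riemannZeta s = ((∑' n : ℕ, ((n : ℝ) + 1) ^ (-s) : ℝ) : ℂ) := by
  rw [zeta_eq_tsum_one_div_nat_add_one_cpow (by simpa using hs), Complex.ofReal_tsum]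
  congr 1 with n
  rw [Complex.ofReal_cpow (by positivity)]
  push_cast
  rw [Complex.cpow_neg, one_div]

theorem one_le_zeta_series {s : ℝ} (hs : 1 < s) : 1 ≤ ∑' n : ℕ, ((n : ℝ) + 1) ^ (-s) := by
  have := (summable_succ_rpow hs).le_tsum 0 fun n _ => by positivity
  simpa using this

theorem zeta_series_le {s : ℝ} (hs : 4 ≤ s) : ∑' n : ℕ, ((n : ℝ) + 1) ^ (-s) ≤ 1.0825 := by
  have h4 : HasSum (fun n : ℕ => ((n : ℝ) + 1) ^ (-4 : ℝ)) (Real.pi ^ 4 / 90) := by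
    have := (hasSum_nat_add_iff' 1).2 hasSum_zeta_four
    simp only [Finset.range_one, Finset.sum_singleton, Nat.cast_zero, Nat.cast_add,
      Nat.cast_one] at this
    have e : (fun n : ℕ => ((n : ℝ) + 1) ^ (-4 : ℝ)) = fun n : ℕ => 1 / ((n : ℝ) + 1) ^ 4 := by
      funext n
      rw [Real.rpow_neg (by positivity), one_div]
      norm_cast
    rw [e]
    simpa using this
  have h1 : ∑' n : ℕ, ((n : ℝ) + 1) ^ (-s) ≤ Real.pi ^ 4 / 90 := by
    rw [← h4.tsum_eq]
    refine (summable_succ_rpow (by linarith)).tsum_le_tsum (fun n => ?_) h4.summable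
    refine Real.rpow_le_rpow_of_exponent_le ?_ (by linarith)
    have : (0 : ℝ) ≤ n := Nat.cast_nonneg n
    linarith
  have h2 : Real.pi ^ 4 ≤ 3.1416 ^ 4 := by
    gcongr
    exact Real.pi_lt_d4.le
  refine h1.trans ?_
  rw [div_le_iff₀ (by norm_num)]
  exact h2.trans (by norm_num)

/-- The real number `ζ(1/2 + 4k)`. -/
def zetaVal (k : ℕ) : ℝ := ∑' n : ℕ, ((n : ℝ) + 1) ^ (-(1 / 2 + 4 * k : ℝ))

theorem riemannZeta_eq_zetaVal {k : ℕ} (hk : 1 ≤ k) :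
    riemannZeta (1 / 2 + 4 * k) = zetaVal k := by
  have : (1 : ℝ) ≤ k := by exact_mod_cast hk
  rw [zetaVal, ← riemannZeta_ofReal (by linarith)]
  push_cast
  rfl

theorem zetaVal_bounds {k : ℕ} (hk : 1 ≤ k) : 1 ≤ zetaVal k ∧ zetaVal k ≤ 1.0825 := by
  have : (1 : ℝ) ≤ k := by exact_mod_cast hk
  exact ⟨one_le_zeta_series (by linarith), zeta_series_le (by linarith)⟩

theorem cTilde_eq {k : ℕ} (hk : 1 ≤ k) : cTilde k =
    1 / (Real.pi ^ (3 / 4 : ℝ) * Real.Gamma (5 / 4 + 2 * k) * (2 * k - 1 / 4) * zetaVal k) := by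
  rw [cTilde, riemannZeta_eq_zetaVal hk, Complex.ofReal_re]

theorem cTilde_pos {k : ℕ} (hk : 1 ≤ k) : 0 < cTilde k := by
  have : (1 : ℝ) ≤ k := by exact_mod_cast hk
  have h1 : 0 < Real.Gamma (5 / 4 + 2 * k) := Real.Gamma_pos_of_pos (by linarith)
  have h2 := zetaVal_bounds hk
  have h3 : (0 : ℝ) < 2 * k - 1 / 4 := by linarith
  have h4 : 0 < zetaVal k := by linarith
  rw [cTilde_eq hk]
  positivity

/-- The constant only has to exceed `2π² ≈ 19.74`, the factor by which differences of consecutive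
even powers can grow on `[0, π]`. The Gamma recursion and bounds for zeta close to `1` leave ample
room. -/
theorem cTilde_succ_le {k : ℕ} (hk : 1 ≤ k) : 20.2 * cTilde (k + 1) ≤ cTilde k := by
  have hk' : (1 : ℝ) ≤ k := by exact_mod_cast hk
  have h1 : 0 < Real.Gamma (5 / 4 + 2 * k) := Real.Gamma_pos_of_pos (by linarith)
  have h2 := zetaVal_bounds hk
  have h2' := zetaVal_bounds (Nat.le_succ_of_le hk : 1 ≤ k + 1)
  have h3 : (0 : ℝ) < 2 * k - 1 / 4 := by linarith
  have hG : Real.Gamma (5 / 4 + 2 * (k + 1 : ℕ)) =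
      (9 / 4 + 2 * k) * ((5 / 4 + 2 * k) * Real.Gamma (5 / 4 + 2 * k)) := by
    rw [← Real.Gamma_add_one (by linarith), show (9 / 4 + 2 * (k : ℝ)) = 5 / 4 + 2 * k + 1 by ring,
      ← Real.Gamma_add_one (by linarith)]
    congr 1; push_cast; ring
  rw [cTilde_eq hk, cTilde_eq (by omega), hG]
  set G := Real.Gamma (5 / 4 + 2 * k)
  set Z := zetaVal k
  set Z' := zetaVal (k + 1)
  have hZ : 0 < Z := by linarith
  have hZ' : 0 < Z' := by linarith
  have hp : 0 < Real.pi ^ (3 / 4 : ℝ) := Real.rpow_pos_of_pos Real.pi_pos _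
  have h5 : (0 : ℝ) < 2 * ((k + 1 : ℕ) : ℝ) - 1 / 4 := by push_cast; linarith
  rw [mul_one_div, div_le_div_iff₀ (by positivity) (by positivity)]
  have h6 : 20.2 * ((2 * (k : ℝ) - 1 / 4) * Z) ≤
      (9 / 4 + 2 * k) * (5 / 4 + 2 * k) * (2 * ((k + 1 : ℕ) : ℝ) - 1 / 4) * Z' := by
    push_cast
    have e1 : 20.2 * ((2 * (k : ℝ) - 1 / 4) * Z) ≤ 20.2 * ((2 * (k : ℝ) - 1 / 4) * 1.0825) := by
      gcongr
      exact h2.2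
    have e2 : (9 / 4 + 2 * (k : ℝ)) * (5 / 4 + 2 * k) * (2 * (k + 1) - 1 / 4) * 1 ≤
        (9 / 4 + 2 * k) * (5 / 4 + 2 * k) * (2 * (k + 1) - 1 / 4) * Z' := by
      have : (0 : ℝ) < 2 * (k + 1) - 1 / 4 := by linarith
      gcongr
      exact h2'.1
    refine e1.trans (le_trans ?_ e2)
    -- Substituting `k = j + 1` turns the claim into a cubic inequality on `j ≥ 0`.
    obtain ⟨j, hj⟩ : ∃ j : ℝ, (k : ℝ) = j + 1 := ⟨k - 1, by ring⟩
    have hj0 : 0 ≤ j := by linarith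
    rw [hj]
    nlinarith [pow_nonneg hj0 2, pow_nonneg hj0 3]
  calc _ = (Real.pi ^ (3 / 4 : ℝ) * G) * (20.2 * ((2 * (k : ℝ) - 1 / 4) * Z)) := by ring
    _ ≤ (Real.pi ^ (3 / 4 : ℝ) * G) * _ := mul_le_mul_of_nonneg_left h6 (by positivity)
    _ = _ := by ring

/-! ### The kernel of the central strip -/

theorem hasEvenSeries_one_sub_cos :
    HasEvenSeries (fun v => 1 - Real.cos v) fun k => (-1) ^ k / (2 * k + 2).factorial := by
  refine ⟨fun v => ?_, fun v => ?_⟩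
  · have h := (Real.summable_pow_div_factorial |v|).comp_injective
      (i := fun k : ℕ => 2 * k + 2) fun a b h => by simpa using h
    refine h.congr fun k => ?_
    simp only [Function.comp_apply, abs_div, abs_pow, abs_neg, abs_one, one_pow, Nat.abs_cast]
    ring
  · have h := (hasSum_nat_add_iff' 1).2 (Real.hasSum_cos v)
    have h2 := h.neg
    simp only [Finset.range_one, Finset.sum_singleton, pow_zero, mul_zero, Nat.factorial_zero,
      Nat.cast_one, div_one, mul_one, neg_sub] at h2
    refine h2.congr_fun fun k => ?_
    rw [show 2 * (k + 1) = 2 * k + 2 by ring, pow_succ]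
    ring

/-- A multiple of `P_0`, as a mixture of functions `1 - cos`. -/
def centralKernel : ℝ → ℝ :=
  moebiusMix (1 / 2) (betaMix (-5 / 4) 1 (betaMix 0 (1 / 4) fun v => 1 - Real.cos v))

/-- The bound `re z > 1/4` is imposed both by the Dirichlet series of `1/ζ(1/2+2z)` and by the beta
weight that yields `1/(z - 1/4)`. -/
theorem lap_centralKernel {z : ℂ} (h0 : 1 / 4 < z.re) (h2 : z.re < 2) :
    LapConv centralKernel z.re ∧ lap centralKernel z = Complex.Gamma (1 / 4) * (Real.pi / 2) /
      (Complex.sin (Real.pi * z / 2) * (Complex.Gamma (5 / 4 + z) * (z - 1 / 4) *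
        riemannZeta (1 / 2 + 2 * z))) := by
  have h0' : 0 < z.re := by linarith
  have c0 := lapConv_one_sub_cos h0' h2
  have m1 : Measurable (betaMix 0 (1 / 4) fun v => 1 - Real.cos v) :=
    measurable_betaMix (by fun_prop)
  have m2 := measurable_betaMix (c := -5 / 4) (b := 1) m1
  have c1 := lapConv_betaMix (c := 0) (b := 1 / 4) (by fun_prop) (by norm_num) (by linarith) c0
  have c2 := lapConv_betaMix (c := -5 / 4) (b := 1) m1 (by norm_num) (by linarith) c1
  have c3 := lapConv_moebiusMix (s := 1 / 2) m2 (by linarith) c2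
  refine ⟨c3, ?_⟩
  rw [centralKernel, lap_moebiusMix m2 (by linarith) c2, lap_betaMix m1 (by norm_num)
    (by linarith) c1, lap_betaMix (by fun_prop) (by norm_num) (by linarith) c0,
    lap_one_sub_cos h0' h2]
  have hf := zeta_factor_ne_zero h0
  have hs := sin_ne_zero_of_re h0' h2
  have g1 : Complex.Gamma (1 + z) ≠ 0 := Complex.Gamma_ne_zero_of_re_pos (by simp; linarith)
  have g4 : Complex.Gamma (z - 1 / 4) ≠ 0 :=
    Complex.Gamma_ne_zero_of_re_pos (by norm_num; linarith)
  have hq : z - 1 / 4 ≠ 0 := sub_ne_zero.2 (ne_quarter_of_re h0)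
  have e1 : (1 : ℂ) + ((-5 / 4 : ℝ) : ℂ) + z = z - 1 / 4 := by push_cast; ring
  have e2 : (1 : ℂ) + ((0 : ℝ) : ℂ) + z = 1 + z := by push_cast; ring
  have e3 : ((1 / 4 : ℝ) : ℂ) = 1 / 4 := by push_cast; ring
  have e4 : ((1 / 2 : ℝ) : ℂ) = 1 / 2 := by push_cast; ring
  have e5 : 1 + z + 1 / 4 = 5 / 4 + z := by ring
  rw [e1, e2, e3, e4, e5, Complex.ofReal_one, Complex.Gamma_add_one _ hq, Complex.Gamma_one]
  have z1 : Complex.Gamma (5 / 4 + z) ≠ 0 := fun h => hf (by rw [h]; simp)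
  have z2 : riemannZeta (1 / 2 + 2 * z) ≠ 0 := fun h => hf (by rw [h]; simp)
  generalize Complex.Gamma (1 + z) = G1 at *
  generalize Complex.Gamma (z - 1 / 4) = G4 at *
  generalize z - 1 / 4 = q at *
  generalize Complex.Gamma (5 / 4 + z) = G5 at *
  generalize riemannZeta (1 / 2 + 2 * z) = Z at *
  generalize Complex.sin (Real.pi * z / 2) = S at *
  field_simp

theorem HasEvenSeries.betaMix {g : ℝ → ℝ} {a : ℕ → ℝ} {c b : ℝ} (hb : 0 < b) (hc : 0 < 3 + c)
    (hg : HasEvenSeries g a) : HasEvenSeries (betaMix c b g) fun k =>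
      a k * (Real.Gamma (3 + c + 2 * k) * Real.Gamma b / Real.Gamma (3 + c + 2 * k + b)) := by
  have h := hg.mixture (measurable_beta_weight c b) measurable_id ae_Ioo_pos
    ((ae_restrict_iff' measurableSet_Ioo).2 (ae_of_all _ fun y hy => (hy : y ∈ Ioo (0 : ℝ) 1).2.le))
    (integrable_beta_real hb (by linarith))
  have e : ∀ k : ℕ, ∫ y in Ioo (0 : ℝ) 1, (y ^ c * (1 - y) ^ (b - 1)) * id y ^ (2 * k + 2) =
      Real.Gamma (3 + c + 2 * k) * Real.Gamma b / Real.Gamma (3 + c + 2 * k + b) := by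
    intro k
    have hk : (0 : ℝ) ≤ k := Nat.cast_nonneg k
    have := (integrable_beta_complex (c := c) (z := ((2 * k + 2 : ℕ) : ℂ)) hb
      (by simp; linarith)).2
    apply Complex.ofReal_injective
    rw [← integral_complex_ofReal]
    refine Eq.trans (congrArg _ (funext fun y => ?_)) (this.trans ?_)
    · rw [Complex.cpow_natCast]
      push_cast
      rfl
    · simp only [Complex.ofReal_div, Complex.ofReal_mul, ← Complex.Gamma_ofReal]
      push_cast
      ring_nf
  simp only [e] at h
  exact h

theorem HasEvenSeries.moebiusMix {g : ℝ → ℝ} {a : ℕ → ℝ}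
    (hg : HasEvenSeries g a) : HasEvenSeries (moebiusMix (1 / 2) g) fun k =>
      a k * (zetaVal (k + 1))⁻¹ := by
  have h := hg.mixture (ν := Measure.count) (h := moebiusWeight (1 / 2)) (y := invSq)
    .of_discrete .of_discrete (ae_of_all _ invSq_pos)
    (ae_of_all _ invSq_le_one) (integrable_moebiusWeight (by norm_num))
  have e : ∀ k : ℕ, ∫ n, moebiusWeight (1 / 2) n * invSq n ^ (2 * k + 2) ∂Measure.count =
      (zetaVal (k + 1))⁻¹ := by
    intro k
    have hk : (0 : ℝ) ≤ k := Nat.cast_nonneg k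
    have := integral_moebiusWeight (s := 1 / 2) (z := ((2 * k + 2 : ℕ) : ℂ))
      (by simp; linarith)
    have e4 : ((1 / 2 : ℝ) : ℂ) + 2 * ((2 * k + 2 : ℕ) : ℂ) = 1 / 2 + 4 * ((k + 1 : ℕ) : ℂ) := by
      push_cast; ring
    rw [e4, riemannZeta_eq_zetaVal (by omega)] at this
    apply Complex.ofReal_injective
    rw [← integral_complex_ofReal, Complex.ofReal_inv, ← one_div, ← this]
    congr 1 with n
    rw [Complex.cpow_natCast]
    push_cast
    rfl
  simp only [e] at h
  exact h

theorem HasEvenSeries.const_mul {g : ℝ → ℝ} {a : ℕ → ℝ} (hg : HasEvenSeries g a) (c : ℝ) :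
    HasEvenSeries (fun v => c * g v) fun k => c * a k := by
  refine ⟨fun v => ((hg.summable v).mul_left |c|).congr fun k => ?_,
    fun v => ((hg.hasSum v).mul_left c).congr_fun fun k => ?_⟩
  · rw [abs_mul, mul_assoc]
  · rw [mul_assoc]

/-- Each mixture multiplies the coefficient of `v^{2k+2}` by its moment of that order. The factor
`Γ(3+2k)` from the first beta weight cancels the factorial of the cosine series, leaving the
coefficients of `P_0`. -/
theorem hasEvenSeries_centralKernel : HasEvenSeries centralKernel fun k =>
    Real.pi ^ (3 / 4 : ℝ) * Real.Gamma (1 / 4) * ((-1) ^ k * cTilde (k + 1)) := by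
  have h := ((hasEvenSeries_one_sub_cos.betaMix (c := 0) (b := 1 / 4) (by norm_num)
    (by norm_num)).betaMix (c := -5 / 4) (b := 1) (by norm_num) (by norm_num)).moebiusMix
  rw [← centralKernel] at h
  convert h using 2 with k
  have hk : (0 : ℝ) ≤ k := Nat.cast_nonneg k
  have hq : (7 / 4 + 2 * k : ℝ) ≠ 0 := by positivity
  have g1 : Real.Gamma (1 / 4) ≠ 0 := (Real.Gamma_pos_of_pos (by norm_num)).ne'
  have g2 : Real.Gamma (7 / 4 + 2 * k) ≠ 0 := (Real.Gamma_pos_of_pos (by positivity)).ne'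
  have g3 : Real.Gamma (13 / 4 + 2 * k) ≠ 0 := (Real.Gamma_pos_of_pos (by positivity)).ne'
  have hp : Real.pi ^ (3 / 4 : ℝ) ≠ 0 := (Real.rpow_pos_of_pos Real.pi_pos _).ne'
  have hz : zetaVal (k + 1) ≠ 0 := by linarith [zetaVal_bounds (Nat.succ_pos k : 1 ≤ k + 1)]
  have hfac : Real.Gamma (3 + 0 + 2 * k) = (2 * k + 2).factorial := by
    rw [← Real.Gamma_nat_eq_factorial]
    congr 1; push_cast; ring
  have hfac0 : ((2 * k + 2).factorial : ℝ) ≠ 0 := by exact_mod_cast Nat.factorial_ne_zero _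
  have hG : Real.Gamma (3 + -5 / 4 + 2 * k + 1) =
      (7 / 4 + 2 * k) * Real.Gamma (7 / 4 + 2 * k) := by
    rw [← Real.Gamma_add_one hq]
    congr 1; ring
  rw [hfac, hG, Real.Gamma_one, cTilde_eq (by omega),
    show (3 + 0 + 2 * k + 1 / 4 : ℝ) = 13 / 4 + 2 * k by ring,
    show (3 + -5 / 4 + 2 * k : ℝ) = 7 / 4 + 2 * k by ring,
    show (5 / 4 + 2 * ((k + 1 : ℕ) : ℝ)) = 13 / 4 + 2 * k by push_cast; ring,
    show (2 * ((k + 1 : ℕ) : ℝ) - 1 / 4) = 7 / 4 + 2 * k by push_cast; ring]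
  field_simp

theorem P0_eq_mul_centralKernel (v : ℝ) :
    P0 v = (Real.pi ^ (3 / 4 : ℝ) * Real.Gamma (1 / 4))⁻¹ * centralKernel v := by
  rw [P0, ← tsum_neg, ← ((hasEvenSeries_centralKernel.hasSum v).mul_left _).tsum_eq]
  refine tsum_congr fun k => ?_
  have g1 : Real.Gamma (1 / 4) ≠ 0 := (Real.Gamma_pos_of_pos (by norm_num)).ne'
  have hp : Real.pi ^ (3 / 4 : ℝ) ≠ 0 := (Real.rpow_pos_of_pos Real.pi_pos _).ne'
  rw [show (-v ^ 2) ^ (k + 1) = -((-1) ^ k * v ^ (2 * k + 2)) by rw [neg_pow]; ring]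
  field_simp

theorem hasEvenSeries_P0 : HasEvenSeries P0 fun k => (-1) ^ k * cTilde (k + 1) := by
  have g1 : Real.Gamma (1 / 4) ≠ 0 := (Real.Gamma_pos_of_pos (by norm_num)).ne'
  have hp : Real.pi ^ (3 / 4 : ℝ) ≠ 0 := (Real.rpow_pos_of_pos Real.pi_pos _).ne'
  have h := hasEvenSeries_centralKernel.const_mul (Real.pi ^ (3 / 4 : ℝ) * Real.Gamma (1 / 4))⁻¹
  simp only [← P0_eq_mul_centralKernel] at h
  convert h using 2 with k
  field_simp

theorem lap_P0 {z : ℂ} (h0 : 1 / 4 < z.re) (h2 : z.re < 2) :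
    LapConv (fun v => P0 (Real.pi * v)) z.re ∧
      lap (fun v => P0 (Real.pi * v)) z = 2 / nFun (2 * z) := by
  obtain ⟨hc, hl⟩ := lap_centralKernel h0 h2
  have hP : P0 = fun v => (Real.pi ^ (3 / 4 : ℝ) * Real.Gamma (1 / 4))⁻¹ * centralKernel v :=
    funext P0_eq_mul_centralKernel
  have hc1 : LapConv P0 z.re := by
    rw [hP]
    exact (hc.const_mul _).congr (ae_of_all _ fun u => (mul_assoc _ _ _).symm)
  have hl1 : lap P0 z = ((Real.pi ^ (3 / 4 : ℝ) * Real.Gamma (1 / 4))⁻¹ : ℝ) *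
      lap centralKernel z := by
    rw [hP, lap, lap, ← integral_const_mul]
    congr 1 with u
    push_cast
    ring
  refine ⟨lapConv_comp_mul Real.pi_pos hc1, ?_⟩
  have hq := ne_quarter_of_re h0
  have hpi : (Real.pi : ℂ) ≠ 0 := by exact_mod_cast Real.pi_ne_zero
  rw [lap_comp_mul Real.pi_pos, hl1, hl, nFun_two_mul (by linarith) hq]
  have hf := zeta_factor_ne_zero h0
  have hs := sin_ne_zero_of_re (by linarith : 0 < z.re) h2
  have hG : Complex.Gamma (1 / 4) ≠ 0 := Complex.Gamma_ne_zero_of_re_pos (by norm_num)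
  have e1 : (((Real.pi ^ (3 / 4 : ℝ) * Real.Gamma (1 / 4))⁻¹ : ℝ) : ℂ) =
      ((Real.pi : ℂ) ^ (3 / 4 : ℂ) * Complex.Gamma (1 / 4))⁻¹ := by
    rw [Complex.ofReal_inv, Complex.ofReal_mul, Complex.ofReal_cpow Real.pi_pos.le,
      ← Complex.Gamma_ofReal]
    push_cast
    rfl
  have e2 : (Real.pi : ℂ) ^ (-1 / 4 : ℂ) * Real.pi = (Real.pi : ℂ) ^ (3 / 4 : ℂ) := by
    nth_rw 2 [← Complex.cpow_one (Real.pi : ℂ)]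
    rw [← Complex.cpow_add _ _ hpi]
    norm_num
  rw [e1, ← e2]
  have p1 := pi_cpow_ne_zero z
  have p3 := pi_cpow_ne_zero (-1 / 4)
  generalize (Real.pi : ℂ) ^ z = A at *
  generalize (Real.pi : ℂ) ^ (-1 / 4 : ℂ) = D at *
  generalize Complex.Gamma (5 / 4 + z) * (z - 1 / 4) * riemannZeta (1 / 2 + 2 * z) = F at *
  generalize Complex.sin (Real.pi * z / 2) = S at *
  field_simp
  norm_num

/-! ### Elementary properties of `P_0` -/

theorem HasEvenSeries.continuous {g : ℝ → ℝ} {a : ℕ → ℝ} (hg : HasEvenSeries g a) :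
    Continuous g := by
  refine continuous_iff_continuousAt.2 fun v => ?_
  have hO : Ioo (-(|v| + 1)) (|v| + 1) ∈ 𝓝 v :=
    isOpen_Ioo.mem_nhds ⟨by linarith [neg_abs_le v], by linarith [le_abs_self v]⟩
  refine ContinuousOn.continuousAt (s := Ioo (-(|v| + 1)) (|v| + 1)) ?_ hO
  have he : g = fun v => ∑' k, a k * v ^ (2 * k + 2) := funext fun v => (hg.hasSum v).tsum_eq.symm
  rw [he]
  refine continuousOn_tsum (fun k => by fun_prop) (hg.summable (|v| + 1)) fun k x hx => ?_
  rw [norm_mul, norm_pow, Real.norm_eq_abs, Real.norm_eq_abs,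
    abs_of_nonneg (by positivity : 0 ≤ |v| + 1)]
  gcongr
  exact (abs_lt.2 hx).le

theorem HasEvenSeries.exists_le_sq {g : ℝ → ℝ} {a : ℕ → ℝ} (hg : HasEvenSeries g a) {R : ℝ}
    (hR : 0 < R) : ∃ C, 0 ≤ C ∧ ∀ v, |v| ≤ R → |g v| ≤ C * v ^ 2 := by
  refine ⟨(∑' k, |a k| * |R| ^ (2 * k + 2)) / R ^ 2, by positivity, fun v hv => ?_⟩
  rw [← (hg.hasSum v).tsum_eq, ← Real.norm_eq_abs]
  refine tsum_of_norm_bounded (((hg.summable R).hasSum.div_const _).mul_right _) fun k => ?_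
  rw [norm_mul, norm_pow, Real.norm_eq_abs, Real.norm_eq_abs, abs_of_pos hR, pow_add, pow_add,
    sq_abs]
  have : |v| ^ (2 * k) ≤ R ^ (2 * k) := by gcongr
  calc |a k| * (|v| ^ (2 * k) * v ^ 2) ≤ |a k| * (R ^ (2 * k) * v ^ 2) := by gcongr
    _ = _ := by field_simp

theorem hasSum_P0_sub (v₁ v₂ : ℝ) : HasSum (fun k : ℕ => (-1) ^ k * (cTilde (k + 1) *
    (v₂ ^ (2 * k + 2) - v₁ ^ (2 * k + 2)))) (P0 v₂ - P0 v₁) :=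
  ((hasEvenSeries_P0.hasSum v₂).sub (hasEvenSeries_P0.hasSum v₁)).congr_fun fun k => by ring

theorem pow_succ_sub_pow_succ_le {a b : ℝ} (hb : 0 ≤ b) (hab : b ≤ a) (m : ℕ) :
    a ^ (m + 2) - b ^ (m + 2) ≤ 2 * a * (a ^ (m + 1) - b ^ (m + 1)) := by
  have ha : 0 ≤ a := hb.trans hab
  have h1 : b ^ m ≤ a ^ m := by gcongr
  have h2 : 0 ≤ b ^ m := by positivity
  have h3 : b * b ≤ a * b := by gcongr
  have h4 : b ^ (m + 1) * (a - b) ≤ a * (a ^ (m + 1) - b ^ (m + 1)) := by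
    have e : a * (a ^ (m + 1) - b ^ (m + 1)) - b ^ (m + 1) * (a - b) =
        a ^ 2 * (a ^ m - b ^ m) + b ^ m * (a - b) ^ 2 := by ring
    have : 0 ≤ a ^ 2 * (a ^ m - b ^ m) + b ^ m * (a - b) ^ 2 := by
      have : 0 ≤ a ^ m - b ^ m := by linarith
      positivity
    nlinarith
  have e : a ^ (m + 2) - b ^ (m + 2) =
      a * (a ^ (m + 1) - b ^ (m + 1)) + b ^ (m + 1) * (a - b) := by ring
  linarith

theorem antitone_P0_terms {v₁ v₂ : ℝ} (h1 : 0 ≤ v₁) (h12 : v₁ ≤ v₂) (h2 : v₂ ≤ Real.pi) :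
    Antitone fun k : ℕ => cTilde (k + 1) * (v₂ ^ (2 * k + 2) - v₁ ^ (2 * k + 2)) := by
  refine antitone_nat_of_succ_le fun k => ?_
  have hc := cTilde_succ_le (Nat.succ_pos k : 1 ≤ k + 1)
  have hc0 := cTilde_pos (Nat.succ_pos (k + 1) : 1 ≤ k + 1 + 1)
  have hp := pow_succ_sub_pow_succ_le (sq_nonneg v₁) (pow_le_pow_left₀ h1 h12 2) k
  simp only [← pow_mul] at hp
  rw [show 2 * (k + 1) + 2 = 2 * (k + 2) by ring, show 2 * k + 2 = 2 * (k + 1) by ring]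
  have hd : 0 ≤ v₂ ^ (2 * (k + 1)) - v₁ ^ (2 * (k + 1)) :=
    sub_nonneg.2 (pow_le_pow_left₀ h1 h12 _)
  have hv : v₂ ^ 2 ≤ 3.1416 ^ 2 :=
    pow_le_pow_left₀ (h1.trans h12) (h2.trans Real.pi_lt_d4.le) 2
  calc _ ≤ cTilde (k + 1 + 1) * (2 * v₂ ^ 2 * (v₂ ^ (2 * (k + 1)) - v₁ ^ (2 * (k + 1)))) := by
        gcongr
    _ ≤ cTilde (k + 1 + 1) * (20.2 * (v₂ ^ (2 * (k + 1)) - v₁ ^ (2 * (k + 1)))) := by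
        gcongr
        norm_num at hv ⊢
        linarith
    _ = (20.2 * cTilde (k + 1 + 1)) * (v₂ ^ (2 * (k + 1)) - v₁ ^ (2 * (k + 1))) := by ring
    _ ≤ _ := mul_le_mul_of_nonneg_right hc hd

theorem P0_mono {v₁ v₂ : ℝ} (h1 : 0 ≤ v₁) (h12 : v₁ ≤ v₂) (h2 : v₂ ≤ Real.pi) :
    P0 v₁ ≤ P0 v₂ := by
  -- The sum is bounded below by the partial sums of even length; the empty one suffices here.
  have := (antitone_P0_terms h1 h12 h2).alternating_series_le_tendsto
    (hasSum_P0_sub v₁ v₂).tendsto_sum_nat 0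
  simp at this
  exact this

theorem P0_zero : P0 0 = 0 := by
  simp [P0]

theorem P0_pos {v : ℝ} (h0 : 0 < v) (h2 : v ≤ Real.pi) : 0 < P0 v := by
  -- Two terms are kept this time: `c̃(4) v² - c̃(8) v⁴` is strictly positive for `0 < v ≤ π`.
  have := (antitone_P0_terms le_rfl h0.le h2).alternating_series_le_tendsto
    (hasSum_P0_sub 0 v).tendsto_sum_nat 1
  simp [Finset.sum_range_succ, P0_zero] at this
  have hc := cTilde_succ_le le_rfl
  have hc0 := cTilde_pos (le_refl 1)
  norm_num at hc this
  have hv : v ^ 2 ≤ 3.1416 ^ 2 := pow_le_pow_left₀ h0.le (h2.trans Real.pi_lt_d4.le) 2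
  norm_num at hv
  have hv0 : 0 < v ^ 2 := by positivity
  have hc2 := cTilde_pos (one_le_two)
  have e : cTilde 2 * v ^ 4 = cTilde 2 * v ^ 2 * v ^ 2 := by ring
  nlinarith [mul_pos hc0 hv0, mul_pos hc2 hv0]

/-! ### Growth of analytic functions in a strip -/

/-- A lower bound for a zero-free analytic function of exponential type near the boundary of a
strip, from the Borel–Carathéodory inequality. -/
theorem exists_norm_inv_le_exp {m : ℂ → ℂ} (hm : Differentiable ℂ m)
    (h0 : ∀ z : ℂ, 0 < z.re → z.re < 2 → m z ≠ 0) {C : ℝ} (hC : 0 ≤ C)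
    (hgr : ∀ z : ℂ, 0 < z.re → z.re < 2 → ‖m z‖ ≤ Real.exp (C * (1 + |z.im|)))
    {D : ℝ} (hD : 0 ≤ D) (h1 : ∀ z : ℂ, z.re = 1 → ‖(m z)⁻¹‖ ≤ Real.exp D) :
    ∃ K, 0 < K ∧ ∀ z : ℂ, 0 < z.re → z.re ≤ 1 →
      ‖(m z)⁻¹‖ ≤ Real.exp (K * (1 + |z.im|) / z.re) := by
  -- The factor `3` is `1` from the bound at the centre of the disc plus `2` from
  -- Borel–Carathéodory. The summand `1` makes `M` positive.
  refine ⟨3 * (2 * C + D + 1), by positivity, fun z hz0 hz1 => ?_⟩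
  -- The unit disc about `c` touches the imaginary axis and stays in the zero-free strip; `z` has
  -- distance `1 - re z` from its centre, so `re z` becomes the Borel–Carathéodory denominator.
  set c : ℂ := 1 + z.im * Complex.I
  have hcre : c.re = 1 := by simp [c]
  have hcim : c.im = z.im := by simp [c]
  have hball : ∀ w ∈ Metric.ball c 1, 0 < w.re ∧ w.re < 2 ∧ |w.im| ≤ |z.im| + 1 := by
    intro w hw
    rw [Metric.mem_ball, dist_eq_norm] at hw
    have h2 := (Complex.abs_re_le_norm (w - c)).trans_lt hw
    have h3 := (Complex.abs_im_le_norm (w - c)).trans_lt hw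
    rw [Complex.sub_re, hcre, abs_lt] at h2
    rw [Complex.sub_im, hcim] at h3
    refine ⟨by linarith, by linarith, ?_⟩
    have := abs_add_le (w.im - z.im) z.im
    rw [sub_add_cancel] at this
    linarith
  have hne : ∀ w ∈ Metric.ball c 1, m w ≠ 0 := fun w hw => h0 w (hball w hw).1 (hball w hw).2.1
  have hdl : DifferentiableOn ℂ (fun w => deriv m w / m w) (Metric.ball c 1) :=
    (hm.deriv.differentiableOn).div hm.differentiableOn hne
  -- A primitive of the logarithmic derivative: a branch of `log m` on the disc, up to a constant.
  obtain ⟨g, hg⟩ := hdl.isExactOn_ball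
  have hcmem : c ∈ Metric.ball c 1 := Metric.mem_ball_self one_pos
  have hconst : ∀ w ∈ Metric.ball c 1, m w * Complex.exp (-g w) = m c * Complex.exp (-g c) := by
    intro w hw
    refine (convex_ball c 1).is_const_of_fderivWithin_eq_zero (𝕜 := ℂ)
      (f := fun w => m w * Complex.exp (-g w)) (fun x hx => ?_) (fun x hx => ?_) hw hcmem
    · exact (hm x).differentiableWithinAt.mul
        ((hg x hx).differentiableAt.neg.cexp).differentiableWithinAt
    · have hd : HasDerivAt (fun w => m w * Complex.exp (-g w)) 0 x := by
        have := (hm x).hasDerivAt.mul (hg x hx).neg.cexp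
        refine this.congr_deriv ?_
        have := hne x hx
        simp
        field_simp
        ring
      rw [fderivWithin_of_isOpen Metric.isOpen_ball hx]
      ext
      simp [hd.hasFDerivAt.fderiv]
  have hexp : ∀ w ∈ Metric.ball c 1, m w = m c * Complex.exp (g w - g c) := by
    intro w hw
    have h2 := hconst w hw
    rw [Complex.exp_neg, Complex.exp_neg] at h2
    rw [Complex.exp_sub]
    have h3 := Complex.exp_ne_zero (g w)
    have h4 := Complex.exp_ne_zero (g c)
    field_simp at h2 ⊢
    linear_combination h2
  set M : ℝ := (2 * C + D + 1) * (1 + |z.im|)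
  have habs := abs_nonneg z.im
  have hM : 0 < M := by positivity
  have hMD : D ≤ M := by simp only [M]; nlinarith
  have hmc : ‖(m c)⁻¹‖ ≤ Real.exp D := h1 c hcre
  have hmc0 : 0 < ‖m c‖ := norm_pos_iff.2 (hne c hcmem)
  have hsub : ∀ ζ ∈ Metric.ball (0 : ℂ) 1, c + ζ ∈ Metric.ball c 1 := by
    intro ζ hζ
    simpa [dist_eq_norm] using hζ
  have hBC := Complex.borelCaratheodory_zero (f := fun ζ => g (c + ζ) - g c) (R := 1) (M := M)
    (z := z - c) hM ?_ ?_ one_pos ?_ (by simp)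
  · have hzc : z - c = ((z.re - 1 : ℝ) : ℂ) := by
      apply Complex.ext <;> simp [c]
    have hn : ‖z - c‖ = 1 - z.re := by
      rw [hzc, Complex.norm_real, Real.norm_eq_abs, abs_sub_comm, abs_of_nonneg (by linarith)]
    rw [hn] at hBC
    simp only [add_sub_cancel, sub_sub_cancel] at hBC
    have hzb : z ∈ Metric.ball c 1 := by
      rw [Metric.mem_ball, dist_eq_norm, hn]; linarith
    rw [hexp z hzb, mul_inv, norm_mul, ← Complex.exp_neg, Complex.norm_exp]
    calc ‖(m c)⁻¹‖ * Real.exp (-(g z - g c)).re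
        ≤ Real.exp (M / z.re) * Real.exp (2 * M / z.re) := by
          gcongr
          · refine hmc.trans (Real.exp_le_exp.2 (hMD.trans ?_))
            rw [le_div_iff₀ hz0]
            nlinarith
          · refine (Complex.re_le_norm _).trans ?_
            rw [norm_neg]
            refine hBC.trans (div_le_div_of_nonneg_right ?_ hz0.le)
            nlinarith
      _ = _ := by
          rw [← Real.exp_add]
          congr 1
          simp only [M]
          ring
  · refine DifferentiableOn.sub_const (fun ζ hζ => ?_) _
    exact ((hg _ (hsub ζ hζ)).differentiableAt.comp ζ (by fun_prop)).differentiableWithinAt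
  · intro ζ hζ
    have hw := hsub ζ hζ
    obtain ⟨b1, b2, b3⟩ := hball _ hw
    have h2 := hgr _ b1 b2
    rw [hexp _ hw, norm_mul, Complex.norm_exp] at h2
    change (g (c + ζ) - g c).re ≤ M
    rw [← Real.exp_le_exp]
    have h3 : Real.exp (g (c + ζ) - g c).re ≤ ‖(m c)⁻¹‖ * Real.exp (C * (1 + |(c + ζ).im|)) := by
      rw [norm_inv, inv_mul_eq_div, le_div_iff₀ hmc0, mul_comm]
      exact h2
    refine h3.trans ((mul_le_mul_of_nonneg_right hmc (Real.exp_pos _).le).trans ?_)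
    rw [← Real.exp_add, Real.exp_le_exp]
    simp only [M]
    nlinarith
  · simp only [Metric.mem_ball, dist_zero_right]
    have hzc : z - c = ((z.re - 1 : ℝ) : ℂ) := by
      apply Complex.ext <;> simp [c]
    rw [hzc, Complex.norm_real, Real.norm_eq_abs, abs_sub_comm, abs_of_nonneg (by linarith)]
    linarith

/-- This sum has poles at `±i`, the corners of the square `|re| + |im| ≤ 1` on the imaginary axis.
The summand singular at the nearer corner gives the lower bound, and the other has nonnegative real
part. -/
theorem re_inv_add_inv_ge {ζ : ℂ} {s : ℝ} (hs : 0 < s) (h1 : |ζ.re| ≤ s) (h2 : |ζ.im| = 1 - s) :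
    1 / (2 * s) ≤ ((1 + Complex.I * ζ)⁻¹ + (1 - Complex.I * ζ)⁻¹).re := by
  have ha : (1 + Complex.I * ζ).re = 1 - ζ.im := by simp; ring
  have ha' : (1 + Complex.I * ζ).im = ζ.re := by simp
  have hb : (1 - Complex.I * ζ).re = 1 + ζ.im := by simp
  have hb' : (1 - Complex.I * ζ).im = -ζ.re := by simp
  rw [Complex.add_re, Complex.inv_re, Complex.inv_re, Complex.normSq_apply, Complex.normSq_apply,
    ha, ha', hb, hb']
  have hr : ζ.re * ζ.re ≤ s * s := by
    rw [← abs_mul_abs_self ζ.re]; gcongr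
  have hr0 := mul_self_nonneg ζ.re
  have key : ∀ y : ℝ, y = 1 - s → 1 / (2 * s) ≤ (1 - y) / ((1 - y) * (1 - y) + ζ.re * ζ.re) := by
    rintro y rfl
    rw [div_le_div_iff₀ (by positivity) (by nlinarith)]
    nlinarith
  have pos : ∀ y : ℝ, |y| ≤ 1 → 0 ≤ (1 + y) / ((1 + y) * (1 + y) + ζ.re * ζ.re) := by
    intro y hy
    have := (abs_le.1 hy).1
    exact div_nonneg (by linarith) (by nlinarith)
  rcases le_total 0 ζ.im with h | h
  · rw [abs_of_nonneg h] at h2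
    have e1 := key _ h2
    have e2 := pos ζ.im (by rw [abs_of_nonneg h]; linarith)
    have e3 : -ζ.re * -ζ.re = ζ.re * ζ.re := by ring
    rw [e3]
    linarith
  · rw [abs_of_nonpos h] at h2
    have e1 := key _ h2
    have e2 := pos (-ζ.im) (by rw [abs_neg, abs_of_nonpos h]; linarith)
    have e3 : -ζ.re * -ζ.re = ζ.re * ζ.re := by ring
    rw [sub_neg_eq_add] at e1
    rw [e3]
    rw [← sub_eq_add_neg] at e2
    linarith

/-- The boundary of the square `|re| + |im| ≤ 1` centred at `i im z` meets the imaginary axis only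
at two corners. There a factor `exp(-2 K2 q)` with `re q ≥ 1/(2s)` cancels the blow-up `exp(K2/s)`,
so the maximum principle bounds `f` inside, including on the axis. -/
theorem norm_le_exp_of_singular_bound {f : ℂ → ℂ} (hf : DifferentiableOn ℂ f {z | |z.re| < 2})
    {K : ℝ} (hK : 0 < K)
    (hb : ∀ z : ℂ, z.re ≠ 0 → |z.re| ≤ 1 → ‖f z‖ ≤ Real.exp (K * (1 + |z.im|) / |z.re|))
    {z : ℂ} (hz : |z.re| < 1) : ‖f z‖ ≤ Real.exp (8 * K * (1 + |z.im|)) := by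
  set t := z.im
  set K2 := K * (2 + |t|)
  have hK2 : 0 < K2 := by positivity
  have habs := abs_nonneg t
  have hre : ∀ ζ : ℂ, (ζ + t * Complex.I).re = ζ.re := by intro ζ; simp
  have him : ∀ ζ : ℂ, (ζ + t * Complex.I).im = ζ.im + t := by intro ζ; simp
  obtain ⟨M, hM⟩ : ∃ M, ∀ ζ : ℂ, ‖ζ‖ ≤ 1 → ‖f (ζ + t * Complex.I)‖ ≤ M := by
    have hc : ContinuousOn (fun ζ : ℂ => f (ζ + t * Complex.I)) (Metric.closedBall 0 1) := by
      refine hf.continuousOn.comp (by fun_prop) fun w hw => ?_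
      rw [Metric.mem_closedBall, dist_zero_right] at hw
      have := (Complex.abs_re_le_norm _).trans hw
      simp only [mem_ofPred_eq, hre]
      linarith
    obtain ⟨M, hM⟩ := (isCompact_closedBall (0 : ℂ) 1).exists_bound_of_continuousOn hc
    exact ⟨M, fun ζ hζ => hM ζ (by simpa using hζ)⟩
  -- The corners are cut off at height `1 - η`. On the cuts the compactness bound `M` replaces the
  -- singular bound, and `η` is so small that `exp(K2/η)` still dominates it.
  obtain ⟨η, hη0, hη1, hηM⟩ : ∃ η : ℝ, 0 < η ∧ η < 1 / 2 ∧ M ≤ Real.exp (K2 / η) := by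
    refine ⟨min (1 / 4) (K2 / (|M| + 1)), by positivity,
      (min_le_left _ _).trans_lt (by norm_num), ?_⟩
    have h1 : |M| + 1 ≤ K2 / min (1 / 4) (K2 / (|M| + 1)) := by
      rw [le_div_iff₀ (by positivity)]
      calc _ ≤ (|M| + 1) * (K2 / (|M| + 1)) := by gcongr; exact min_le_right _ _
        _ = K2 := by field_simp
    linarith [Real.add_one_le_exp (K2 / min (1 / 4) (K2 / (|M| + 1))), le_abs_self M]
  set q : ℂ → ℂ := fun ζ => (1 + Complex.I * ζ)⁻¹ + (1 - Complex.I * ζ)⁻¹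
  set g : ℂ → ℂ := fun ζ => f (ζ + t * Complex.I) * Complex.exp (-(2 * K2 : ℝ) * q ζ)
  set ψ : ℂ → ℝ := fun ζ => max (|ζ.re| + |ζ.im|) (|ζ.im| + η)
  have hψ : Continuous ψ := by fun_prop
  have hnorm : ∀ ζ : ℂ, ‖g ζ‖ = ‖f (ζ + t * Complex.I)‖ * Real.exp (-(2 * K2 * (q ζ).re)) := by
    intro ζ
    rw [norm_mul, Complex.norm_exp, ← Complex.ofReal_neg, Complex.re_ofReal_mul, neg_mul]
  set U : Set ℂ := {ζ | ψ ζ < 1}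
  have hclU : closure U ⊆ {ζ | ψ ζ ≤ 1} :=
    closure_minimal (fun ζ hζ => by
      rw [mem_ofPred_eq]; exact le_of_lt (hζ : ψ ζ < 1)) (isClosed_le hψ continuous_const)
  have hfrU : frontier U ⊆ {ζ | ψ ζ = 1} := frontier_lt_subset_eq hψ continuous_const
  have hle1 : ∀ ζ : ℂ, ψ ζ ≤ 1 → |ζ.re| + |ζ.im| ≤ 1 ∧ |ζ.im| ≤ 1 - η := fun ζ h =>
    ⟨(le_max_left _ _).trans h, by linarith [(le_max_right (|ζ.re| + |ζ.im|) (|ζ.im| + η)).trans h]⟩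
  have hnorm1 : ∀ ζ : ℂ, ψ ζ ≤ 1 → ‖ζ‖ ≤ 1 := fun ζ h =>
    (Complex.norm_le_abs_re_add_abs_im ζ).trans (hle1 ζ h).1
  have hbd : Bornology.IsBounded U := by
    refine (Metric.isBounded_closedBall (x := (0 : ℂ)) (r := 1)).subset fun ζ hζ => ?_
    simpa using hnorm1 ζ (le_of_lt hζ)
  have hdiff : DiffContOnCl ℂ g U := by
    refine DifferentiableOn.diffContOnCl fun ζ hζ => DifferentiableAt.differentiableWithinAt ?_
    have hζ1 := hle1 ζ (hclU hζ)
    have him1 := abs_le.1 hζ1.2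
    have ha : (1 + Complex.I * ζ) ≠ 0 := fun h => by
      have := congrArg Complex.re h
      simp at this
      linarith
    have hb' : (1 - Complex.I * ζ) ≠ 0 := fun h => by
      have := congrArg Complex.re h
      simp at this
      linarith
    have hfd : DifferentiableAt ℂ f (ζ + t * Complex.I) := by
      refine hf.differentiableAt ((isOpen_lt (by fun_prop) continuous_const).mem_nhds ?_)
      rw [mem_ofPred_eq, hre]
      linarith [abs_nonneg ζ.im]
    have h1 : DifferentiableAt ℂ (fun ζ => f (ζ + t * Complex.I)) ζ :=
      DifferentiableAt.comp (g := f) ζ hfd (by fun_prop)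
    have h2 : DifferentiableAt ℂ q ζ :=
      DifferentiableAt.add (DifferentiableAt.inv (by fun_prop) ha)
        (DifferentiableAt.inv (by fun_prop) hb')
    exact h1.mul ((h2.const_mul _).cexp)
  have hfr : ∀ ζ ∈ frontier U, ‖g ζ‖ ≤ 1 := by
    intro ζ hζ
    have h1 : ψ ζ = 1 := hfrU hζ
    obtain ⟨h2, h3⟩ := hle1 ζ h1.le
    have hfin : ∀ s : ℝ, 0 < s → |ζ.re| ≤ s → |ζ.im| = 1 - s →
        ‖f (ζ + t * Complex.I)‖ ≤ Real.exp (K2 / s) → ‖g ζ‖ ≤ 1 := by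
      intro s hs h4 h5 h6
      have h7 := re_inv_add_inv_ge hs h4 h5
      rw [hnorm]
      calc _ ≤ Real.exp (K2 / s) * Real.exp (-(2 * K2 * (1 / (2 * s)))) := by
            gcongr
        _ = 1 := by
            rw [← Real.exp_add, Real.exp_eq_one_iff]
            field_simp
            ring
    rcases max_choice (|ζ.re| + |ζ.im|) (|ζ.im| + η) with h | h
    · have h4 : |ζ.re| + |ζ.im| = 1 := by rw [← h]; exact h1
      have h5 : 0 < |ζ.re| := by linarith
      refine hfin |ζ.re| h5 le_rfl (by linarith) ?_
      have h6 := hb (ζ + t * Complex.I) (by rw [hre]; exact abs_pos.1 h5)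
        (by rw [hre]; linarith [abs_nonneg ζ.im])
      rw [hre, him] at h6
      refine h6.trans (Real.exp_le_exp.2 (div_le_div_of_nonneg_right ?_ h5.le))
      refine mul_le_mul_of_nonneg_left ?_ hK.le
      linarith [abs_add_le ζ.im t]
    · have h4 : |ζ.im| + η = 1 := by rw [← h]; exact h1
      exact hfin η hη0 (by linarith) (by linarith) ((hM ζ (hnorm1 ζ h1.le)).trans hηM)
  have hzU : ((z.re : ℝ) : ℂ) ∈ U := by
    change max (|((z.re : ℝ) : ℂ).re| + |((z.re : ℝ) : ℂ).im|) (|((z.re : ℝ) : ℂ).im| + η) < 1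
    simp only [Complex.ofReal_re, Complex.ofReal_im, abs_zero, add_zero, zero_add]
    exact max_lt hz (by linarith)
  have h1 := Complex.norm_le_of_forall_mem_frontier_norm_le hbd hdiff hfr (subset_closure hzU)
  have hzt : ((z.re : ℝ) : ℂ) + t * Complex.I = z := Complex.re_add_im z
  rw [hnorm, hzt] at h1
  -- After recentring, `z` becomes a real point `x`, where `q = 2/(1+x²)`; the damping costs at most
  -- `exp(4 K2)`.
  have hq : (q ((z.re : ℝ) : ℂ)).re ≤ 2 := by
    simp only [q]
    rw [Complex.add_re, Complex.inv_re, Complex.inv_re, Complex.normSq_apply,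
      Complex.normSq_apply]
    simp only [Complex.add_re, Complex.one_re, Complex.mul_re, Complex.I_re, Complex.ofReal_re,
      Complex.I_im, Complex.ofReal_im, Complex.sub_re, Complex.add_im, Complex.one_im,
      Complex.mul_im, Complex.sub_im]
    norm_num
    have h2 : (1 + z.re * z.re)⁻¹ ≤ 1 := inv_le_one_of_one_le₀ (by nlinarith [mul_self_nonneg z.re])
    linarith
  have h2 : ‖f z‖ ≤ Real.exp (2 * K2 * (q ((z.re : ℝ) : ℂ)).re) := by
    rwa [Real.exp_neg, ← div_eq_mul_inv, div_le_one (Real.exp_pos _)] at h1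
  refine h2.trans (Real.exp_le_exp.2 ?_)
  calc 2 * K2 * (q ((z.re : ℝ) : ℂ)).re ≤ 2 * K2 * 2 := by gcongr
    _ ≤ _ := by simp only [K2]; nlinarith

theorem norm_le_of_strip {f : ℂ → ℂ} (hf : DifferentiableOn ℂ f {z | |z.re| < 2})
    {K : ℝ} (hK : 0 < K)
    (hb : ∀ z : ℂ, z.re ≠ 0 → |z.re| ≤ 1 → ‖f z‖ ≤ Real.exp (K * (1 + |z.im|) / |z.re|))
    {B : ℝ} (hB : ∀ z : ℂ, |z.re| = 1 / 2 → ‖f z‖ ≤ B) {z : ℂ} (hz : |z.re| ≤ 1 / 2) :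
    ‖f z‖ ≤ B := by
  have hz' := abs_le.1 hz
  refine PhragmenLindelof.vertical_strip (a := -(1 / 2)) (b := 1 / 2) (f := f) ?_ ?_ ?_ ?_
    hz'.1 hz'.2
  · refine DifferentiableOn.diffContOnCl (hf.mono fun w hw => ?_)
    have : closure (Complex.re ⁻¹' Ioo (-(1 / 2)) (1 / 2)) ⊆ Complex.re ⁻¹' Icc (-(1 / 2)) (1 / 2) :=
      closure_minimal (preimage_mono Ioo_subset_Icc_self) (isClosed_Icc.preimage Complex.continuous_re)
    have h := this hw
    simp only [mem_preimage, mem_Icc] at h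
    have := abs_le.2 h
    simp only [mem_ofPred_eq]
    linarith
  -- Phragmén–Lindelöf on a strip of width `1` allows growth `exp(B e^{c|im|})` with `c < π`; the
  -- bound just proved is well below the case `c = 1`.
  · refine ⟨1, by norm_num; linarith [Real.pi_gt_three], 8 * K, ?_⟩
    refine Asymptotics.IsBigO.of_bound 1 ?_
    refine eventually_inf_principal.2 (Eventually.of_forall fun w hw => ?_)
    have hw' : |w.re| < 1 / 2 := abs_lt.2 hw
    refine (norm_le_exp_of_singular_bound hf hK hb (by linarith)).trans ?_
    rw [one_mul, Real.norm_of_nonneg (Real.exp_pos _).le, one_mul]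
    gcongr
    linarith [Real.add_one_le_exp |w.im|]
  · intro w hw
    exact hB w (by rw [hw]; norm_num)
  · intro w hw
    exact hB w (by rw [hw]; norm_num)

/-! ### One-sided Laplace transforms -/

/-- `∫_0^∞ k(u) e^{-zu} du`. -/
def halfLap (k : ℝ → ℂ) (z : ℂ) : ℂ := ∫ u in Ioi (0 : ℝ), k u * Complex.exp (-z * u)

/-- Absolute convergence of `halfLap k` on the line `re z = σ`. -/
def HalfLapConv (k : ℝ → ℂ) (σ : ℝ) : Prop :=
  IntegrableOn (fun u : ℝ => ‖k u‖ * Real.exp (-σ * u)) (Ioi 0)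

section

variable {k : ℝ → ℂ} {σ : ℝ} {z : ℂ}

theorem norm_mul_exp_le (hz : σ ≤ z.re) {u : ℝ} (hu : 0 < u) :
    ‖k u * Complex.exp (-z * u)‖ ≤ ‖k u‖ * Real.exp (-σ * u) := by
  rw [norm_mul, norm_exp_mul_ofReal, Complex.neg_re]
  gcongr

theorem HalfLapConv.integrableOn (hk : Continuous k) (h : HalfLapConv k σ) (hz : σ ≤ z.re) :
    IntegrableOn (fun u : ℝ => k u * Complex.exp (-z * u)) (Ioi 0) :=
  h.mono' (Continuous.aestronglyMeasurable (by fun_prop))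
    ((ae_restrict_iff' measurableSet_Ioi).2 (ae_of_all _ fun _ hu => norm_mul_exp_le hz hu))

theorem HalfLapConv.mono (hk : Continuous k) (h : HalfLapConv k σ) {τ : ℝ} (hτ : σ ≤ τ) :
    HalfLapConv k τ := by
  refine Integrable.mono' h (Continuous.aestronglyMeasurable (by fun_prop))
    ((ae_restrict_iff' measurableSet_Ioi).2 (ae_of_all _ fun u hu => ?_))
  have hu' : (0 : ℝ) < u := hu
  rw [norm_mul, norm_norm, Real.norm_of_nonneg (Real.exp_pos _).le]
  gcongr

theorem halfLapConv_of_norm_le (hk : Continuous k) {B a : ℝ}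
    (h : ∀ u, 0 < u → ‖k u‖ ≤ B * Real.exp (a * u)) (ha : a < σ) : HalfLapConv k σ := by
  refine Integrable.mono' ((integrableOn_exp_mul_Ioi (a := a - σ) (by linarith) 0).const_mul B)
    (Continuous.aestronglyMeasurable (by fun_prop))
    ((ae_restrict_iff' measurableSet_Ioi).2 (ae_of_all _ fun u hu => ?_))
  rw [norm_mul, norm_norm, Real.norm_of_nonneg (Real.exp_pos _).le, sub_mul, sub_eq_add_neg,
    Real.exp_add, ← mul_assoc, ← neg_mul]
  exact mul_le_mul_of_nonneg_right (h u hu) (Real.exp_pos _).le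

theorem HalfLapConv.norm_halfLap_le (h : HalfLapConv k σ) (hz : σ ≤ z.re) :
    ‖halfLap k z‖ ≤ ∫ u in Ioi (0 : ℝ), ‖k u‖ * Real.exp (-σ * u) :=
  norm_integral_le_of_norm_le h
    ((ae_restrict_iff' measurableSet_Ioi).2 (ae_of_all _ fun _ hu => norm_mul_exp_le hz hu))

theorem HalfLapConv.differentiableAt (hk : Continuous k) (h : HalfLapConv k σ) (hz : σ < z.re) :
    DifferentiableAt ℂ (halfLap k) z := by
  -- Half of the margin absorbs the factor `u` produced by differentiation, through `u e^{-εu} ≤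
  -- 1/ε`.
  set ε := (z.re - σ) / 2
  have hε : 0 < ε := by simp only [ε]; linarith
  have hs : {w : ℂ | σ + ε < w.re} ∈ 𝓝 z :=
    (isOpen_lt continuous_const Complex.continuous_re).mem_nhds (by
      rw [mem_ofPred_eq]; simp only [ε]; linarith)
  refine (hasDerivAt_integral_of_dominated_loc_of_deriv_le
    (μ := volume.restrict (Ioi (0 : ℝ))) (s := {w : ℂ | σ + ε < w.re})
    (F := fun w u => k u * Complex.exp (-w * u))
    (F' := fun w u => k u * (Complex.exp (-w * u) * (-u)))
    (bound := fun u => ε⁻¹ * (‖k u‖ * Real.exp (-σ * u))) hs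
    (Eventually.of_forall fun w => Continuous.aestronglyMeasurable (by fun_prop))
    (h.integrableOn hk hz.le) (Continuous.aestronglyMeasurable (by fun_prop)) ?_
    (h.const_mul _) (ae_of_all _ fun u w _ => ?_)).2.differentiableAt
  · refine (ae_restrict_iff' measurableSet_Ioi).2 (ae_of_all _ fun u hu w hw => ?_)
    have hu' : (0 : ℝ) < u := hu
    have hw' : σ + ε < w.re := hw
    rw [norm_mul, norm_mul, norm_exp_mul_ofReal, norm_neg, Complex.norm_real,
      Real.norm_of_nonneg hu'.le, Complex.neg_re]
    have h1 : Real.exp (-w.re * u) ≤ Real.exp (-σ * u) * Real.exp (-(ε * u)) := by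
      rw [← Real.exp_add]
      refine Real.exp_le_exp.2 ?_
      nlinarith
    have h2 : Real.exp (-(ε * u)) * u ≤ ε⁻¹ := by
      rw [Real.exp_neg, inv_mul_le_iff₀ (Real.exp_pos _)]
      have := Real.add_one_le_exp (ε * u)
      rw [← div_eq_mul_inv, le_div_iff₀ hε]
      linarith
    calc ‖k u‖ * (Real.exp (-w.re * u) * u)
        ≤ ‖k u‖ * (Real.exp (-σ * u) * Real.exp (-(ε * u)) * u) := by gcongr
      _ = ‖k u‖ * (Real.exp (-σ * u) * (Real.exp (-(ε * u)) * u)) := by ring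
      _ ≤ ‖k u‖ * (Real.exp (-σ * u) * ε⁻¹) := by gcongr
      _ = _ := by ring
  · have : HasDerivAt (fun w : ℂ => -w * (u : ℂ)) (-u) w := by
      simpa using (hasDerivAt_id w).neg.mul_const (u : ℂ)
    exact this.cexp.const_mul _

end

/-! ### Removable singularities -/

theorem limUnder_eventuallyEq {F A : ℂ → ℂ} {z₀ : ℂ} (hA : AnalyticAt ℂ A z₀)
    (h : F =ᶠ[𝓝[≠] z₀] A) : (fun z => limUnder (𝓝[≠] z) F) =ᶠ[𝓝 z₀] A := by
  have h1 : ∀ᶠ y in 𝓝 z₀, ∀ᶠ z in 𝓝 y, z ≠ z₀ → F z = A z :=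
    eventually_eventually_nhds.2 (eventually_nhdsWithin_iff.1 h)
  filter_upwards [h1, hA.eventually_analyticAt] with y hy hAy
  have h2 : F =ᶠ[𝓝[≠] y] A := by
    refine eventually_nhdsWithin_iff.2 ?_
    rcases eq_or_ne y z₀ with rfl | hne
    · exact hy
    · filter_upwards [hy, isOpen_ne.mem_nhds hne] with z hz hz2 _ using hz hz2
  exact ((hAy.continuousAt.tendsto.mono_left nhdsWithin_le_nhds).congr' h2.symm).limUnder_eq

/-- Write `m(z) = (z - z₀) q(z)` with `q(z₀) = m'(z₀) ≠ 0`. The regular part of `1/m` is then the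
difference quotient of `1/q` at `z₀`. -/
theorem inv_sub_pole {m : ℂ → ℂ} (hm : Differentiable ℂ m) {z₀ : ℂ} (h0 : m z₀ = 0)
    (h1 : deriv m z₀ ≠ 0) : ∃ A : ℂ → ℂ, AnalyticAt ℂ A z₀ ∧
      ∀ᶠ z in 𝓝[≠] z₀, (m z)⁻¹ = A z + (deriv m z₀)⁻¹ / (z - z₀) := by
  have hq : Differentiable ℂ (dslope m z₀) := by
    rw [← differentiableOn_univ, Complex.differentiableOn_dslope univ_mem, differentiableOn_univ]
    exact hm
  have hq0 : dslope m z₀ z₀ ≠ 0 := by rwa [dslope_same]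
  have hev : ∀ᶠ z in 𝓝 z₀, dslope m z₀ z ≠ 0 := hq.continuous.continuousAt.eventually_ne hq0
  obtain ⟨U, hU, hUo, hzU⟩ := mem_nhds_iff.1 hev
  have hd : DifferentiableOn ℂ (fun z => (dslope m z₀ z)⁻¹) U :=
    hq.differentiableOn.inv fun z hz => hU hz
  have hUn : U ∈ 𝓝 z₀ := hUo.mem_nhds hzU
  refine ⟨dslope (fun z => (dslope m z₀ z)⁻¹) z₀,
    ((Complex.differentiableOn_dslope hUn).2 hd).analyticAt hUn, ?_⟩
  filter_upwards [self_mem_nhdsWithin, mem_nhdsWithin_of_mem_nhds hUn] with z hz hzU'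
  have hz' : z - z₀ ≠ 0 := sub_ne_zero.2 hz
  have hqz : dslope m z₀ z ≠ 0 := hU hzU'
  have hmz : m z = (z - z₀) * dslope m z₀ z := by
    rw [dslope_of_ne _ hz, slope_def_field, h0]
    field_simp
    ring
  rw [dslope_of_ne _ hz, slope_def_field, dslope_same, hmz]
  field_simp
  ring

/-! ### Sums of simple poles on the imaginary axis -/

section Polar

variable {Z : Set ℂ} {c : ℂ → ℂ}

/-- `∑_{ρ ∈ Z} c(ρ) / (z - ρ)`. -/
def polarSum (Z : Set ℂ) (c : ℂ → ℂ) (z : ℂ) : ℂ := ∑' ρ : Z, c ρ / (z - ρ)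

/-- `∑_{ρ ∈ Z} c(ρ) e^{ρu}`. -/
def expSum (Z : Set ℂ) (c : ℂ → ℂ) (u : ℝ) : ℂ := ∑' ρ : Z, c ρ * Complex.exp (ρ * u)

theorem norm_mul_exp_of_re_eq_zero {ρ : ℂ} (h : ρ.re = 0) (a : ℂ) (u : ℝ) :
    ‖a * Complex.exp (ρ * u)‖ = ‖a‖ := by
  rw [norm_mul, norm_exp_mul_ofReal, h]
  simp

theorem continuous_expSum (hZ : ∀ ρ ∈ Z, ρ.re = 0) (hc : Summable fun ρ : Z => ‖c ρ‖) :
    Continuous (expSum Z c) :=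
  continuous_tsum (fun ρ => by fun_prop) hc
    fun ρ u => (norm_mul_exp_of_re_eq_zero (hZ _ ρ.2) _ u).le

theorem norm_expSum_le (hZ : ∀ ρ ∈ Z, ρ.re = 0) (hc : Summable fun ρ : Z => ‖c ρ‖) (u : ℝ) :
    ‖expSum Z c u‖ ≤ ∑' ρ : Z, ‖c ρ‖ :=
  tsum_of_norm_bounded hc.hasSum fun ρ => (norm_mul_exp_of_re_eq_zero (hZ _ ρ.2) _ u).le

theorem norm_div_sub_le {ρ z : ℂ} (h : ρ.re = 0) (hz : z.re ≠ 0) (a : ℂ) :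
    ‖a / (z - ρ)‖ ≤ ‖a‖ / |z.re| := by
  rw [norm_div]
  have h1 : 0 < |z.re| := abs_pos.2 hz
  have := Complex.abs_re_le_norm (z - ρ)
  rw [Complex.sub_re, h, sub_zero] at this
  gcongr

theorem norm_polarSum_le (hZ : ∀ ρ ∈ Z, ρ.re = 0) (hc : Summable fun ρ : Z => ‖c ρ‖) {z : ℂ}
    (hz : z.re ≠ 0) : ‖polarSum Z c z‖ ≤ (∑' ρ : Z, ‖c ρ‖) / |z.re| :=
  tsum_of_norm_bounded (hc.hasSum.div_const _) fun ρ => norm_div_sub_le (hZ _ ρ.2) hz _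

/-- Termwise integration: each exponential `e^{ρu}` has transform `1/(z - ρ)`. -/
theorem halfLap_expSum (hZ : ∀ ρ ∈ Z, ρ.re = 0) (hZc : Z.Countable)
    (hc : Summable fun ρ : Z => ‖c ρ‖) {z : ℂ}
    (hz : 0 < z.re) : halfLap (expSum Z c) z = polarSum Z c z := by
  have : Countable Z := hZc.to_subtype
  have hre : ∀ ρ : Z, ((ρ : ℂ) - z).re < 0 := fun ρ => by
    rw [Complex.sub_re, hZ _ ρ.2]; linarith
  have e : ∀ (ρ : Z) (u : ℝ), c ρ * Complex.exp (ρ * u) * Complex.exp (-z * u) =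
      c ρ * Complex.exp ((ρ - z) * u) := fun ρ u => by
    rw [mul_assoc, ← Complex.exp_add]; congr 2; ring
  have h := hasSum_integral_of_summable_integral_norm (μ := volume.restrict (Ioi (0 : ℝ)))
    (F := fun (ρ : Z) u => c ρ * Complex.exp (ρ * u) * Complex.exp (-z * u))
    (fun ρ => by
      simp only [e]
      exact (integrableOn_exp_mul_complex_Ioi (hre ρ) 0).const_mul _) (by
      refine (hc.mul_right (∫ u in Ioi (0 : ℝ), Real.exp (-z.re * u))).congr fun ρ => ?_
      rw [← integral_const_mul]
      congr 1 with u
      rw [norm_mul, norm_mul_exp_of_re_eq_zero (hZ _ ρ.2), norm_exp_mul_ofReal, Complex.neg_re])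
  have h1 : halfLap (expSum Z c) z = ∫ u in Ioi (0 : ℝ),
      ∑' ρ : Z, c ρ * Complex.exp (ρ * u) * Complex.exp (-z * u) := by
    simp only [tsum_mul_right]
    rfl
  rw [h1, ← h.tsum_eq, polarSum]
  refine tsum_congr fun ρ => ?_
  have hne : z - ρ ≠ 0 := fun h0 => by
    have := hre ρ
    rw [← neg_sub, h0] at this
    simp at this
  have hne' : (ρ : ℂ) - z ≠ 0 := by rwa [← neg_sub, neg_ne_zero]
  simp only [e]
  rw [integral_const_mul, integral_exp_mul_complex_Ioi (hre ρ)]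
  simp only [Complex.ofReal_zero, mul_zero, Complex.exp_zero]
  rw [← neg_sub z, neg_div_neg_eq, mul_one_div]

theorem polarSum_local (hc : Summable fun ρ : Z => ‖c ρ‖) {z₀ : ℂ} {r : ℝ} (hr : 0 < r)
    (hiso : ∀ ρ ∈ Z, ρ ≠ z₀ → 2 * r ≤ ‖ρ - z₀‖) :
    ∃ A : ℂ → ℂ, AnalyticAt ℂ A z₀ ∧ ∀ᶠ z in 𝓝 z₀,
      polarSum Z c z = A z + Z.indicator c z₀ / (z - z₀) := by
  classical
  -- The coefficient at `z₀` is removed; all remaining poles are at distance at least `r` from the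
  -- ball, so the series converges uniformly there.
  set c' : ℂ → ℂ := fun ρ => if ρ = z₀ then 0 else c ρ
  have hle : ∀ (ρ : Z) (z : ℂ), z ∈ Metric.ball z₀ r → ‖c' ρ / (z - ρ)‖ ≤ ‖c ρ‖ / r := by
    intro ρ z hz
    simp only [c']
    split_ifs with h
    · simp; positivity
    · rw [norm_div]
      rw [Metric.mem_ball, dist_eq_norm] at hz
      have h1 := hiso _ ρ.2 h
      have h2 := norm_sub_le_norm_sub_add_norm_sub (ρ : ℂ) z z₀
      rw [norm_sub_rev (ρ : ℂ) z] at h2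
      gcongr
      linarith
  have hne : ∀ (ρ : Z) (z : ℂ), (ρ : ℂ) ≠ z₀ → z ∈ Metric.ball z₀ r → z - ρ ≠ 0 := by
    intro ρ z h hz h0
    rw [sub_eq_zero] at h0
    rw [h0, Metric.mem_ball, dist_eq_norm] at hz
    linarith [hiso _ ρ.2 h]
  have hA : DifferentiableOn ℂ (polarSum Z c') (Metric.ball z₀ r) := by
    refine Complex.differentiableOn_tsum_of_summable_norm (hc.div_const r) (fun ρ => ?_)
      Metric.isOpen_ball fun ρ z hz => hle ρ z hz
    by_cases h : (ρ : ℂ) = z₀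
    · simp only [c', h, if_true, zero_div]
      exact differentiableOn_const _
    · exact DifferentiableOn.div (by fun_prop) (by fun_prop) fun z hz => hne ρ z h hz
  refine ⟨polarSum Z c', hA.analyticAt (Metric.ball_mem_nhds z₀ hr), ?_⟩
  filter_upwards [Metric.ball_mem_nhds z₀ hr] with z hz
  have hs' : Summable fun ρ : Z => c' ρ / (z - ρ) :=
    Summable.of_norm_bounded (hc.div_const r) fun ρ => hle ρ z hz
  by_cases hmem : z₀ ∈ Z
  · rw [indicator_of_mem hmem]
    have hsum : HasSum (fun ρ : Z => c' ρ / (z - ρ) + if ρ = ⟨z₀, hmem⟩ then c z₀ / (z - z₀) else 0)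
        (polarSum Z c' z + c z₀ / (z - z₀)) := hs'.hasSum.add (hasSum_ite_eq _ _)
    rw [← hsum.tsum_eq]
    refine tsum_congr fun ρ => ?_
    by_cases h : ρ = ⟨z₀, hmem⟩
    · simp [h, c']
    · have h' : (ρ : ℂ) ≠ z₀ := fun h2 => h (Subtype.ext h2)
      simp [h, h', c']
  · rw [indicator_of_notMem hmem, zero_div, add_zero]
    refine tsum_congr fun ρ => ?_
    have h' : (ρ : ℂ) ≠ z₀ := fun h2 => hmem (h2 ▸ ρ.2)
    simp [h', c']

end Polar

/-! ### The reflection formula for the inverse transform of `1 / m` -/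

/-- The zeros of `m` on the imaginary axis. -/
def axisZeros (m : ℂ → ℂ) : Set ℂ := {ρ | ρ.re = 0 ∧ m ρ = 0}

/-- The residue `1 / m'(ρ)` of `1 / m` at a simple zero `ρ` of `m`. -/
def residue (m : ℂ → ℂ) (ρ : ℂ) : ℂ := (deriv m ρ)⁻¹

/-- The zeros of an entire function are isolated. -/
theorem exists_le_norm_sub_zero {m : ℂ → ℂ} (hm : Differentiable ℂ m) {w : ℂ} (hw : m w ≠ 0)
    (z₀ : ℂ) : ∃ r : ℝ, 0 < r ∧ ∀ ρ, m ρ = 0 → ρ ≠ z₀ → 2 * r ≤ ‖ρ - z₀‖ := by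
  have han : AnalyticOnNhd ℂ m univ := fun z _ => hm.analyticAt z
  have hev : ∀ᶠ z in 𝓝[≠] z₀, m z ≠ 0 := by
    rcases (han z₀ trivial).eventually_eq_zero_or_eventually_ne_zero with h | h
    · exact absurd (han.eqOn_zero_of_preconnected_of_eventuallyEq_zero isPreconnected_univ
        (mem_univ z₀) h (mem_univ w)) hw
    · exact h
  rw [eventually_nhdsWithin_iff, Metric.eventually_nhds_iff] at hev
  obtain ⟨ε, hε, h⟩ := hev
  refine ⟨ε / 2, by positivity, fun ρ h0 hne => ?_⟩
  by_contra hlt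
  exact h (y := ρ) (by rw [dist_eq_norm]; linarith) hne h0

theorem deriv_neg_of_odd {m : ℂ → ℂ} (hm : ∀ z, m (-z) = -m z) (z : ℂ) :
    deriv m (-z) = deriv m z := by
  have h1 : m = fun z => -m (-z) := by funext z; rw [hm, neg_neg]
  have h2 : deriv m z = deriv (fun z => -m (-z)) z := by rw [← h1]
  rw [h2, deriv.fun_neg, deriv_comp_neg, neg_neg]

/-- `m` is an odd entire function whose zeros in the strip `|re z| < 2` are simple and lie on the
imaginary axis, with absolutely summable residues of `1 / m`, and `p` is a function whose bilateral
Laplace transform is `1 / m` for `1/4 < re z < 2`. -/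
structure StripData (m : ℂ → ℂ) (p : ℝ → ℝ) : Prop where
  diff : Differentiable ℂ m
  odd : ∀ z, m (-z) = -m z
  growth : ∃ C : ℝ, 0 ≤ C ∧ ∀ z : ℂ, 0 < z.re → z.re < 2 → ‖m z‖ ≤ Real.exp (C * (1 + |z.im|))
  ne_zero : ∀ z : ℂ, 0 < z.re → z.re < 2 → m z ≠ 0
  simple : ∀ ρ ∈ axisZeros m, deriv m ρ ≠ 0
  summable : Summable fun ρ : axisZeros m => ‖residue m ρ‖
  cont : Continuous p
  bound : ∃ B : ℝ, ∀ u : ℝ, 0 < u → |p (-u)| ≤ B * Real.exp (-2 * u)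
  conv : ∀ σ : ℝ, 1 / 4 < σ → σ < 2 → Integrable fun u => p u * Real.exp (-σ * u)
  lap : ∀ z : ℂ, 1 / 4 < z.re → z.re < 2 → ∫ u, (p u : ℂ) * Complex.exp (-z * u) = (m z)⁻¹

theorem re_eq_zero_of_mem_axisZeros {m : ℂ → ℂ} : ∀ ρ ∈ axisZeros m, ρ.re = 0 := fun _ h => h.1

namespace StripData

variable {m : ℂ → ℂ} {p : ℝ → ℝ}

theorem ne_zero' (d : StripData m p) {z : ℂ} (h0 : z.re ≠ 0) (h2 : |z.re| < 2) : m z ≠ 0 := by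
  rw [abs_lt] at h2
  rcases lt_or_gt_of_ne h0 with h | h
  · have := d.ne_zero (-z) (by simpa using h) (by simp; linarith)
    rw [d.odd] at this
    simpa using this
  · exact d.ne_zero z h h2.2

theorem residue_neg (d : StripData m p) (z : ℂ) : residue m (-z) = residue m z := by
  rw [residue, residue, deriv_neg_of_odd d.odd]

theorem neg_mem (d : StripData m p) {z : ℂ} (h : z ∈ axisZeros m) : -z ∈ axisZeros m :=
  ⟨by simpa using h.1, by rw [d.odd, h.2, neg_zero]⟩

/-- The reflection `ρ ↦ -ρ` of the zeros. -/
def negEquiv (d : StripData m p) : axisZeros m ≃ axisZeros m where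
  toFun ρ := ⟨-ρ, d.neg_mem ρ.2⟩
  invFun ρ := ⟨-ρ, d.neg_mem ρ.2⟩
  left_inv ρ := by simp
  right_inv ρ := by simp

theorem polarSum_neg (d : StripData m p) (z : ℂ) : polarSum (axisZeros m) (residue m) (-z) =
    -polarSum (axisZeros m) (residue m) z := by
  rw [polarSum, polarSum, ← tsum_neg, ← d.negEquiv.tsum_eq]
  refine tsum_congr fun ρ => ?_
  simp only [negEquiv, Equiv.coe_fn_mk, d.residue_neg]
  rw [show -z - -(ρ : ℂ) = -(z - ρ) by ring, div_neg]

theorem expSum_neg (d : StripData m p) (u : ℝ) : expSum (axisZeros m) (residue m) (-u) =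
    expSum (axisZeros m) (residue m) u := by
  rw [expSum, expSum, ← d.negEquiv.tsum_eq]
  refine tsum_congr fun ρ => ?_
  simp only [negEquiv, Equiv.coe_fn_mk, d.residue_neg]
  congr 2
  push_cast
  ring

/-- A summable family has countable support, and no residue at a simple zero vanishes. -/
theorem countable_axisZeros (d : StripData m p) : (axisZeros m).Countable := by
  have h := d.summable.countable_support
  have h2 : Function.support (fun ρ : axisZeros m => ‖residue m ρ‖) = univ := by
    ext ρ
    simp [residue, d.simple ρ ρ.2]
  rw [h2, countable_univ_iff] at h
  exact countable_coe_iff.1 h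

theorem isolated (d : StripData m p) (z₀ : ℂ) :
    ∃ r : ℝ, 0 < r ∧ ∀ ρ, m ρ = 0 → ρ ≠ z₀ → 2 * r ≤ ‖ρ - z₀‖ :=
  exists_le_norm_sub_zero d.diff (d.ne_zero 1 (by simp) (by simp)) z₀

/-- `u ↦ p(-u)`. -/
def refl (p : ℝ → ℝ) (u : ℝ) : ℂ := p (-u)

/-- `p(u) + p(-u) - ∑ c(ρ) e^{ρu}`. -/
def remainder (m : ℂ → ℂ) (p : ℝ → ℝ) (u : ℝ) : ℂ :=
  p u + refl p u - expSum (axisZeros m) (residue m) u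

/-- The Laplace transform of the remainder, continued to the strip `|re z| < 2`. -/
def contin (m : ℂ → ℂ) (p : ℝ → ℝ) (z : ℂ) : ℂ :=
  (m z)⁻¹ - halfLap (refl p) (-z) + halfLap (refl p) z - polarSum (axisZeros m) (residue m) z

theorem continuous_refl (d : StripData m p) : Continuous (refl p) :=
  Complex.continuous_ofReal.comp (d.cont.comp continuous_neg)

theorem continuous_ofReal (d : StripData m p) : Continuous fun u => (p u : ℂ) :=
  Complex.continuous_ofReal.comp d.cont

theorem continuous_E (d : StripData m p) : Continuous (expSum (axisZeros m) (residue m)) :=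
  continuous_expSum re_eq_zero_of_mem_axisZeros d.summable

theorem continuous_remainder (d : StripData m p) : Continuous (remainder m p) :=
  (d.continuous_ofReal.add d.continuous_refl).sub d.continuous_E

theorem conv_refl (d : StripData m p) {σ : ℝ} (hσ : -2 < σ) : HalfLapConv (refl p) σ := by
  obtain ⟨B, hB⟩ := d.bound
  refine halfLapConv_of_norm_le d.continuous_refl (B := B) (fun u hu => ?_) hσ
  rw [refl, Complex.norm_real]
  exact hB u hu

theorem conv_E (d : StripData m p) {σ : ℝ} (hσ : 0 < σ) : HalfLapConv (expSum (axisZeros m) (residue m)) σ := by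
  refine halfLapConv_of_norm_le d.continuous_E (a := 0)
    (B := ∑' ρ : axisZeros m, ‖residue m ρ‖) (fun u _ => ?_) hσ
  rw [zero_mul, Real.exp_zero, mul_one]
  exact norm_expSum_le re_eq_zero_of_mem_axisZeros d.summable u

theorem conv_p (d : StripData m p) {σ : ℝ} (hσ : 1 / 4 < σ) : HalfLapConv (fun u => (p u : ℂ)) σ := by
  obtain ⟨τ, h1, h2, h3⟩ : ∃ τ : ℝ, 1 / 4 < τ ∧ τ < 2 ∧ τ ≤ σ :=
    ⟨min σ 1, lt_min hσ (by norm_num), (min_le_right _ _).trans_lt (by norm_num), min_le_left _ _⟩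
  refine HalfLapConv.mono d.continuous_ofReal (σ := τ) ?_ h3
  refine ((d.conv τ h1 h2).norm.integrableOn).congr_fun (fun u _ => ?_) measurableSet_Ioi
  simp

theorem conv_remainder (d : StripData m p) {σ : ℝ} (hσ : 1 / 4 < σ) : HalfLapConv (remainder m p) σ := by
  refine Integrable.mono' (((d.conv_p hσ).add (d.conv_refl (by linarith))).add
    (d.conv_E (by linarith)))
    (Continuous.aestronglyMeasurable (by have := d.continuous_remainder; fun_prop))
    (ae_of_all _ fun u => ?_)
  rw [norm_mul, norm_norm, Real.norm_of_nonneg (Real.exp_pos _).le]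
  simp only [Pi.add_apply]
  rw [← add_mul, ← add_mul]
  gcongr
  exact (norm_sub_le _ _).trans (add_le_add_left (norm_add_le _ _) _)

theorem integral_eq_halfLap {z : ℂ} (h : Integrable fun u => (p u : ℂ) * Complex.exp (-z * u)) :
    ∫ u, (p u : ℂ) * Complex.exp (-z * u) = halfLap (fun u => (p u : ℂ)) z +
      halfLap (refl p) (-z) := by
  rw [← integral_add_compl (measurableSet_Ioi (a := (0 : ℝ))) h, compl_Ioi, halfLap, halfLap]
  congr 1
  have := integral_comp_neg_Ioi (0 : ℝ) fun u => (p u : ℂ) * Complex.exp (-z * u)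
  rw [neg_zero] at this
  rw [← this]
  congr 1 with u
  rw [refl]
  push_cast
  ring_nf

theorem integrable_conv (d : StripData m p) {z : ℂ} (h0 : 1 / 4 < z.re) (h2 : z.re < 2) :
    Integrable fun u => (p u : ℂ) * Complex.exp (-z * u) := by
  refine Integrable.mono' (d.conv z.re h0 h2).norm
    (Continuous.aestronglyMeasurable (by have := d.continuous_ofReal; fun_prop))
    (ae_of_all _ fun u => ?_)
  rw [norm_mul, norm_mul, norm_exp_mul_ofReal, Complex.norm_real,
    Real.norm_of_nonneg (Real.exp_pos (-z.re * u)).le, Complex.neg_re]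

/-- Splitting the bilateral transform at `0` gives `1/m(z)` as the half-line transform of `p` at `z`
plus that of `refl p` at `-z`. Solving for the former explains the shape of `contin`, all of whose
terms make sense beyond `1/4 < re z`. -/
theorem contin_eq (d : StripData m p) {z : ℂ} (h0 : 1 / 4 < z.re) (h2 : z.re < 2) :
    contin m p z = halfLap (remainder m p) z := by
  have h1 : halfLap (remainder m p) z = halfLap (fun u => (p u : ℂ)) z + halfLap (refl p) z -
      halfLap (expSum (axisZeros m) (residue m)) z := by
    rw [halfLap, halfLap, halfLap, halfLap, ← integral_add, ← integral_sub]
    · congr 1 with u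
      rw [remainder]; ring
    · exact ((d.conv_p h0).integrableOn d.continuous_ofReal le_rfl).add
        ((d.conv_refl (by linarith)).integrableOn d.continuous_refl le_rfl)
    · exact (d.conv_E (by linarith)).integrableOn d.continuous_E le_rfl
    · exact (d.conv_p h0).integrableOn d.continuous_ofReal le_rfl
    · exact (d.conv_refl (by linarith)).integrableOn d.continuous_refl le_rfl
  rw [h1, halfLap_expSum re_eq_zero_of_mem_axisZeros d.countable_axisZeros d.summable (by linarith), contin,
    ← d.lap z h0 h2, integral_eq_halfLap (d.integrable_conv h0 h2)]
  ring

theorem contin_neg (d : StripData m p) (z : ℂ) : contin m p (-z) = -contin m p z := by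
  rw [contin, contin, d.polarSum_neg, d.odd, neg_neg, inv_neg]
  ring

/-- At a zero of `m` the principal parts of `1/m` and of the polar sum coincide and cancel; the
decay of `p(-u)` keeps both half-line transforms analytic on the strip. -/
theorem contin_local (d : StripData m p) {z₀ : ℂ} (h : |z₀.re| < 2) : ∃ A : ℂ → ℂ, AnalyticAt ℂ A z₀ ∧
    contin m p =ᶠ[𝓝[≠] z₀] A ∧ (m z₀ ≠ 0 → contin m p =ᶠ[𝓝 z₀] A) := by
  rw [abs_lt] at h
  have hopen : IsOpen {z : ℂ | -2 < z.re} := isOpen_lt continuous_const Complex.continuous_re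
  have hL : ∀ z : ℂ, -2 < z.re → AnalyticAt ℂ (halfLap (refl p)) z := fun z hz => by
    refine DifferentiableOn.analyticAt (s := {z : ℂ | -2 < z.re}) (fun w hw => ?_)
      (hopen.mem_nhds hz)
    have hw' : -2 < w.re := hw
    exact ((d.conv_refl (σ := (w.re - 2) / 2) (by linarith)).differentiableAt d.continuous_refl
      (by linarith)).differentiableWithinAt
  have hL1 := hL z₀ h.1
  have hL2 : AnalyticAt ℂ (fun z => halfLap (refl p) (-z)) z₀ :=
    AnalyticAt.comp (g := halfLap (refl p)) (hL (-z₀) (by simp; linarith)) analyticAt_id.neg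
  obtain ⟨r, hr, hiso⟩ := d.isolated z₀
  obtain ⟨A, hA, hAe⟩ := polarSum_local d.summable hr fun ρ hρ => hiso ρ hρ.2
  by_cases hm : m z₀ = 0
  · have hmem : z₀ ∈ axisZeros m := by
      refine ⟨?_, hm⟩
      by_contra hre
      exact d.ne_zero' hre (abs_lt.2 h) hm
    obtain ⟨A', hA', hAe'⟩ := inv_sub_pole d.diff hm (d.simple z₀ hmem)
    refine ⟨fun z => A' z - halfLap (refl p) (-z) + halfLap (refl p) z - A z,
      ((hA'.sub hL2).add hL1).sub hA, ?_, fun h => absurd hm h⟩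
    filter_upwards [hAe', mem_nhdsWithin_of_mem_nhds hAe] with z h1 h2
    rw [contin, h1, h2, indicator_of_mem hmem, residue]
    ring
  · have hmem : z₀ ∉ axisZeros m := fun h => hm h.2
    have hmi : AnalyticAt ℂ (fun z => (m z)⁻¹) z₀ := (d.diff.analyticAt z₀).inv hm
    have hev : contin m p =ᶠ[𝓝 z₀] fun z =>
        (m z)⁻¹ - halfLap (refl p) (-z) + halfLap (refl p) z - A z := by
      filter_upwards [hAe] with z h2
      rw [contin, h2, indicator_of_notMem hmem]
      ring
    exact ⟨_, ((hmi.sub hL2).add hL1).sub hA, hev.filter_mono nhdsWithin_le_nhds, fun _ => hev⟩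

/-- `contin` with its removable singularities removed. -/
def continReg (m : ℂ → ℂ) (p : ℝ → ℝ) (z : ℂ) : ℂ := limUnder (𝓝[≠] z) (contin m p)

theorem continReg_eq (d : StripData m p) {z : ℂ} (hm : m z ≠ 0) (h : |z.re| < 2) :
    continReg m p z = contin m p z := by
  obtain ⟨A, hA, h1, h2⟩ := d.contin_local h
  rw [(h2 hm).self_of_nhds]
  exact (limUnder_eventuallyEq hA h1).self_of_nhds

theorem differentiableOn_continReg (d : StripData m p) : DifferentiableOn ℂ (continReg m p) {z | |z.re| < 2} := by
  intro z hz
  obtain ⟨A, hA, h1, -⟩ := d.contin_local hz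
  exact (hA.differentiableAt.congr_of_eventuallyEq
    (limUnder_eventuallyEq hA h1)).differentiableWithinAt

end StripData

/-! ### Vanishing of the continued transform and of the remainder -/

namespace StripData

variable {m : ℂ → ℂ} {p : ℝ → ℝ}

theorem le_exp_of_le_exp_add {K1 Φ S a x : ℝ} (hΦ : 0 ≤ Φ) (hS : 0 ≤ S) (hK : 0 ≤ K1) (ha : 1 ≤ a)
    (h : x ≤ Real.exp (K1 * a) + Φ + Φ + S * a) : x ≤ Real.exp ((K1 + Φ + S + 2) * a) := by
  have ha0 : 0 ≤ a := by linarith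
  have e1 : Real.exp (K1 * a) ≤ Real.exp ((K1 + Φ + S) * a) := by
    gcongr; linarith
  have e2 : Φ ≤ Real.exp ((K1 + Φ + S) * a) := by
    have h1 := Real.add_one_le_exp ((K1 + Φ + S) * a)
    nlinarith [mul_nonneg hK ha0, mul_nonneg hS ha0]
  have e3 : S * a ≤ Real.exp ((K1 + Φ + S) * a) := by
    have h1 := Real.add_one_le_exp ((K1 + Φ + S) * a)
    nlinarith [mul_nonneg hK ha0, mul_nonneg hΦ ha0]
  have e4 : (4 : ℝ) ≤ Real.exp (2 * a) := by
    have h1 := Real.exp_one_gt_d9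
    have h2 : Real.exp 2 ≤ Real.exp (2 * a) := Real.exp_le_exp.2 (by linarith)
    have h3 : Real.exp 2 = Real.exp 1 * Real.exp 1 := by rw [← Real.exp_add]; norm_num
    nlinarith
  rw [show (K1 + Φ + S + 2) * a = (K1 + Φ + S) * a + 2 * a by ring, Real.exp_add]
  have := Real.exp_pos ((K1 + Φ + S) * a)
  nlinarith

/-- The half-line transforms are bounded for `|re z| ≤ 1` and the polar sum is at most a constant
over `|re z|`, so the estimate of `1/m` decides. Oddness transfers the bound to the left half. -/
theorem exists_contin_bound (d : StripData m p) : ∃ K, 0 < K ∧ ∀ z : ℂ, z.re ≠ 0 → |z.re| ≤ 1 →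
    ‖contin m p z‖ ≤ Real.exp (K * (1 + |z.im|) / |z.re|) := by
  obtain ⟨C, hC, hgr⟩ := d.growth
  obtain ⟨K1, hK1, hK⟩ := exists_norm_inv_le_exp d.diff d.ne_zero hC hgr
    (D := ∫ u, ‖p u * Real.exp (-1 * u)‖) (integral_nonneg fun _ => norm_nonneg _) (fun z hz => by
      rw [← d.lap z (by rw [hz]; norm_num) (by rw [hz]; norm_num)]
      refine le_trans ?_ (le_of_lt (lt_of_lt_of_le (lt_add_one _) (Real.add_one_le_exp _)))
      refine (norm_integral_le_integral_norm _).trans (le_of_eq ?_)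
      congr 1 with u
      rw [norm_mul, norm_mul, norm_exp_mul_ofReal, Complex.norm_real, Complex.neg_re, hz,
        Real.norm_of_nonneg (Real.exp_pos (-1 * u)).le])
  set Φ := ∫ u in Ioi (0 : ℝ), ‖refl p u‖ * Real.exp (-(-1) * u)
  have hΦ : 0 ≤ Φ := integral_nonneg fun _ => by positivity
  set S := ∑' ρ : axisZeros m, ‖residue m ρ‖
  have hS : 0 ≤ S := tsum_nonneg fun _ => norm_nonneg _
  have hpos : ∀ z : ℂ, 0 < z.re → z.re ≤ 1 →
      ‖contin m p z‖ ≤ Real.exp ((K1 + Φ + S + 2) * ((1 + |z.im|) / z.re)) := by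
    intro z h0 h1
    have ha : 1 ≤ (1 + |z.im|) / z.re := by
      rw [le_div_iff₀ h0]; linarith [abs_nonneg z.im]
    refine le_exp_of_le_exp_add hΦ hS hK1.le ha ?_
    have b1 := hK z h0 h1
    have b2 := (d.conv_refl (σ := -1) (by norm_num)).norm_halfLap_le (z := -z) (by simp; linarith)
    have b3 := (d.conv_refl (σ := -1) (by norm_num)).norm_halfLap_le (z := z) (by linarith)
    have b4 := norm_polarSum_le (c := residue m) re_eq_zero_of_mem_axisZeros d.summable h0.ne'
    rw [abs_of_pos h0] at b4
    have b5 : (∑' ρ : axisZeros m, ‖residue m ρ‖) / z.re ≤ S * ((1 + |z.im|) / z.re) := by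
      rw [mul_div_assoc']
      gcongr
      nlinarith [abs_nonneg z.im]
    rw [mul_div_assoc] at b1
    rw [contin]
    exact (norm_sub_le _ _).trans (add_le_add ((norm_add_le _ _).trans (add_le_add
      ((norm_sub_le _ _).trans (add_le_add b1 b2)) b3)) (b4.trans b5))
  refine ⟨K1 + Φ + S + 2, by positivity, fun z h0 h1 => ?_⟩
  rw [mul_div_assoc]
  rcases lt_or_gt_of_ne h0 with h | h
  · rw [abs_of_neg h] at h1 ⊢
    have := hpos (-z) (by simpa using h) (by simpa using h1)
    rw [d.contin_neg, norm_neg] at this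
    simpa using this
  · rw [abs_of_pos h] at h1 ⊢
    exact hpos z h h1

/-- The entire function that continues the Laplace transform of the remainder. -/
def entireContin (m : ℂ → ℂ) (p : ℝ → ℝ) (z : ℂ) : ℂ :=
  if |z.re| < 2 then continReg m p z
  else if 0 < z.re then halfLap (remainder m p) z else -halfLap (remainder m p) (-z)

theorem entireContin_of_pos (d : StripData m p) {z : ℂ} (h : 1 / 4 < z.re) :
    entireContin m p z = halfLap (remainder m p) z := by
  have h0 : 0 < z.re := by linarith
  rw [entireContin]
  split_ifs with h2
  · rw [d.continReg_eq (d.ne_zero' h0.ne' h2) h2, d.contin_eq h (abs_lt.1 h2).2]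
  · rfl

theorem entireContin_of_neg (d : StripData m p) {z : ℂ} (h : z.re < -(1 / 4)) :
    entireContin m p z = -halfLap (remainder m p) (-z) := by
  have h0 : z.re < 0 := by linarith
  rw [entireContin]
  split_ifs with h2 h3
  · rw [d.continReg_eq (d.ne_zero' h0.ne h2) h2, ← d.contin_eq (by simp; linarith)
      (by simp; linarith [(abs_lt.1 h2).1]), d.contin_neg, neg_neg]
  · linarith
  · rfl

/-- The three pieces agree on the overlaps `1/4 < |re z| < 2`, so near each point the function
equals a single analytic piece. -/
theorem differentiable_entireContin (d : StripData m p) : Differentiable ℂ (entireContin m p) := by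
  have hL : ∀ w : ℂ, 1 / 4 < w.re → DifferentiableAt ℂ (halfLap (remainder m p)) w := fun w hw =>
    (d.conv_remainder (σ := (w.re + 1 / 4) / 2) (by linarith)).differentiableAt
      d.continuous_remainder (by linarith)
  intro z
  rcases lt_trichotomy z.re (-(1 / 4)) with h | h | h
  · have hev : entireContin m p =ᶠ[𝓝 z] fun z => -halfLap (remainder m p) (-z) := by
      filter_upwards [(isOpen_lt Complex.continuous_re continuous_const).mem_nhds
        (show z ∈ {z : ℂ | z.re < -(1 / 4)} from h)] with w hw using d.entireContin_of_neg hw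
    refine DifferentiableAt.congr_of_eventuallyEq ?_ hev
    exact (DifferentiableAt.comp (g := halfLap (remainder m p)) z
      (hL (-z) (by simp; linarith)) differentiableAt_id.neg).neg
  all_goals
    by_cases h2 : |z.re| < 2
    · have hopen : {z : ℂ | |z.re| < 2} ∈ 𝓝 z :=
        (isOpen_lt (by fun_prop) continuous_const).mem_nhds h2
      have hev : entireContin m p =ᶠ[𝓝 z] continReg m p := by
        filter_upwards [hopen] with w hw
        exact if_pos hw
      exact (d.differentiableOn_continReg.differentiableAt hopen).congr_of_eventuallyEq hev
    · have hz : 1 / 4 < z.re := by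
        rw [not_lt, le_abs] at h2
        rcases h2 with h2 | h2 <;> linarith
      have hev : entireContin m p =ᶠ[𝓝 z] halfLap (remainder m p) := by
        filter_upwards [(isOpen_lt continuous_const Complex.continuous_re).mem_nhds
          (show z ∈ {z : ℂ | 1 / 4 < z.re} from hz)] with w hw using d.entireContin_of_pos hw
      exact (hL z hz).congr_of_eventuallyEq hev

theorem continReg_bound (d : StripData m p) : ∃ K, 0 < K ∧ ∀ z : ℂ, z.re ≠ 0 → |z.re| ≤ 1 →
    ‖continReg m p z‖ ≤ Real.exp (K * (1 + |z.im|) / |z.re|) := by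
  obtain ⟨K, hK, hb⟩ := d.exists_contin_bound
  refine ⟨K, hK, fun z h0 h1 => ?_⟩
  rw [d.continReg_eq (d.ne_zero' h0 (by linarith)) (by linarith)]
  exact hb z h0 h1

/-- For `|re z| ≥ 1/2` the function is bounded by an absolutely convergent integral, and
Phragmén–Lindelöf carries the bound into the strip. By Liouville it is constant, and its values at
`1` and `-1` are opposite. -/
theorem entireContin_eq_zero (d : StripData m p) (z : ℂ) : entireContin m p z = 0 := by
  set B := ∫ u in Ioi (0 : ℝ), ‖remainder m p u‖ * Real.exp (-(1 / 2) * u)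
  have hc := d.conv_remainder (σ := 1 / 2) (by norm_num)
  have hB1 : ∀ z : ℂ, 1 / 2 ≤ |z.re| → ‖entireContin m p z‖ ≤ B := by
    intro z hz
    rcases le_abs.1 hz with h | h
    · rw [d.entireContin_of_pos (by linarith)]
      exact hc.norm_halfLap_le h
    · rw [d.entireContin_of_neg (by linarith), norm_neg]
      exact hc.norm_halfLap_le (by simpa using h)
  obtain ⟨K, hK, hb⟩ := d.continReg_bound
  have hB : ∀ z : ℂ, ‖entireContin m p z‖ ≤ B := by
    intro z
    rcases le_total (1 / 2) |z.re| with h | h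
    · exact hB1 z h
    · have heq : ∀ z : ℂ, |z.re| < 2 → entireContin m p z = continReg m p z := fun z hz => if_pos hz
      rw [heq z (by linarith)]
      exact norm_le_of_strip d.differentiableOn_continReg hK hb
        (fun w hw => heq w (by rw [hw]; norm_num) ▸ hB1 w hw.ge) h
  have hconst : ∀ w, entireContin m p z = entireContin m p w := fun w =>
    d.differentiable_entireContin.apply_eq_apply_of_bounded
      ((Metric.isBounded_closedBall (x := (0 : ℂ)) (r := B)).subset (by
        rintro _ ⟨w, rfl⟩
        simpa using hB w)) z w
  have h1 := hconst 1
  have h2 := hconst (-1)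
  rw [d.entireContin_of_pos (z := 1) (by norm_num)] at h1
  rw [d.entireContin_of_neg (z := -1) (by norm_num), neg_neg, ← h1] at h2
  exact self_eq_neg.1 h2

theorem remainder_neg (d : StripData m p) (u : ℝ) : remainder m p (-u) = remainder m p u := by
  rw [remainder, remainder, d.expSum_neg, refl, refl, neg_neg]
  ring

/-- The remainder is even, so after damping by `e^{-|u|}` its Fourier transform at `w` is the sum of
the half-line transforms at `1 ± 2πiw`, both zero. Fourier inversion finishes. -/
theorem remainder_eq_zero (d : StripData m p) (u : ℝ) : remainder m p u = 0 := by
  set k : ℝ → ℂ := fun u => remainder m p u * Real.exp (-|u|)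
  have hkc : Continuous k := by
    have := d.continuous_remainder
    fun_prop
  have hkeven : ∀ u, k (-u) = k u := fun u => by simp only [k, d.remainder_neg, abs_neg]
  have hki : IntegrableOn k (Ioi 0) := by
    refine Integrable.mono' (d.conv_remainder (σ := 1) (by norm_num)) hkc.aestronglyMeasurable
      ((ae_restrict_iff' measurableSet_Ioi).2 (ae_of_all _ fun u hu => ?_))
    have hu' : (0 : ℝ) < u := hu
    simp only [k]
    rw [norm_mul, Complex.norm_real, Real.norm_of_nonneg (Real.exp_pos _).le, abs_of_pos hu',
      neg_one_mul]
  have hki2 : IntegrableOn k (Iic 0) := by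
    rw [integrableOn_Iic_iff_integrableOn_Iio]
    have h := ((Measure.measurePreserving_neg (volume : Measure ℝ)).integrableOn_comp_preimage
      (Homeomorph.neg ℝ).measurableEmbedding (f := k) (s := Ioi 0)).2 hki
    rw [neg_preimage, neg_Ioi, neg_zero] at h
    exact h.congr_fun (fun u _ => hkeven u) measurableSet_Iio
  have hkI : Integrable k := by
    rw [← integrableOn_univ, ← Iic_union_Ioi (a := (0 : ℝ))]
    exact hki2.union hki
  have hz : ∀ z : ℂ, 1 / 4 < z.re → halfLap (remainder m p) z = 0 := fun z hz => by
    rw [← d.entireContin_of_pos hz, d.entireContin_eq_zero]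
  have hexp : ∀ (w u : ℝ), 0 < u → Complex.exp (↑(-2 * Real.pi * u * w) * Complex.I) * k u =
      remainder m p u * Complex.exp (-(1 + 2 * Real.pi * w * Complex.I) * u) := by
    intro w u hu
    simp only [k]
    rw [abs_of_pos hu, Complex.ofReal_exp, mul_left_comm, ← Complex.exp_add]
    congr 2
    push_cast
    ring
  have hF : FourierTransform.fourier k = 0 := by
    funext w
    rw [Real.fourier_real_eq_integral_exp_smul, Pi.zero_apply]
    simp only [smul_eq_mul]
    have hkF : Integrable fun u : ℝ => Complex.exp (↑(-2 * Real.pi * u * w) * Complex.I) * k u := by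
      refine hkI.norm.mono' (Continuous.aestronglyMeasurable (by fun_prop)) (ae_of_all _ fun u => ?_)
      rw [norm_mul, Complex.norm_exp_ofReal_mul_I, one_mul]
    rw [← integral_add_compl (measurableSet_Ioi (a := (0 : ℝ))) hkF, compl_Ioi]
    have h1 := integral_comp_neg_Ioi (0 : ℝ)
      fun u : ℝ => Complex.exp (↑(-2 * Real.pi * u * w) * Complex.I) * k u
    rw [neg_zero] at h1
    rw [← h1]
    have e1 : ∫ u in Ioi (0 : ℝ), Complex.exp (↑(-2 * Real.pi * u * w) * Complex.I) * k u =
        halfLap (remainder m p) (1 + 2 * Real.pi * w * Complex.I) :=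
      setIntegral_congr_fun measurableSet_Ioi fun u hu => hexp w u hu
    have e2 : ∫ u in Ioi (0 : ℝ), Complex.exp (↑(-2 * Real.pi * -u * w) * Complex.I) * k (-u) =
        halfLap (remainder m p) (1 + 2 * Real.pi * (-w : ℝ) * Complex.I) := by
      refine setIntegral_congr_fun measurableSet_Ioi fun u hu => ?_
      have := hexp (-w) u hu
      simp only [hkeven]
      rw [← this]
      ring_nf
    rw [e1, e2, hz _ (by simp; norm_num), hz _ (by simp; norm_num), add_zero]
  have h := hkc.fourierInv_fourier_eq hkI (by rw [hF]; exact integrable_zero _ _ _)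
  have h0 : k u = 0 := by
    rw [← h, hF, Real.fourierInv_eq']
    simp
  simpa [k] using h0

end StripData

/-! ### Consequences of the reflection formula -/

namespace StripData

variable {m : ℂ → ℂ} {p : ℝ → ℝ}

/-- The reflection formula. -/
theorem add_refl_eq (d : StripData m p) (u : ℝ) :
    (p u : ℂ) + p (-u) = expSum (axisZeros m) (residue m) u :=
  sub_eq_zero.1 (d.remainder_eq_zero u)

theorem contin_eq_zero (d : StripData m p) {z : ℂ} (h0 : 0 < z.re) (h2 : z.re < 2) :
    contin m p z = 0 := by
  have h : |z.re| < 2 := by rwa [abs_of_pos h0]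
  rw [← d.continReg_eq (d.ne_zero' h0.ne' h) h, ← d.entireContin_eq_zero z, entireContin, if_pos h]

/-- By the reflection formula `p` is, for `u > 0`, a bounded exponential sum minus a decaying term.
This lowers the abscissa of convergence from `1/4` to `0`. -/
theorem conv_of_pos (d : StripData m p) {σ : ℝ} (h0 : 0 < σ) :
    HalfLapConv (fun u => (p u : ℂ)) σ := by
  have h : (fun u => (p u : ℂ)) = fun u => expSum (axisZeros m) (residue m) u - refl p u := by
    funext u
    rw [← d.add_refl_eq u, refl]
    ring
  rw [h]
  refine Integrable.mono' ((d.conv_E h0).add (d.conv_refl (σ := σ) (by linarith)))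
    (Continuous.aestronglyMeasurable
      (by have := d.continuous_E; have := d.continuous_refl; fun_prop))
    (ae_of_all _ fun u => ?_)
  rw [norm_mul, norm_norm, Real.norm_of_nonneg (Real.exp_pos _).le]
  simp only [Pi.add_apply]
  rw [← add_mul]
  gcongr
  exact norm_sub_le _ _

theorem integrable_of_pos (d : StripData m p) {z : ℂ} (h0 : 0 < z.re) (h2 : z.re < 2) :
    Integrable fun u => (p u : ℂ) * Complex.exp (-z * u) := by
  have h1 := (d.conv_of_pos h0).integrableOn d.continuous_ofReal le_rfl
  have h3 := (d.conv_refl (σ := -z.re) (by linarith)).integrableOn d.continuous_refl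
    (z := -z) (by simp)
  rw [← integrableOn_univ, ← Iic_union_Ioi (a := (0 : ℝ))]
  refine IntegrableOn.union ?_ h1
  rw [integrableOn_Iic_iff_integrableOn_Iio]
  have h := ((Measure.measurePreserving_neg (volume : Measure ℝ)).integrableOn_comp_preimage
    (Homeomorph.neg ℝ).measurableEmbedding (s := Ioi 0)).2 h3
  rw [neg_preimage, neg_Ioi, neg_zero] at h
  refine h.congr_fun (fun u _ => ?_) measurableSet_Iio
  simp [refl]

/-- Inserting `p = expSum - refl p` on the positive half-line turns the vanishing of `contin` into
the claim. -/
theorem lap_of_pos (d : StripData m p) {z : ℂ} (h0 : 0 < z.re) (h2 : z.re < 2) :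
    ∫ u, (p u : ℂ) * Complex.exp (-z * u) = (m z)⁻¹ := by
  rw [integral_eq_halfLap (d.integrable_of_pos h0 h2)]
  have h1 : halfLap (fun u => (p u : ℂ)) z =
      halfLap (expSum (axisZeros m) (residue m)) z - halfLap (refl p) z := by
    rw [halfLap, halfLap, halfLap, ← integral_sub]
    · congr 1 with u
      rw [← d.add_refl_eq u, refl]; ring
    · exact (d.conv_E h0).integrableOn d.continuous_E le_rfl
    · exact (d.conv_refl (by linarith)).integrableOn d.continuous_refl le_rfl
  have h3 := d.contin_eq_zero h0 h2
  rw [contin] at h3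
  rw [h1, halfLap_expSum re_eq_zero_of_mem_axisZeros d.countable_axisZeros d.summable h0]
  linear_combination -h3

/-- Lower bound for the exponential sum through the residue at `0`. -/
theorem residue_sub_le (d : StripData m p) (h0 : m 0 = 0) (u : ℝ) :
    (residue m 0).re - ∑' ρ : {ρ : axisZeros m // (ρ : ℂ) ≠ 0}, ‖residue m ρ‖ ≤ p u + p (-u) := by
  have hZ := re_eq_zero_of_mem_axisZeros (m := m)
  have hmem : (0 : ℂ) ∈ axisZeros m := ⟨rfl, h0⟩
  set f : axisZeros m → ℂ := fun ρ => residue m ρ * Complex.exp (ρ * u)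
  have hn : ∀ ρ, ‖f ρ‖ = ‖residue m ρ‖ := fun ρ => norm_mul_exp_of_re_eq_zero (hZ _ ρ.2) _ u
  have hf : Summable f := Summable.of_norm (d.summable.congr fun ρ => (hn ρ).symm)
  have hsplit := hf.tsum_subtype_add_tsum_subtype_compl {(⟨0, hmem⟩ : axisZeros m)}
  rw [tsum_singleton (⟨0, hmem⟩ : axisZeros m) f] at hsplit
  have hset : ({(⟨0, hmem⟩ : axisZeros m)} : Set (axisZeros m))ᶜ =
      ({ρ | (ρ : ℂ) ≠ 0} : Set (axisZeros m)) := by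
    ext ρ
    simp [Subtype.ext_iff]
  rw [hset] at hsplit
  have hb : ‖∑' ρ : ({ρ | (ρ : ℂ) ≠ 0} : Set (axisZeros m)), f ρ‖ ≤
      ∑' ρ : {ρ : axisZeros m // (ρ : ℂ) ≠ 0}, ‖residue m ρ‖ :=
    tsum_of_norm_bounded (d.summable.subtype {ρ : axisZeros m | (ρ : ℂ) ≠ 0}).hasSum
      fun ρ => (hn ρ).le
  have h1 : ((p u + p (-u) : ℝ) : ℂ) = residue m 0 +
      ∑' ρ : ({ρ | (ρ : ℂ) ≠ 0} : Set (axisZeros m)), f ρ := by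
    rw [Complex.ofReal_add, d.add_refl_eq u, expSum, ← hsplit]
    simp [f]
  have h2 := congrArg Complex.re h1
  rw [Complex.ofReal_re, Complex.add_re] at h2
  rw [h2]
  have := (abs_le.1 ((Complex.abs_re_le_norm _).trans hb)).1
  linarith

end StripData

/-! ### Growth and zeros of `n` -/

/-- On the closed strip `t^{re s - 1}` is at most the sum of the two extreme powers. -/
theorem exists_norm_mellin_le {f : ℝ → ℂ} {a b : ℝ} (ha : MellinConvergent f a)
    (hb : MellinConvergent f b) :
    ∃ D : ℝ, 0 ≤ D ∧ ∀ s : ℂ, a ≤ s.re → s.re ≤ b → ‖mellin f s‖ ≤ D := by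
  refine ⟨∫ t in Ioi (0 : ℝ), (‖(t : ℂ) ^ ((a : ℂ) - 1) • f t‖ + ‖(t : ℂ) ^ ((b : ℂ) - 1) • f t‖),
    integral_nonneg fun _ => by positivity, fun s h1 h2 => ?_⟩
  refine norm_integral_le_of_norm_le (ha.norm.add hb.norm)
    ((ae_restrict_iff' measurableSet_Ioi).2 (ae_of_all _ fun t ht => ?_))
  have ht' : (0 : ℝ) < t := ht
  simp only [norm_smul, Complex.norm_cpow_eq_rpow_re_of_pos ht', Complex.sub_re, Complex.one_re,
    Complex.ofReal_re]
  rw [← add_mul]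
  refine mul_le_mul_of_nonneg_right ?_ (norm_nonneg _)
  have p1 := Real.rpow_pos_of_pos ht' (a - 1)
  have p2 := Real.rpow_pos_of_pos ht' (b - 1)
  rcases le_total 1 t with h | h
  · have := Real.rpow_le_rpow_of_exponent_le h (sub_le_sub_right h2 1)
    linarith
  · have := Real.rpow_le_rpow_of_exponent_ge ht' h (sub_le_sub_right h1 1)
    linarith

theorem exists_norm_completedRiemannZeta₀_le (a b : ℝ) :
    ∃ D : ℝ, 0 ≤ D ∧ ∀ s : ℂ, a ≤ s.re → s.re ≤ b → ‖completedRiemannZeta₀ s‖ ≤ D := by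
  set P := HurwitzZeta.hurwitzEvenFEPair 0
  have hc : ∀ s : ℂ, MellinConvergent P.f_modif s :=
    fun s => (P.isStrongFEPair_toStrongFEPair.hasMellin s).1
  obtain ⟨D, hD, h⟩ := exists_norm_mellin_le (hc ((a / 2 : ℝ) : ℂ)) (hc ((b / 2 : ℝ) : ℂ))
  refine ⟨D / 2, by positivity, fun s h1 h2 => ?_⟩
  -- By definition `Λ₀` is a Mellin transform that converges absolutely everywhere, hence is bounded
  -- on vertical strips.
  have e : completedRiemannZeta₀ s = mellin P.f_modif (s / 2) / 2 := rfl
  have hre : (s / 2).re = s.re / 2 := by simp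
  rw [e, norm_div, Complex.norm_ofNat]
  gcongr
  exact h _ (by rw [hre]; linarith) (by rw [hre]; linarith)

theorem norm_sin_le_exp (z : ℂ) : ‖Complex.sin z‖ ≤ Real.exp |z.im| := by
  have h1 : ‖Complex.exp (-z * Complex.I)‖ ≤ Real.exp |z.im| := by
    rw [Complex.norm_exp]
    exact Real.exp_le_exp.2 (by simpa using le_abs_self z.im)
  have h2 : ‖Complex.exp (z * Complex.I)‖ ≤ Real.exp |z.im| := by
    rw [Complex.norm_exp]
    exact Real.exp_le_exp.2 (by simpa using neg_le_abs z.im)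
  rw [Complex.sin, norm_div, norm_mul, Complex.norm_I, mul_one, Complex.norm_ofNat]
  have := norm_sub_le (Complex.exp (-z * Complex.I)) (Complex.exp (z * Complex.I))
  linarith

theorem differentiable_nFun : Differentiable ℂ nFun := by
  have := differentiable_xi
  unfold nFun
  fun_prop

/-- `n(2z) / 2`, the reciprocal of the transform of `v ↦ P_0(πv)`. -/
def halfN (z : ℂ) : ℂ := nFun (2 * z) / 2

theorem differentiable_halfN : Differentiable ℂ halfN := by
  have := differentiable_nFun
  unfold halfN
  fun_prop

theorem halfN_neg (z : ℂ) : halfN (-z) = -halfN z := by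
  rw [halfN, halfN, mul_neg, nFun_neg, neg_div]

/-- The inner factor `2` cancels the outer `1/2`, so the residue of `1/halfN` at `ρ` is exactly
`c(2ρ)`. -/
theorem deriv_halfN (z : ℂ) : deriv halfN z = deriv nFun (2 * z) := by
  have h : HasDerivAt (fun z : ℂ => 2 * z) 2 z := by
    simpa using (hasDerivAt_id z).const_mul (2 : ℂ)
  have h1 := ((differentiable_nFun (2 * z)).hasDerivAt.comp z h).div_const 2
  have h2 : deriv halfN z = _ := h1.deriv
  rw [h2]
  ring

theorem exists_norm_halfN_le : ∃ C : ℝ, 0 ≤ C ∧ ∀ z : ℂ, 0 < z.re → z.re < 2 →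
    ‖halfN z‖ ≤ Real.exp (C * (1 + |z.im|)) := by
  -- These are the extreme real parts of `1/2 + 2z` for `0 ≤ re z ≤ 2`.
  obtain ⟨D, hD, hb⟩ := exists_norm_completedRiemannZeta₀_le (1 / 2) (9 / 2)
  refine ⟨25 * D + 5, by positivity, fun z h0 h2 => ?_⟩
  set a := 1 + |z.im|
  have ha : 1 ≤ a := by simp only [a]; linarith [abs_nonneg z.im]
  have hz : ‖z‖ ≤ 2 + |z.im| := by
    have := Complex.norm_le_abs_re_add_abs_im z
    rw [abs_of_pos h0] at this
    linarith
  have hs : ‖(1 / 2 + 2 * z : ℂ)‖ ≤ 5 * a := by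
    have := norm_add_le (1 / 2 : ℂ) (2 * z)
    rw [norm_mul, Complex.norm_ofNat] at this
    norm_num at this ⊢
    simp only [a]
    linarith [abs_nonneg z.im]
  have hs1 : ‖(1 / 2 + 2 * z - 1 : ℂ)‖ ≤ 5 * a := by
    have := norm_add_le (-1 / 2 : ℂ) (2 * z)
    rw [norm_mul, Complex.norm_ofNat] at this
    rw [show (1 / 2 + 2 * z - 1 : ℂ) = -1 / 2 + 2 * z by ring]
    norm_num at this ⊢
    simp only [a]
    linarith [abs_nonneg z.im]
  have hL := hb (1 / 2 + 2 * z) (by simp; linarith) (by simp; linarith)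
  have hxi : ‖(2 * xi (1 / 2 + 2 * z) : ℂ)‖ ≤ (25 * D + 1) * a ^ 2 := by
    rw [xi, ← mul_assoc, mul_one_div_cancel two_ne_zero, one_mul]
    refine (norm_add_le _ _).trans ?_
    rw [norm_mul, norm_mul, norm_one]
    calc _ ≤ 5 * a * (5 * a) * D + 1 := by gcongr
      _ ≤ _ := by nlinarith
  have hsin : ‖Complex.sin (Real.pi * (2 * z) / 4)‖ ≤ Real.exp (2 * a) := by
    refine (norm_sin_le_exp _).trans (Real.exp_le_exp.2 ?_)
    have : (Real.pi * (2 * z) / 4 : ℂ) = ((Real.pi / 2 : ℝ) : ℂ) * z := by push_cast; ring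
    rw [this, Complex.im_ofReal_mul, abs_mul, abs_of_pos (by positivity)]
    simp only [a]
    nlinarith [Real.pi_lt_four, abs_nonneg z.im]
  have e1 : 25 * D + 1 ≤ Real.exp ((25 * D + 1) * a) := by
    have := Real.add_one_le_exp ((25 * D + 1) * a)
    nlinarith
  have e2 : a ^ 2 ≤ Real.exp (2 * a) := by
    have := Real.add_one_le_exp a
    rw [two_mul, Real.exp_add]
    nlinarith
  rw [halfN, nFun, norm_div, norm_mul, Complex.norm_ofNat,
    show (25 * D + 5) * a = 2 * a + ((25 * D + 1) * a + 2 * a) by ring, Real.exp_add, Real.exp_add]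
  refine (div_le_self (by positivity) one_le_two).trans ?_
  gcongr
  exact hxi.trans (by gcongr)

theorem lFun_ne_zero {s : ℂ} (hs : 0 < s.re) : lFun s ≠ 0 := by
  have h : Complex.Gamma (1 + s / 2) ≠ 0 :=
    Complex.Gamma_ne_zero_of_re_pos (by simp; linarith)
  rw [lFun]
  exact mul_ne_zero (pi_cpow_ne_zero _) (mul_ne_zero two_ne_zero h)

theorem xi_eq_zero_iff {s : ℂ} (hs : 0 < s.re) (h1 : s ≠ 1) : xi s = 0 ↔ riemannZeta s = 0 := by
  have h2 : ∀ k : ℕ, s ≠ -2 * (k + 1) := by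
    rintro k rfl
    have : (-2 * ((k : ℂ) + 1)).re = -2 * ((k : ℝ) + 1) := by simp
    rw [this] at hs
    have : (0 : ℝ) ≤ k := Nat.cast_nonneg k
    linarith
  rw [xi_eq h1 h2, aFun]
  simp [lFun_ne_zero hs, sub_ne_zero.2 h1]

theorem re_eq_half (hRH : RiemannHypothesis) {s : ℂ} (hs : riemannZeta s = 0) (hi : s.im ≠ 0) :
    s.re = 1 / 2 := by
  refine hRH s hs ?_ ?_
  · rintro ⟨k, rfl⟩
    simp at hi
  · rintro rfl
    simp at hi

theorem halfN_ne_zero (hRH : RiemannHypothesis) {z : ℂ} (h0 : 0 < z.re) (h2 : z.re < 2) :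
    halfN z ≠ 0 := by
  have hx : xi (1 / 2 + 2 * z) ≠ 0 := by
    have hre : (1 / 2 + 2 * z : ℂ).re = 1 / 2 + 2 * z.re := by simp
    by_cases h1 : (1 / 2 + 2 * z : ℂ) = 1
    · rw [h1, xi]
      norm_num
    · rw [Ne, xi_eq_zero_iff (by rw [hre]; linarith) h1]
      intro hζ
      have := hRH _ hζ (by
        rintro ⟨k, hk⟩
        have := congrArg Complex.re hk
        rw [hre] at this
        have h3 : (-2 * ((k : ℂ) + 1)).re = -2 * ((k : ℝ) + 1) := by simp
        rw [h3] at this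
        have : (0 : ℝ) ≤ k := Nat.cast_nonneg k
        linarith) h1
      linarith
  rw [halfN, nFun, show (Real.pi * (2 * z) / 4 : ℂ) = Real.pi * z / 2 by ring]
  exact div_ne_zero (mul_ne_zero (sin_ne_zero_of_re h0 h2) (mul_ne_zero two_ne_zero hx)) two_ne_zero

theorem nFun_ordinate_eq_zero (hRH : RiemannHypothesis) {y : ℝ} (hy : y ∈ ordinates) :
    nFun (y * Complex.I) = 0 := by
  obtain ⟨h0, s, hs, rfl⟩ := hy
  have hs' : (1 / 2 + s.im * Complex.I : ℂ) = s := by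
    apply Complex.ext <;> simp [re_eq_half hRH hs h0.ne']
  have h : xi (1 / 2 + s.im * Complex.I) = 0 := by
    rw [hs', xi_eq_zero_iff (by rw [re_eq_half hRH hs h0.ne']; norm_num) ?_]
    · exact hs
    · rintro rfl
      simp at h0
  rw [nFun, h, mul_zero, mul_zero]

theorem mem_ordinates_of_nFun {y : ℝ} (h0 : 0 < y) (h : nFun (y * Complex.I) = 0) :
    y ∈ ordinates := by
  have him : (1 / 2 + y * Complex.I : ℂ).im = y := by simp
  refine ⟨h0, 1 / 2 + y * Complex.I, ?_, him⟩
  have h1 : (1 / 2 + y * Complex.I : ℂ) ≠ 1 := fun h => by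
    rw [h] at him
    simp at him
    exact h0.ne him
  rw [← xi_eq_zero_iff (by simp) h1]
  rw [nFun] at h
  rcases mul_eq_zero.1 h with h | h
  · rw [Complex.sin_eq_zero_iff] at h
    obtain ⟨k, hk⟩ := h
    have h3 : (Real.pi * (y * Complex.I) / 4 : ℂ) = ((Real.pi * y / 4 : ℝ) : ℂ) * Complex.I := by
      push_cast; ring
    have h4 : (k * Real.pi : ℂ) = ((k * Real.pi : ℝ) : ℂ) := by push_cast; rfl
    have := congrArg Complex.im hk
    rw [h3, h4] at this
    simp at this
    exact absurd this h0.ne'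
  · simpa using h

/-- The successive infima of a discrete set of reals exhaust it. -/
theorem exists_eq_of_successive_sInf {O : Set ℝ} (hO : ∀ y ∈ O, 0 < y)
    (hd : ∀ L : ℝ, ∃ r : ℝ, 0 < r ∧ ∀ y ∈ O, y ≠ L → r ≤ |y - L|) {g : ℕ → ℝ} (h0 : g 0 = 0)
    (hg : ∀ k, g (k + 1) = sInf {y | y ∈ O ∧ g k < y}) {y : ℝ} (hy : y ∈ O) :
    ∃ k, y = g (k + 1) := by
  by_contra! hne
  have hbdd : ∀ k, BddBelow {y | y ∈ O ∧ g k < y} := fun k => ⟨g k, fun x hx => hx.2.le⟩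
  have hlt : ∀ k, g k < y := by
    intro k
    induction k with
    | zero => rw [h0]; exact hO y hy
    | succ k ih =>
      refine lt_of_le_of_ne ?_ (hne k).symm
      rw [hg]
      exact csInf_le (hbdd k) ⟨hy, ih⟩
  -- An infimum that is not attained would be an accumulation point of `O`; the set is nonempty
  -- because it contains `y`.
  have hmem : ∀ k, g (k + 1) ∈ O ∧ g k < g (k + 1) := by
    intro k
    by_contra hn
    obtain ⟨r, hr, hr'⟩ := hd (g (k + 1))
    obtain ⟨x, hx, hx2⟩ := exists_lt_of_csInf_lt (s := {y | y ∈ O ∧ g k < y}) ⟨y, hy, hlt k⟩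
      (show sInf {y | y ∈ O ∧ g k < y} < g (k + 1) + r by rw [← hg]; linarith)
    have h1 : g (k + 1) ≤ x := by
      rw [hg]
      exact csInf_le (hbdd k) hx
    have hne : x ≠ g (k + 1) := by
      rintro rfl
      exact hn hx
    have := hr' x hx.1 hne
    rw [abs_of_nonneg (by linarith)] at this
    linarith
  have hmono : StrictMono g := strictMono_nat_of_lt_succ fun k => (hmem k).2
  -- The sequence stays below `y`, so it converges. Isolation at the limit makes it eventually
  -- constant, contradicting strict growth.
  have hlim := tendsto_atTop_ciSup hmono.monotone ⟨y, by rintro _ ⟨k, rfl⟩; exact (hlt k).le⟩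
  obtain ⟨r, hr, hr'⟩ := hd (⨆ k, g k)
  have hev := (Metric.tendsto_atTop.1 hlim) r hr
  obtain ⟨N, hN⟩ := hev
  have h1 : ∀ k, N ≤ k + 1 → g (k + 1) = ⨆ k, g k := fun k hk => by
    by_contra h
    have h2 := hr' _ (hmem k).1 h
    have h3 := hN _ hk
    rw [Real.dist_eq] at h3
    linarith
  have h2 := h1 N (by omega)
  have h3 := h1 (N + 1) (by omega)
  have h4 := (hmem (N + 1)).2
  linarith

theorem exists_eq_gam (hRH : RiemannHypothesis) {y : ℝ} (hy : y ∈ ordinates) :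
    ∃ k, y = gam (k + 1) := by
  refine exists_eq_of_successive_sInf (O := ordinates) (fun y hy => hy.1) (fun L => ?_) rfl
    (fun k => rfl) hy
  have hne := halfN_ne_zero hRH (z := 1) (by simp) (by simp)
  obtain ⟨r, hr, h⟩ := exists_le_norm_sub_zero differentiable_nFun (w := 2 * 1)
    (fun h => hne (by rw [halfN, h, zero_div])) (L * Complex.I)
  refine ⟨2 * r, by positivity, fun y hy hyL => ?_⟩
  have e : (y * Complex.I - L * Complex.I : ℂ) = ((y - L : ℝ) : ℂ) * Complex.I := by
    push_cast; ring
  have := h _ (nFun_ordinate_eq_zero hRH hy) (fun hh => hyL (by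
    simpa using mul_right_cancel₀ Complex.I_ne_zero hh))
  rwa [e, norm_mul, Complex.norm_I, mul_one, Complex.norm_real, Real.norm_eq_abs] at this

/-! ### The zeros of `n` on the imaginary axis and the sum `A` -/

/-- The Boolean records the sign in `2ρ = ±iγ_k`. -/
theorem exists_gam_of_mem_axisZeros (hRH : RiemannHypothesis) {ρ : ℂ} (hρ : ρ ∈ axisZeros halfN)
    (h0 : ρ ≠ 0) :
    ∃ q : ℕ × Bool, 2 * ρ = (if q.2 then 1 else -1) * (gam (q.1 + 1) * Complex.I) := by
  have key : ∀ y : ℝ, 0 < y → nFun (y * Complex.I) = 0 → ∃ k, y = gam (k + 1) :=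
    fun y hy h => exists_eq_gam hRH (mem_ordinates_of_nFun hy h)
  have e : 2 * ρ = ((2 * ρ.im : ℝ) : ℂ) * Complex.I := by
    apply Complex.ext <;> simp [hρ.1]
  have hn : nFun (2 * ρ) = 0 := by
    have := hρ.2
    rw [halfN] at this
    simpa using this
  have him : ρ.im ≠ 0 := fun h => h0 (Complex.ext hρ.1 h)
  rcases lt_or_gt_of_ne him with h | h
  · obtain ⟨k, hk⟩ := key (-(2 * ρ.im)) (by linarith) (by
      rw [Complex.ofReal_neg, neg_mul, ← e, nFun_neg, hn, neg_zero])
    refine ⟨(k, false), ?_⟩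
    rw [e, ← hk]
    push_cast
    simp
  · obtain ⟨k, hk⟩ := key (2 * ρ.im) (by linarith) (by rw [← e, hn])
    exact ⟨(k, true), by rw [e, ← hk]; simp⟩

theorem deriv_halfN_of_eq {ρ : ℂ} {q : ℕ × Bool}
    (h : 2 * ρ = (if q.2 then 1 else -1) * (gam (q.1 + 1) * Complex.I)) :
    deriv halfN ρ = deriv nFun (gam (q.1 + 1) * Complex.I) := by
  rw [deriv_halfN, h]
  split_ifs
  · rw [one_mul]
  · rw [neg_one_mul, deriv_neg_of_odd nFun_neg]

/-- In `ℝ≥0∞` the inverse of `0` is `⊤`, so finiteness of `A` already contains the simplicity of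
these zeros. -/
theorem deriv_nFun_gam_ne_zero (hA : bigA < ⊤) (k : ℕ) :
    deriv nFun (gam (k + 1) * Complex.I) ≠ 0 := by
  intro h
  refine hA.ne ?_
  rw [bigA, ENNReal.tsum_eq_top_of_eq_top ⟨k, by rw [h]; simp⟩]
  simp

theorem deriv_halfN_ne_zero (hRH : RiemannHypothesis) (hA : bigA < ⊤) (hc : 0 < cZero) {ρ : ℂ}
    (hρ : ρ ∈ axisZeros halfN) : deriv halfN ρ ≠ 0 := by
  by_cases h0 : ρ = 0
  · rw [deriv_halfN, h0, mul_zero]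
    -- Division by zero would give `cZero` the default value `0`, contrary to `hc`.
    intro h
    rw [cZero, h] at hc
    simp at hc
  · obtain ⟨q, hq⟩ := exists_gam_of_mem_axisZeros hRH hρ h0
    rw [deriv_halfN_of_eq hq]
    exact deriv_nFun_gam_ne_zero hA _

/-- The zeros inject into pairs of an index and a sign, and both signs give the same residue, whence
the factor `2` in `A`. An upper bound is all that is needed, so injectivity suffices. -/
theorem tsum_enorm_residue_le (hRH : RiemannHypothesis) (hA : bigA < ⊤) (hc : 0 < cZero) :
    ∑' ρ : {ρ : axisZeros halfN // (ρ : ℂ) ≠ 0}, ‖residue halfN ρ‖ₑ ≤ bigA := by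
  choose q hq using fun ρ : {ρ : axisZeros halfN // (ρ : ℂ) ≠ 0} =>
    exists_gam_of_mem_axisZeros hRH ρ.1.2 ρ.2
  have hinj : Function.Injective q := by
    intro a b hab
    have h := (hq a).trans (hab ▸ (hq b).symm)
    exact Subtype.ext (Subtype.ext (mul_left_cancel₀ two_ne_zero h))
  set G : ℕ × Bool → ℝ≥0∞ := fun q => ‖deriv nFun (gam (q.1 + 1) * Complex.I)‖ₑ⁻¹
  have h1 : ∀ ρ, ‖residue halfN ρ.1‖ₑ = G (q ρ) := fun ρ => by
    rw [residue, enorm_inv (deriv_halfN_ne_zero hRH hA hc ρ.1.2), deriv_halfN_of_eq (hq ρ)]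
  calc _ = ∑' ρ, G (q ρ) := tsum_congr h1
    _ ≤ ∑' x, G x := ENNReal.tsum_comp_le_tsum_of_injective hinj G
    _ = bigA := by
      rw [ENNReal.tsum_prod', bigA, ← ENNReal.tsum_mul_left]
      simp [G, tsum_fintype, two_mul]

theorem summable_residue_compl (hRH : RiemannHypothesis) (hA : bigA < ⊤) (hc : 0 < cZero) :
    Summable fun ρ : {ρ : axisZeros halfN // (ρ : ℂ) ≠ 0} => ‖residue halfN ρ‖ := by
  have h := ((tsum_enorm_residue_le hRH hA hc).trans_lt hA).ne
  simp only [enorm_eq_nnnorm] at h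
  exact NNReal.summable_coe.2 (ENNReal.tsum_coe_ne_top_iff_summable.1 h)

theorem tsum_norm_residue_le (hRH : RiemannHypothesis) (hA : bigA < ⊤) (hc : 0 < cZero) :
    ∑' ρ : {ρ : axisZeros halfN // (ρ : ℂ) ≠ 0}, ‖residue halfN ρ‖ ≤ bigA.toReal := by
  rw [← ENNReal.ofReal_le_iff_le_toReal hA.ne,
    ENNReal.ofReal_tsum_of_nonneg (fun _ => norm_nonneg _) (summable_residue_compl hRH hA hc)]
  simp only [ofReal_norm]
  exact tsum_enorm_residue_le hRH hA hc

/-- The logarithmic form `u ↦ P_0(π e^u)` of `P_0`. -/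
def logP0 (u : ℝ) : ℝ := P0 (Real.pi * Real.exp u)

theorem stripData_halfN (hRH : RiemannHypothesis) (hA : bigA < ⊤) (hc : 0 < cZero) :
    StripData halfN logP0 where
  diff := differentiable_halfN
  odd := halfN_neg
  growth := exists_norm_halfN_le
  ne_zero _ h0 h2 := halfN_ne_zero hRH h0 h2
  simple _ hρ := deriv_halfN_ne_zero hRH hA hc hρ
  summable := by
    have hfin : {ρ : axisZeros halfN | (ρ : ℂ) = 0}.Finite :=
      (finite_singleton (0 : ℂ)).preimage Subtype.val_injective.injOn
    exact hfin.summable_compl_iff.1 (summable_residue_compl hRH hA hc)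
  cont := by
    have := hasEvenSeries_P0.continuous
    unfold logP0
    fun_prop
  bound := by
    obtain ⟨C, hC, h⟩ := hasEvenSeries_P0.exists_le_sq Real.pi_pos
    refine ⟨C * Real.pi ^ 2, fun u hu => (h _ ?_).trans (le_of_eq ?_)⟩
    · rw [abs_of_pos (by positivity)]
      exact mul_le_of_le_one_right Real.pi_pos.le (Real.exp_le_one_iff.2 (by linarith))
    · rw [mul_pow, ← Real.exp_nat_mul, mul_assoc]
      congr 3
      push_cast
      ring
  conv σ h0 h2 := by
    have := (lap_P0 (z := (σ : ℂ)) (by simpa using h0) (by simpa using h2)).1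
    rwa [Complex.ofReal_re] at this
  lap z h0 h2 := by
    rw [halfN, inv_div]
    exact (lap_P0 h0 h2).2

/-! ### Positivity of `P_0` and the central strip -/

theorem P0_add_inv_ge (hRH : RiemannHypothesis) (hA : bigA < ⊤) (hc : 0 < cZero) {v : ℝ}
    (hv : 0 < v) : -bigA.toReal + cZero ≤ P0 (Real.pi * v) + P0 (Real.pi / v) := by
  have h0 : halfN 0 = 0 := by simp [halfN, nFun]
  have h := (stripData_halfN hRH hA hc).residue_sub_le h0 (Real.log v)
  have e : (residue halfN 0).re = cZero := by
    rw [residue, deriv_halfN, mul_zero, cZero, one_div]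
  rw [e, logP0, logP0, Real.exp_neg, Real.exp_log hv, ← div_eq_mul_inv] at h
  linarith [tsum_norm_residue_le hRH hA hc]

theorem lapConv_P0 (hRH : RiemannHypothesis) (hA : bigA < ⊤) (hc : 0 < cZero) {σ : ℝ}
    (h0 : 0 < σ) (h2 : σ < 2) : LapConv (fun v => P0 (Real.pi * v)) σ := by
  have h := ((stripData_halfN hRH hA hc).integrable_of_pos (z := (σ : ℂ)) (by simpa using h0)
    (by simpa using h2)).re
  refine h.congr (ae_of_all _ fun u => ?_)
  have : (logP0 u * Complex.exp (-σ * u) : ℂ) =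
      ((P0 (Real.pi * Real.exp u) * Real.exp (-σ * u) : ℝ) : ℂ) := by
    rw [logP0]; push_cast; rfl
  simp only [this]
  exact Complex.ofReal_re _

theorem isFiniteMetricNorm_of_P0_nonneg (hRH : RiemannHypothesis) (hA : bigA < ⊤)
    (hc : 0 < cZero) (hP : ∀ v, 0 < v → 0 ≤ P0 (Real.pi * v)) {x : ℝ} (h0 : 0 < x) (h4 : x < 4) :
    IsFiniteMetricNorm (mNorm x) := by
  have d := stripData_halfN hRH hA hc
  refine isFiniteMetricNorm_of_lap (w := 0) (σ := x / 2) (K := 2) (by ring)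
    (lapConv_P0 hRH hA hc (by linarith) (by linarith)) hP (fun z hz => ?_) two_ne_zero
    fun z hz => ?_
  · have := halfN_ne_zero hRH (z := z) (by linarith) (by linarith)
    rw [halfN] at this
    rw [Complex.ofReal_zero, add_zero]
    exact fun h => this (by rw [h, zero_div])
  · have := d.lap_of_pos (z := z) (by linarith) (by linarith)
    rw [halfN, inv_div] at this
    rw [Complex.ofReal_zero, add_zero, ← this]
    rfl

/-- For `v ≥ 1` reflection gives `P_0(πv) ≥ c(0) - A - P_0(π/v)`, and monotonicity gives `P_0(π/v) ≤
P_0(π) ≤ c(0) - A`. -/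
theorem P0_nonneg_of_ge (hRH : RiemannHypothesis) (hA : bigA < ⊤)
    (h : P0 Real.pi ≤ -bigA.toReal + cZero) (hc : 0 < cZero) {v : ℝ} (hv : 0 < v) :
    0 ≤ P0 (Real.pi * v) := by
  have hpi := Real.pi_pos
  rcases le_total v 1 with h1 | h1
  · exact (P0_pos (by positivity) (mul_le_of_le_one_right hpi.le h1)).le
  · have h2 := P0_add_inv_ge hRH hA hc hv
    have h3 := P0_mono (v₁ := Real.pi / v) (by positivity) (div_le_self hpi.le h1) le_rfl
    linarith

/-- Up to `v = 1/v₀` positivity comes from the alternating series or is assumed. Beyond, `π/v ≤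
πv₀`, so `P_0(π/v) ≤ P_0(πv₀) = c(0) - A` and reflection applies. -/
theorem P0_nonneg_of_C5 (hRH : RiemannHypothesis) (h : C5) {v : ℝ} (hv : 0 < v) :
    0 ≤ P0 (Real.pi * v) := by
  obtain ⟨hA, h0, -, v₀, hv0, hv1, hP, hpos⟩ := h
  have hc : 0 < cZero := by linarith [ENNReal.toReal_nonneg (a := bigA)]
  have hpi := Real.pi_pos
  rcases le_total v 1 with h1 | h1
  · exact (P0_pos (by positivity) (mul_le_of_le_one_right hpi.le h1)).le
  rcases h1.eq_or_lt with rfl | h1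
  · exact (P0_pos (by positivity) (by simp)).le
  rcases le_total (v * v₀) 1 with h2 | h2
  · refine (hpos _ (lt_mul_of_one_lt_right hpi h1) ?_).le
    rw [le_div_iff₀ hv0, mul_assoc]
    exact mul_le_of_le_one_right hpi.le h2
  · have h3 := P0_add_inv_ge hRH hA hc hv
    have h4 : P0 (Real.pi / v) ≤ P0 (Real.pi * v₀) := by
      refine P0_mono (by positivity) ?_ (mul_le_of_le_one_right hpi.le hv1.le)
      rw [div_le_iff₀ hv, mul_assoc]
      exact le_mul_of_one_le_right hpi.le (by linarith)
    linarith

end Csizmazia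

end

theorem mainTheorem12 :
    (∀ x : ℝ, 4 < |x| → (∀ w : ℤ, x ≠ 4 * w) →
      Csizmazia.IsFiniteMetricNorm (Csizmazia.mNorm x) ∧
      Csizmazia.IsTranslationInvariantMetric (Csizmazia.dMetric x)) ∧
    (Csizmazia.CHat → Csizmazia.C5 → ∀ x : ℝ, 0 < x → x < 4 →
      Csizmazia.IsFiniteMetricNorm (Csizmazia.mNorm x) ∧
      Csizmazia.IsTranslationInvariantMetric (Csizmazia.dMetric x)) ∧
    (Csizmazia.CHat →
      (Csizmazia.bigA < ⊤ ∧
        Csizmazia.P0 Real.pi ≤ -Csizmazia.bigA.toReal + Csizmazia.cZero) →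
      ∀ x : ℝ, 0 < x → x < 4 →
      Csizmazia.IsFiniteMetricNorm (Csizmazia.mNorm x) ∧
      Csizmazia.IsTranslationInvariantMetric (Csizmazia.dMetric x)) := by
  have hd : ∀ {x : ℝ}, Csizmazia.IsFiniteMetricNorm (Csizmazia.mNorm x) →
      Csizmazia.IsFiniteMetricNorm (Csizmazia.mNorm x) ∧
      Csizmazia.IsTranslationInvariantMetric (Csizmazia.dMetric x) :=
    fun h => ⟨h, h.isTranslationInvariantMetric⟩
  refine ⟨fun x hx hx' => hd (Csizmazia.isFiniteMetricNorm_of_abs_gt_four hx hx'),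
    fun hC h5 x h0 h4 => hd ?_, fun hC ⟨hA, hP⟩ x h0 h4 => hd ?_⟩
  · have hc : 0 < Csizmazia.cZero := by
      linarith [h5.2.1, ENNReal.toReal_nonneg (a := Csizmazia.bigA)]
    exact Csizmazia.isFiniteMetricNorm_of_P0_nonneg hC.1 h5.1 hc
      (fun v hv => Csizmazia.P0_nonneg_of_C5 hC.1 h5 hv) h0 h4
  -- Here positivity of `c(0)` comes from `0 < P_0(π) ≤ c(0) - A`.
  · have hc : 0 < Csizmazia.cZero := by
      linarith [Csizmazia.P0_pos Real.pi_pos le_rfl,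
        ENNReal.toReal_nonneg (a := Csizmazia.bigA)]
    exact Csizmazia.isFiniteMetricNorm_of_P0_nonneg hC.1 hA hc
      (fun v hv => Csizmazia.P0_nonneg_of_ge hC.1 hA hP hc hv) h0 h4
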